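/- Let $f\in C^1(\mathbb R)$, $u_0\in \mathrm{BV}_{\mathrm{loc}}(\mathbb R)\cap L^\infty(\mathbb R)$, and let $u\in L^\infty(\mathbb R\times[0,\infty))$ be a weak solution of $\partial_t u+\partial_x f(u)=0$, $u(0)=u_0$, that is, $$\int_0^\infty\!\!\int_{\mathbb R} \big(u\,\partial_t\varphi+f(u)\,\partial_x\varphi\big)\,dx\,dt+\int_{\mathbb R}u_0(x)\varphi(x,0)\,dx=0\qquad\text{for all }\varphi\in C_c^\infty(\mathbb R\times[0,\infty)).$$ Assume that $u(\cdot,t)\in \mathrm{BV}_{\mathrm{loc}}(\mathbb R)$ for a.e. $t\ge 0$ (a function is in $\mathrm{BV}_{\mathrm{loc}}(\mathbb R)$ if it is locally integrable and its distributional derivative is a signed, locally finite Borel measure). For $c\in\mathbb R$ let $a_c(x,t)=\dfrac{f(u(x,t))-f(c)}{u(x,t)-c}$ if $u(x,t)\ne c$ and $a_c(x,t)=f'(c)$ if $u(x,t)=c$. Then the following are equivalent: (i) $u$ is the entropy solution, that is, $$\int_0^\infty\!\!\int_{\mathbb R} \big(\eta(u)\,\partial_t\varphi+q(u)\,\partial_x\varphi\big)\,dx\,dt+\int_{\mathbb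 R}\eta(u_0(x))\varphi(x,0)\,dx\ge 0$$ for all $0\le\varphi\in C_c^\infty(\mathbb R\times[0,\infty))$ and all entropy pairs $(\eta,q)$, i.e. $\eta:\mathbb R\to\mathbb R$ convex and $q:\mathbb R\to\mathbb R$ locally absolutely continuous with $q'=\eta' f'$ a.e. (ii) For every $c\in\mathbb R$, $x\in\mathbb R$ and $s\ge 0$, the problem $\dot x_t=a_c(x_t,t)$ for $t>s$, $x_s=x$, is well-posed in the Filippov sense, that is, there is exactly one locally absolutely continuous function $t\mapsto x_t$ on $[s,\infty)$ with $x_s=x$ and $$\lim_{\delta\downarrow0}\operatorname*{ess\,inf}_{|y-x_t|<\delta}a_c(y,t)\ \le\ \dot x_t\ \le\ \lim_{\delta\downarrow0}\operatorname*{ess\,sup}_{|y-x_t|<\delta}a_c(y,t)\qquad\text{for a.e. }t>s.$$ -/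

import Mathlib

open Set MeasureTheory
open scoped ContDiff ENNReal

noncomputable section

namespace ConsLaw

/-- `v ∈ BV_loc(ℝ)`: `v` is locally integrable and its distributional derivative is a signed Borel
measure that is finite on compact sets, written as the difference `μ - ν` of two positive locally
finite Borel measures. -/
def IsBVLoc (v : ℝ → ℝ) : Prop :=
  LocallyIntegrable v volume ∧
    ∃ μ ν : Measure ℝ, IsLocallyFiniteMeasure μ ∧ IsLocallyFiniteMeasure ν ∧
      ∀ φ : ℝ → ℝ, ContDiff ℝ ∞ φ → HasCompactSupport φ →
        ∫ x, v x * deriv φ x = -((∫ x, φ x ∂μ) - ∫ x, φ x ∂ν)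

/-- `u ∈ L^∞(ℝ × [0, ∞))`, for `u = u(x, t)`. The values of `u` at negative times are never used. -/
def IsBounded (u : ℝ → ℝ → ℝ) : Prop :=
  MemLp (Function.uncurry u) ∞ (volume.restrict (univ ×ˢ Ici (0 : ℝ)))

/-- Space-time test functions `φ = φ(x, t)`: smooth functions with compact support on the plane.
Their restrictions to `ℝ × [0, ∞)` are the elements of `C_c^∞(ℝ × [0, ∞))`; in particular they
need not vanish at `t = 0`. -/
def IsTest (φ : ℝ → ℝ → ℝ) : Prop :=
  ContDiff ℝ ∞ (Function.uncurry φ) ∧ HasCompactSupport (Function.uncurry φ)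

/-- The functional
`∫_{t ≥ 0} ∫_ℝ (η(u) ∂_t φ + q(u) ∂_x φ) dx dt + ∫_ℝ η(u₀(x)) φ(x, 0) dx`. -/
def weakForm (η q : ℝ → ℝ) (u₀ : ℝ → ℝ) (u : ℝ → ℝ → ℝ) (φ : ℝ → ℝ → ℝ) : ℝ :=
  (∫ t in Ici (0 : ℝ), ∫ x,
      (η (u x t) * deriv (fun τ => φ x τ) t + q (u x t) * deriv (fun y => φ y t) x)) +
    ∫ x, η (u₀ x) * φ x 0

/-- `u` satisfies `∂_t u + ∂_x f(u) = 0`, `u(0) = u₀` in the sense of distributions on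
`ℝ × [0, ∞)`. -/
def IsWeakSolution (f : ℝ → ℝ) (u₀ : ℝ → ℝ) (u : ℝ → ℝ → ℝ) : Prop :=
  ∀ φ : ℝ → ℝ → ℝ, IsTest φ → weakForm id f u₀ u φ = 0

/-- `(η, q)` is an entropy pair for the flux `f`: `η` is convex on `ℝ` and `q' = η' f'`. As a convex
function need not be differentiable everywhere, the equation reads: `q` is locally absolutely
continuous and `q' = η' f'` holds almost everywhere. This includes the pairs
`η(v) = |v - k|`, `q(v) = sgn(v - k) (f(v) - f(k))`. -/
def IsEntropyPair (f η q : ℝ → ℝ) : Prop :=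
  ConvexOn ℝ univ η ∧ (∀ a b : ℝ, AbsolutelyContinuousOnInterval q a b) ∧
    ∀ᵐ v : ℝ, HasDerivAt q (deriv η v * deriv f v) v

/-- `u` is the entropy solution of the conservation law with flux `f` and initial datum `u₀`: a weak
solution satisfying the entropy inequality for all entropy pairs and all test functions that are
nonnegative on `ℝ × [0, ∞)`. -/
def IsEntropySolution (f : ℝ → ℝ) (u₀ : ℝ → ℝ) (u : ℝ → ℝ → ℝ) : Prop :=
  IsWeakSolution f u₀ u ∧
    ∀ η q : ℝ → ℝ, IsEntropyPair f η q →
      ∀ φ : ℝ → ℝ → ℝ, IsTest φ → (∀ x t, 0 ≤ t → 0 ≤ φ x t) → 0 ≤ weakForm η q u₀ u φ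

/-- `A(v, c) = (f(v) - f(c)) / (v - c)` if `v ≠ c`, and `A(c, c) = f'(c)`. -/
def secantSpeed (f : ℝ → ℝ) (v c : ℝ) : ℝ :=
  if v = c then deriv f c else (f v - f c) / (v - c)

/-- The velocity field `a_c(x, t) = A(u(x, t), c)`. -/
def velocity (f : ℝ → ℝ) (u : ℝ → ℝ → ℝ) (c : ℝ) : ℝ → ℝ → ℝ :=
  fun x t => secantSpeed f (u x t) c

/-- The lower envelope `lim_{δ ↓ 0} ess inf_{y ∈ (x - δ, x + δ)} a(y, t)`, as an extended real
number. The essential infimum increases as `δ` decreases, so that the limit is the supremum over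
`δ > 0`. -/
def lowerEnvelope (a : ℝ → ℝ → ℝ) (x t : ℝ) : EReal :=
  ⨆ (δ : ℝ) (_ : 0 < δ),
    essInf (fun y => (a y t : EReal)) (volume.restrict (Ioo (x - δ) (x + δ)))

/-- The upper envelope `lim_{δ ↓ 0} ess sup_{y ∈ (x - δ, x + δ)} a(y, t)`, as an extended real
number. -/
def upperEnvelope (a : ℝ → ℝ → ℝ) (x t : ℝ) : EReal :=
  ⨅ (δ : ℝ) (_ : 0 < δ),
    essSup (fun y => (a y t : EReal)) (volume.restrict (Ioo (x - δ) (x + δ)))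

/-- `X : [s, ∞) → ℝ` is a Filippov solution of `Ẋ = a(X, t)` for `t > s`, `X(s) = x`: it is locally
absolutely continuous and its derivative lies between the two envelopes of `a` at almost every time.
The values of `X` before time `s` are irrelevant. -/
def IsFilippovSolution (a : ℝ → ℝ → ℝ) (x s : ℝ) (X : ℝ → ℝ) : Prop :=
  X s = x ∧ (∀ T, s ≤ T → AbsolutelyContinuousOnInterval X s T) ∧
    ∀ᵐ t : ℝ, s < t → ∃ w : ℝ, HasDerivAt X w t ∧
      lowerEnvelope a (X t) t ≤ (w : EReal) ∧ (w : EReal) ≤ upperEnvelope a (X t) t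

/-- The problem `Ẋ = a(X, t)` for `t > s`, `X(s) = x`, is well-posed in the Filippov sense: there is
exactly one Filippov solution on `[s, ∞)`. -/
def FilippovWellPosed (a : ℝ → ℝ → ℝ) (x s : ℝ) : Prop :=
  (∃ X, IsFilippovSolution a x s X) ∧
    ∀ X Y, IsFilippovSolution a x s X → IsFilippovSolution a x s Y → ∀ t, s ≤ t → X t = Y t

end ConsLaw

end

/-!
A bounded function with `BV_loc` time slices has a representative `U` that is right continuous with
left limits `UL` in `x` at every time (`exists_cadlagField`). For such a field the Filippov
envelopes are the minimum and maximum of the two one-sided limits, so that Filippov solutions are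
the Lipschitz curves of `FilippovCurve`; they exist by an Euler scheme, and well-posedness amounts
to uniqueness (`CadlagField.filippovWellPosed_iff`). Testing the equation and the entropy
inequalities with smoothed indicator functions of strips `X(t) < x < Y(t)` between Lipschitz curves
turns them into balance laws with one-sided traces (`weakLE_strip`), from which the Rankine–Hugoniot
condition and its entropy version on single curves follow.

*Entropy solutions have unique curves* (`FilippovCurve.eq_of_kruzkov`). Along a Filippov curve of
`a_c` the relative speed `Ẋ - a_c` has opposite signs on the two sides, while the entropy flux
`|u - c| (Ẋ - a_c)` does not decrease across the curve; hence `|u - c|` flows into the curve from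
both sides. If two curves separate from a common point, the mass of `|u - c|` between them is
therefore zero, so `u = c` there. The entropies `|u - k|` with `k` near `c` then show that the
left curve moves at least, and the right curve at most, with the characteristic speed `f'(c)`: the
curves cannot have separated.

*Unique curves give the entropy inequality* (`WeakField.kruzkov_of_unique`). Uniqueness produces a
continuous monotone flow. The last curve arriving at a point is approached by curves from the right,
so its speed is exactly `a_c` evaluated at the right trace, and the flux of `u` relative to it is
that of the constant `c`. Hence the flow transports the signed density `u - c`
(`WeakField.potential_flow`), and transport by a map can only cancel mass: `∫ |u - c| φ` at time `t`
is at most the integral of `φ` along the flow against `|u - c|` at the earlier time `s`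
(`WeakField.integral_abs_mul_le`). Letting `t - s` tend to zero yields the inequality for
`|u - c|`. The derivative of a convex entropy is monotone, hence a uniform limit of nonnegative
combinations of sign functions and constants, and all other entropy inequalities follow
(`WeakField.entropy_of_kruzkov`).
-/

namespace ConsLaw

open Filter Topology
open scoped NNReal Convolution

/-! ### Mollifiers on the line -/

/-- The standard bump supported in `[-1/(n+1), 1/(n+1)]`. -/
noncomputable def bump (n : ℕ) : ContDiffBump (0 : ℝ) where
  rIn := 1 / (2 * ((n : ℝ) + 1))
  rOut := 1 / ((n : ℝ) + 1)
  rIn_pos := by positivity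
  rIn_lt_rOut := by
    have h : (0 : ℝ) < n + 1 := by positivity
    apply one_div_lt_one_div_of_lt h
    linarith

/-- The mollifier: an even smooth probability density supported in `[-1/(n+1), 1/(n+1)]`. -/
noncomputable def moll (n : ℕ) (x : ℝ) : ℝ := (bump n).normed volume x

/-- The smooth step from `0` to `1` whose derivative is the mollifier. -/
noncomputable def step (n : ℕ) (x : ℝ) : ℝ := ∫ y in Iic x, moll n y

lemma moll_nonneg (n : ℕ) (x : ℝ) : 0 ≤ moll n x := (bump n).nonneg_normed x

lemma contDiff_moll (n : ℕ) : ContDiff ℝ ∞ (moll n) := (bump n).contDiff_normed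

lemma continuous_moll (n : ℕ) : Continuous (moll n) := (contDiff_moll n).continuous

lemma hasCompactSupport_moll (n : ℕ) : HasCompactSupport (moll n) :=
  (bump n).hasCompactSupport_normed

lemma integrable_moll (n : ℕ) : Integrable (moll n) := (bump n).integrable_normed

lemma integral_moll (n : ℕ) : ∫ x, moll n x = 1 := (bump n).integral_normed

lemma moll_neg (n : ℕ) (x : ℝ) : moll n (-x) = moll n x := (bump n).normed_neg x

lemma moll_eq_zero {n : ℕ} {x : ℝ} (h : 1 / ((n : ℝ) + 1) ≤ |x|) : moll n x = 0 := by
  have : x ∉ Function.support ((bump n).normed volume) := by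
    rw [(bump n).support_normed_eq]
    simpa [bump] using h
  simpa [moll] using this

lemma step_eq_zero {n : ℕ} {x : ℝ} (h : x ≤ -(1 / ((n : ℝ) + 1))) : step n x = 0 := by
  unfold step
  rw [setIntegral_congr_fun (g := fun _ => (0 : ℝ)) measurableSet_Iic]
  · simp
  · intro y hy
    have hy' : y ≤ x := hy
    apply moll_eq_zero
    rw [abs_of_nonpos]
    · linarith
    · have : (0 : ℝ) < 1 / ((n : ℝ) + 1) := by positivity
      linarith

lemma step_eq_one {n : ℕ} {x : ℝ} (h : 1 / ((n : ℝ) + 1) ≤ x) : step n x = 1 := by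
  unfold step
  rw [← integral_moll n]
  apply setIntegral_eq_integral_of_forall_compl_eq_zero
  intro y hy
  have hy' : x < y := by simpa using hy
  apply moll_eq_zero
  have := le_abs_self y
  linarith

lemma step_sub_step (n : ℕ) (x y : ℝ) : step n y - step n x = ∫ z in x..y, moll n z :=
  intervalIntegral.integral_Iic_sub_Iic (integrable_moll n).integrableOn
    (integrable_moll n).integrableOn

lemma hasDerivAt_step (n : ℕ) (x : ℝ) : HasDerivAt (step n) (moll n x) x := by
  have h : step n = fun y => step n 0 + ∫ z in (0 : ℝ)..y, moll n z := by
    funext y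
    rw [← step_sub_step]; ring
  rw [h]
  exact (intervalIntegral.integral_hasDerivAt_right
    ((continuous_moll n).intervalIntegrable _ _)
    ((continuous_moll n).stronglyMeasurableAtFilter _ _)
    (continuous_moll n).continuousAt).const_add _

lemma deriv_step (n : ℕ) : deriv (step n) = moll n := funext fun x => (hasDerivAt_step n x).deriv

lemma contDiff_step (n : ℕ) : ContDiff ℝ ∞ (step n) := by
  rw [contDiff_infty_iff_deriv, deriv_step]
  exact ⟨fun x => (hasDerivAt_step n x).differentiableAt, contDiff_moll n⟩

lemma step_mono (n : ℕ) : Monotone (step n) :=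
  monotone_of_deriv_nonneg (fun x => (hasDerivAt_step n x).differentiableAt)
    fun x => by rw [deriv_step]; exact moll_nonneg n x

lemma step_nonneg (n : ℕ) (x : ℝ) : 0 ≤ step n x :=
  setIntegral_nonneg measurableSet_Iic fun y _ => moll_nonneg n y

lemma step_le_one (n : ℕ) (x : ℝ) : step n x ≤ 1 := by
  rw [← integral_moll n]
  exact setIntegral_le_integral (integrable_moll n) (ae_of_all _ (moll_nonneg n))

lemma tendsto_step_of_pos {x : ℝ} (hx : 0 < x) : ∀ᶠ n in atTop, step n x = 1 := by
  have := (tendsto_one_div_add_atTop_nhds_zero_nat (𝕜 := ℝ)).eventually (gt_mem_nhds hx)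
  filter_upwards [this] with n hn
  exact step_eq_one hn.le

lemma tendsto_step_of_neg {x : ℝ} (hx : x < 0) : ∀ᶠ n in atTop, step n x = 0 := by
  have hx' : 0 < -x := by linarith
  have := (tendsto_one_div_add_atTop_nhds_zero_nat (𝕜 := ℝ)).eventually (gt_mem_nhds hx')
  filter_upwards [this] with n hn
  apply step_eq_zero
  linarith

/-- Mollifications of a locally integrable function converge almost everywhere. -/
lemma ae_tendsto_moll_sub {g : ℝ → ℝ} (hg : LocallyIntegrable g volume) :
    ∀ᵐ x, Tendsto (fun n => ∫ y, moll n y * g (x - y)) atTop (𝓝 (g x)) := by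
  have h := ContDiffBump.ae_convolution_tendsto_right_of_locallyIntegrable (μ := volume)
    (φ := bump) (l := atTop) (g := g) (K := 2)
    (tendsto_one_div_add_atTop_nhds_zero_nat (𝕜 := ℝ))
    (Eventually.of_forall fun n => by
      simp only [bump]
      apply le_of_eq
      field_simp) hg
  filter_upwards [h] with x hx
  exact hx

lemma integral_moll_sub_eq (n : ℕ) (g : ℝ → ℝ) (x : ℝ) :
    ∫ y, moll n (y - x) * g y = ∫ y, moll n y * g (x - y) := by
  rw [← integral_sub_left_eq_self (fun y => moll n (y - x) * g y) volume x]
  congr 1 with y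
  rw [show x - y - x = -y by ring, moll_neg]

lemma ae_tendsto_moll {g : ℝ → ℝ} (hg : LocallyIntegrable g volume) :
    ∀ᵐ x, Tendsto (fun n => ∫ y, moll n (y - x) * g y) atTop (𝓝 (g x)) := by
  filter_upwards [ae_tendsto_moll_sub hg] with x hx
  simpa only [integral_moll_sub_eq] using hx

/-! ### Functions of locally bounded variation -/

lemma hasCompactSupport_of_zero_off {E : Type*} [PseudoMetricSpace E] [ProperSpace E]
    {φ : E → ℝ} {z : E} {R : ℝ} (h : ∀ x, R < dist x z → φ x = 0) : HasCompactSupport φ := by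
  apply HasCompactSupport.of_support_subset_isCompact (isCompact_closedBall z R)
  intro x hx
  by_contra h'
  exact hx (h x (by simpa using h'))

/-- The smoothed indicator function of `[p, q]`. -/
noncomputable def plateau (n : ℕ) (p q x : ℝ) : ℝ := step n (x - p) - step n (x - q)

lemma contDiff_plateau (n : ℕ) (p q : ℝ) : ContDiff ℝ ∞ (plateau n p q) :=
  ((contDiff_step n).comp (contDiff_id.sub contDiff_const)).sub
    ((contDiff_step n).comp (contDiff_id.sub contDiff_const))

lemma deriv_plateau (n : ℕ) (p q x : ℝ) :
    deriv (plateau n p q) x = moll n (x - p) - moll n (x - q) := by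
  have h : ∀ p : ℝ, HasDerivAt (fun x => step n (x - p)) (moll n (x - p)) x := fun p =>
    (hasDerivAt_step n (x - p)).comp_sub_const x p
  exact ((h p).sub (h q)).deriv

lemma plateau_eq_zero {n : ℕ} {p q x : ℝ} (hpq : p ≤ q)
    (h : x ≤ p - 1 / ((n : ℝ) + 1) ∨ q + 1 / ((n : ℝ) + 1) ≤ x) : plateau n p q x = 0 := by
  unfold plateau
  rcases h with h | h
  · rw [step_eq_zero (by linarith), step_eq_zero (by linarith), sub_self]
  · rw [step_eq_one (by linarith), step_eq_one (by linarith), sub_self]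

lemma plateau_nonneg {n : ℕ} {p q : ℝ} (hpq : p ≤ q) (x : ℝ) : 0 ≤ plateau n p q x :=
  sub_nonneg.2 (step_mono n (by linarith))

lemma plateau_le_one {n : ℕ} {p q : ℝ} (x : ℝ) : plateau n p q x ≤ 1 := by
  have h1 := step_le_one n (x - p)
  have h2 := step_nonneg n (x - q)
  unfold plateau; linarith

lemma plateau_zero_off {n : ℕ} {p q x : ℝ} (hpq : p ≤ q) (h : x ∉ Icc (p - 1) (q + 1)) :
    plateau n p q x = 0 := by
  have hn : 1 / ((n : ℝ) + 1) ≤ 1 := by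
    rw [div_le_one (by positivity)]; linarith [(Nat.cast_nonneg n : (0 : ℝ) ≤ n)]
  apply plateau_eq_zero hpq
  by_contra h'
  push Not at h'
  exact h ⟨by linarith [h'.1], by linarith [h'.2]⟩

lemma hasCompactSupport_plateau (n : ℕ) {p q : ℝ} (hpq : p ≤ q) :
    HasCompactSupport (plateau n p q) := by
  apply HasCompactSupport.of_support_subset_isCompact (isCompact_Icc (a := p - 1) (b := q + 1))
  intro x hx
  by_contra h'
  exact hx (plateau_zero_off hpq h')

lemma tendsto_plateau {p q x : ℝ} (hp : x ≠ p) (hq : x ≠ q) (hpq : p ≤ q) :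
    Tendsto (fun n => plateau n p q x) atTop (𝓝 ((Ioc p q).indicator (fun _ => (1 : ℝ)) x)) := by
  apply tendsto_const_nhds.congr'
  rcases lt_or_gt_of_ne hp with h | h
  · filter_upwards [tendsto_step_of_neg (sub_neg.2 h),
      tendsto_step_of_neg (sub_neg.2 (h.trans_le hpq))] with n h1 h2
    rw [plateau, h1, h2, indicator_of_notMem (by simp [h.le])]; simp
  · rcases lt_or_gt_of_ne hq with h' | h'
    · filter_upwards [tendsto_step_of_pos (sub_pos.2 h),
        tendsto_step_of_neg (sub_neg.2 h')] with n h1 h2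
      rw [plateau, h1, h2, indicator_of_mem (by simp [h, h'.le])]; simp
    · filter_upwards [tendsto_step_of_pos (sub_pos.2 h),
        tendsto_step_of_pos (sub_pos.2 h')] with n h1 h2
      rw [plateau, h1, h2, indicator_of_notMem (by simp [h'])]; simp

lemma integral_deriv_plateau_mul {g : ℝ → ℝ} (hg : LocallyIntegrable g volume) (n : ℕ) (p q : ℝ) :
    ∫ x, deriv (plateau n p q) x * g x =
      (∫ x, moll n (x - p) * g x) - ∫ x, moll n (x - q) * g x := by
  have hi : ∀ p : ℝ, Integrable (fun x => moll n (x - p) * g x) := by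
    intro p
    refine hg.integrable_smul_left_of_hasCompactSupport (g := fun x => moll n (x - p)) ?_ ?_
    · exact (continuous_moll n).comp (continuous_id.sub continuous_const)
    · exact (hasCompactSupport_moll n).comp_homeomorph (Homeomorph.subRight p)
  rw [← integral_sub (hi p) (hi q)]
  congr 1 with x
  rw [deriv_plateau]; ring

lemma tendsto_integral_plateau (μ : Measure ℝ) [IsLocallyFiniteMeasure μ] {p q : ℝ} (hpq : p ≤ q)
    (hp : μ {p} = 0) (hq : μ {q} = 0) {g : ℝ → ℝ} (hg : LocallyIntegrable g μ) :
    Tendsto (fun n => ∫ x, plateau n p q x * g x ∂μ) atTop (𝓝 (∫ x in Ioc p q, g x ∂μ)) := by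
  rw [← integral_indicator measurableSet_Ioc]
  have hgi : IntegrableOn g (Icc (p - 1) (q + 1)) μ := hg.integrableOn_isCompact isCompact_Icc
  apply tendsto_integral_of_dominated_convergence
    (fun x => (Icc (p - 1) (q + 1)).indicator (fun x => |g x|) x)
  · intro n
    exact ((contDiff_plateau n p q).continuous.aestronglyMeasurable).mul hg.aestronglyMeasurable
  · exact (integrable_indicator_iff measurableSet_Icc).2 hgi.abs
  · intro n
    refine ae_of_all _ fun x => ?_
    by_cases hx : x ∈ Icc (p - 1) (q + 1)
    · rw [indicator_of_mem hx, norm_mul, Real.norm_eq_abs, Real.norm_eq_abs,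
        abs_of_nonneg (plateau_nonneg hpq x)]
      exact mul_le_of_le_one_left (abs_nonneg _) (plateau_le_one x)
    · rw [plateau_zero_off hpq hx, indicator_of_notMem hx]; simp
  · have h1 : ∀ᵐ x ∂μ, x ≠ p := by rw [ae_iff]; simpa using hp
    have h2 : ∀ᵐ x ∂μ, x ≠ q := by rw [ae_iff]; simpa using hq
    filter_upwards [h1, h2] with x hxp hxq
    have := (tendsto_plateau hxp hxq hpq).mul_const (g x)
    convert this using 2
    by_cases hx : x ∈ Ioc p q <;> simp [hx]

/-- The cumulative distribution of a measure, normalised to vanish at `z`. -/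
noncomputable def cumul (μ : Measure ℝ) (z x : ℝ) : ℝ :=
  if z ≤ x then μ.real (Ioc z x) else -μ.real (Ioc x z)

lemma measure_Ioc_ne_top (μ : Measure ℝ) [IsLocallyFiniteMeasure μ] (a b : ℝ) : μ (Ioc a b) ≠ ⊤ :=
  measure_Ioc_lt_top.ne

lemma cumul_mono (μ : Measure ℝ) [IsLocallyFiniteMeasure μ] (z : ℝ) : Monotone (cumul μ z) := by
  intro x y hxy
  unfold cumul
  split_ifs with h1 h2 h2
  · exact measureReal_mono (Ioc_subset_Ioc_right hxy) (measure_Ioc_ne_top μ _ _)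
  · exact absurd (h1.trans hxy) h2
  · exact (neg_nonpos.2 measureReal_nonneg).trans measureReal_nonneg
  · exact neg_le_neg (measureReal_mono (Ioc_subset_Ioc_left hxy) (measure_Ioc_ne_top μ _ _))

lemma ae_measure_singleton_eq_zero (μ : Measure ℝ) [IsLocallyFiniteMeasure μ] :
    ∀ᵐ x : ℝ, μ {x} = 0 := by
  have h : {x : ℝ | 0 < μ {x}}.Countable :=
    Measure.countable_meas_pos_of_disjoint_iUnion (μ := μ) (As := fun x : ℝ => {x})
      (fun x => measurableSet_singleton x) (fun x y hxy => by simpa using hxy)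
  filter_upwards [h.ae_notMem volume] with x hx
  simpa using hx

/-- A function of locally bounded variation agrees almost everywhere with a difference of two
monotone functions. -/
lemma IsBVLoc.exists_monotone {v : ℝ → ℝ} (hv : IsBVLoc v) :
    ∃ p q : ℝ → ℝ, Monotone p ∧ Monotone q ∧ v =ᵐ[volume] fun x => p x - q x := by
  obtain ⟨hloc, μ, ν, hμ, hν, h⟩ := hv
  -- Away from the atoms, testing with smoothed indicators identifies the increments of `v`.
  have key : ∀ x y : ℝ, x ≤ y → μ {x} = 0 → μ {y} = 0 → ν {x} = 0 → ν {y} = 0 →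
      Tendsto (fun n => ∫ w, moll n (w - x) * v w) atTop (𝓝 (v x)) →
      Tendsto (fun n => ∫ w, moll n (w - y) * v w) atTop (𝓝 (v y)) →
      v y - v x = μ.real (Ioc x y) - ν.real (Ioc x y) := by
    intro x y hxy h1 h2 h3 h4 h5 h6
    have e : ∀ n, (∫ w, moll n (w - x) * v w) - ∫ w, moll n (w - y) * v w =
        -((∫ w, plateau n x y w * 1 ∂μ) - ∫ w, plateau n x y w * 1 ∂ν) := by
      intro n
      rw [← integral_deriv_plateau_mul hloc]
      simp only [mul_one]
      rw [← h _ (contDiff_plateau n x y) (hasCompactSupport_plateau n hxy)]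
      simp only [mul_comm]
    have l1 := h5.sub h6
    have l2 := ((tendsto_integral_plateau μ hxy h1 h2 (locallyIntegrable_const (1 : ℝ))).sub
      (tendsto_integral_plateau ν hxy h3 h4 (locallyIntegrable_const (1 : ℝ)))).neg
    have := tendsto_nhds_unique l1 (l2.congr fun n => (e n).symm)
    simp at this
    linarith
  have hae : ∀ᵐ x, μ {x} = 0 ∧ ν {x} = 0 ∧
      Tendsto (fun n => ∫ w, moll n (w - x) * v w) atTop (𝓝 (v x)) := by
    filter_upwards [ae_measure_singleton_eq_zero μ, ae_measure_singleton_eq_zero ν,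
      ae_tendsto_moll hloc] with x h1 h2 h3 using ⟨h1, h2, h3⟩
  obtain ⟨z, hz1, hz2, hz3⟩ := hae.exists
  refine ⟨fun x => v z + cumul μ z x, cumul ν z, fun x y h => by
    have := cumul_mono μ z h
    simpa using this, cumul_mono ν z, ?_⟩
  filter_upwards [hae] with x ⟨h1, h2, h3⟩
  unfold cumul
  split_ifs with hzx
  · have := key z x hzx hz1 h1 hz2 h2 hz3 h3
    linarith
  · have := key x z (not_le.1 hzx).le h1 hz1 h2 hz2 h3 hz3
    linarith

/-! ### Differential inequalities on the half-line in the sense of distributions -/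

/-- The distributional inequality `m' ≤ F` on `[0, ∞)` with initial value `m₀`, tested against
smooth functions that are nonnegative on `[0, ∞)`. -/
def WeakLE (m F : ℝ → ℝ) (m₀ : ℝ) : Prop :=
  ∀ β : ℝ → ℝ, ContDiff ℝ ∞ β → HasCompactSupport β → (∀ t, 0 ≤ t → 0 ≤ β t) →
    0 ≤ (∫ t in Ici (0 : ℝ), (deriv β t * m t + β t * F t)) + β 0 * m₀

lemma locallyIntegrable_indicator {g : ℝ → ℝ} (hg : LocallyIntegrable g volume) {s : Set ℝ}
    (hs : MeasurableSet s) : LocallyIntegrable (s.indicator g) volume := by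
  intro x
  obtain ⟨U, hU, hi⟩ := hg x
  exact ⟨U, hU, hi.indicator hs⟩

lemma WeakLE.integral_plateau {m F : ℝ → ℝ} (hm : LocallyIntegrable m volume)
    (hF : LocallyIntegrable F volume) {n : ℕ} {p q : ℝ} (hpq : p ≤ q) :
    ∫ t in Ici (0 : ℝ), (deriv (plateau n p q) t * m t + plateau n p q t * F t) =
      ((∫ t, moll n (t - p) * (Ici (0 : ℝ)).indicator m t) -
        ∫ t, moll n (t - q) * (Ici (0 : ℝ)).indicator m t) +
      ∫ t, plateau n p q t * (Ici (0 : ℝ)).indicator F t := by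
  have hm' := locallyIntegrable_indicator hm (measurableSet_Ici (a := (0 : ℝ)))
  have hF' := locallyIntegrable_indicator hF (measurableSet_Ici (a := (0 : ℝ)))
  rw [← integral_deriv_plateau_mul hm', ← integral_indicator measurableSet_Ici, ← integral_add]
  · congr 1 with t
    by_cases ht : t ∈ Ici (0 : ℝ) <;> simp only [indicator_of_mem, indicator_of_notMem, ht,
      not_false_eq_true, mul_zero, add_zero]
  · refine hm'.integrable_smul_left_of_hasCompactSupport (g := deriv (plateau n p q)) ?_ ?_
    · exact (contDiff_plateau n p q).continuous_deriv (by simp)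
    · exact (hasCompactSupport_plateau n hpq).deriv
  · exact hF'.integrable_smul_left_of_hasCompactSupport (g := plateau n p q)
      (contDiff_plateau n p q).continuous (hasCompactSupport_plateau n hpq)

lemma setIntegral_Ioc_indicator_Ici {F : ℝ → ℝ} {p q : ℝ} (hp : 0 ≤ p) :
    ∫ t in Ioc p q, (Ici (0 : ℝ)).indicator F t = ∫ t in Ioc p q, F t := by
  apply setIntegral_congr_fun measurableSet_Ioc
  intro t ht
  exact indicator_of_mem (hp.trans ht.1.le : (0 : ℝ) ≤ t) F

lemma volume_singleton_zero (x : ℝ) : (volume : Measure ℝ) {x} = 0 := by simp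

/-- A distributional differential inequality can be integrated between almost all times. -/
lemma WeakLE.ae_le {m F : ℝ → ℝ} {m₀ : ℝ} (h : WeakLE m F m₀) (hm : LocallyIntegrable m volume)
    (hF : LocallyIntegrable F volume) :
    ∃ S : Set ℝ, (∀ᵐ t, t ∈ S) ∧ (∀ q ∈ S, 0 < q → m q ≤ m₀ + ∫ t in Ioc 0 q, F t) ∧
      ∀ p ∈ S, ∀ q ∈ S, 0 < p → p < q → m q - m p ≤ ∫ t in Ioc p q, F t := by
  have hm' := locallyIntegrable_indicator hm (measurableSet_Ici (a := (0 : ℝ)))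
  have hF' := locallyIntegrable_indicator hF (measurableSet_Ici (a := (0 : ℝ)))
  refine ⟨{q | Tendsto (fun n => ∫ y, moll n (y - q) * (Ici (0 : ℝ)).indicator m y) atTop
    (𝓝 ((Ici (0 : ℝ)).indicator m q))}, ae_tendsto_moll hm', ?_, ?_⟩
  · intro q hq hq0
    have hq : Tendsto (fun n => ∫ y, moll n (y - q) * (Ici (0 : ℝ)).indicator m y) atTop
      (𝓝 ((Ici (0 : ℝ)).indicator m q)) := hq
    rw [indicator_of_mem (mem_Ici.2 hq0.le) m] at hq
    -- On `[0, ∞)` the plateau between `-2` and `q` is a smoothed indicator of `[0, q]`.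
    have hpq : (-2 : ℝ) ≤ q := by linarith
    have e : ∀ᶠ n in atTop, 0 ≤ (-(∫ t, moll n (t - q) * (Ici (0 : ℝ)).indicator m t) +
      ∫ t, plateau n (-2) q t * (Ici (0 : ℝ)).indicator F t) + m₀ := by
      have := (tendsto_one_div_add_atTop_nhds_zero_nat (𝕜 := ℝ)).eventually (gt_mem_nhds hq0)
      filter_upwards [this] with n hn
      have h1 := h (plateau n (-2) q) (contDiff_plateau n _ _) (hasCompactSupport_plateau n hpq)
        (fun t _ => plateau_nonneg hpq t)
      rw [WeakLE.integral_plateau hm hF hpq] at h1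
      have hn1 : 1 / ((n : ℝ) + 1) ≤ 1 := by
        rw [div_le_one (by positivity)]; linarith [(Nat.cast_nonneg n : (0 : ℝ) ≤ n)]
      have h0 : plateau n (-2) q 0 = 1 := by
        rw [plateau, step_eq_one (by linarith), step_eq_zero (by linarith)]; simp
      have h2 : ∫ t, moll n (t - -2) * (Ici (0 : ℝ)).indicator m t = 0 := by
        apply integral_eq_zero_of_ae
        refine ae_of_all _ fun t => ?_
        by_cases ht : t ∈ Ici (0 : ℝ)
        · have ht' : (0 : ℝ) ≤ t := ht
          have : moll n (t - -2) = 0 := by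
            apply moll_eq_zero
            rw [abs_of_nonneg (by linarith)]; linarith
          simp only [this, zero_mul, Pi.zero_apply]
        · simp [indicator_of_notMem ht]
      rw [h0, h2] at h1
      linarith
    have l := ((hq.neg.add (tendsto_integral_plateau volume hpq (volume_singleton_zero _)
      (volume_singleton_zero _) hF')).add_const m₀)
    have := ge_of_tendsto l e
    have e2 : ∫ t in Ioc (-2) q, (Ici (0 : ℝ)).indicator F t = ∫ t in Ioc 0 q, F t := by
      rw [setIntegral_indicator measurableSet_Ici, ← integral_Icc_eq_integral_Ioc]
      congr 2
      ext t
      simp only [mem_inter_iff, mem_Ioc, mem_Ici, mem_Icc]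
      constructor
      · rintro ⟨⟨_, h2⟩, h3⟩; exact ⟨h3, h2⟩
      · rintro ⟨h1, h2⟩; exact ⟨⟨by linarith, h2⟩, h1⟩
    rw [e2] at this
    linarith
  · intro p hp q hq hp0 hpq
    have hp : Tendsto (fun n => ∫ y, moll n (y - p) * (Ici (0 : ℝ)).indicator m y) atTop
      (𝓝 ((Ici (0 : ℝ)).indicator m p)) := hp
    have hq : Tendsto (fun n => ∫ y, moll n (y - q) * (Ici (0 : ℝ)).indicator m y) atTop
      (𝓝 ((Ici (0 : ℝ)).indicator m q)) := hq
    rw [indicator_of_mem (mem_Ici.2 hp0.le) m] at hp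
    rw [indicator_of_mem (mem_Ici.2 (hp0.trans hpq).le) m] at hq
    have e : ∀ᶠ n in atTop, 0 ≤ ((∫ t, moll n (t - p) * (Ici (0 : ℝ)).indicator m t) -
        ∫ t, moll n (t - q) * (Ici (0 : ℝ)).indicator m t) +
      ∫ t, plateau n p q t * (Ici (0 : ℝ)).indicator F t := by
      have := (tendsto_one_div_add_atTop_nhds_zero_nat (𝕜 := ℝ)).eventually (gt_mem_nhds hp0)
      filter_upwards [this] with n hn
      have h1 := h (plateau n p q) (contDiff_plateau n _ _) (hasCompactSupport_plateau n hpq.le)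
        (fun t _ => plateau_nonneg hpq.le t)
      rw [WeakLE.integral_plateau hm hF hpq.le,
        plateau_eq_zero hpq.le (Or.inl (by linarith))] at h1
      linarith
    have l := (hp.sub hq).add (tendsto_integral_plateau volume hpq.le (volume_singleton_zero _)
      (volume_singleton_zero _) hF')
    have := ge_of_tendsto l e
    rw [setIntegral_Ioc_indicator_Ici hp0.le] at this
    linarith

lemma frequently_nhdsGT_of_ae {P : ℝ → Prop} (h : ∀ᵐ t, P t) (p : ℝ) : ∃ᶠ q in 𝓝[>] p, P q := by
  intro hn
  obtain ⟨u, hu, hsub⟩ := mem_nhdsGT_iff_exists_Ioo_subset.1 hn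
  obtain ⟨x, hx, hxP⟩ := (Measure.dense_of_ae h).exists_mem_open isOpen_Ioo
    (nonempty_Ioo.2 (mem_Ioi.1 hu))
  exact hsub hxP hx

/-- Lebesgue differentiation with right-hand averages. -/
lemma ae_tendsto_average_right {F : ℝ → ℝ} (hF : LocallyIntegrable F volume) :
    ∀ᵐ p, Tendsto (fun q => (q - p)⁻¹ * ∫ t in Ioc p q, F t) (𝓝[>] p) (𝓝 (F p)) := by
  filter_upwards [_root_.LocallyIntegrable.ae_hasDerivAt_integral hF] with p hp
  have h1 := ((hasDerivAt_iff_tendsto_slope.1 (hp p)).mono_left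
    (nhdsWithin_mono p (fun q (hq : p < q) => hq.ne')))
  apply h1.congr'
  filter_upwards [self_mem_nhdsWithin] with q hq
  have hq : p < q := hq
  rw [slope_def_field, intervalIntegral.integral_same, sub_zero,
    intervalIntegral.integral_of_le hq.le, div_eq_inv_mul]

/-- If `m' ≤ F` holds for `m = 0`, then `F` is nonnegative. -/
lemma WeakLE.ae_nonneg {F : ℝ → ℝ} (h : WeakLE (fun _ => 0) F 0)
    (hF : LocallyIntegrable F volume) : ∀ᵐ t, 0 < t → 0 ≤ F t := by
  obtain ⟨S, hS, -, h2⟩ := h.ae_le (locallyIntegrable_const 0) hF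
  filter_upwards [hS, ae_tendsto_average_right hF] with p hp hlim hp0
  refine isClosed_Ici.mem_of_frequently_of_tendsto ?_ hlim
  refine ((frequently_nhdsGT_of_ae hS p).and_eventually self_mem_nhdsWithin).mono ?_
  rintro q ⟨hq, hpq⟩
  have hpq : p < q := hpq
  have := h2 p hp q hq hp0 hpq
  exact mul_nonneg (inv_nonneg.2 (sub_nonneg.2 hpq.le)) (by linarith)

/-! ### Smoothing of Lipschitz curves -/

/-- Mollification of a curve. -/
noncomputable def smoothed (X : ℝ → ℝ) (n : ℕ) (t : ℝ) : ℝ := ∫ y, moll n y * X (t - y)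

lemma integrable_moll_mul {g : ℝ → ℝ} (hg : LocallyIntegrable g volume) (n : ℕ) (t : ℝ) :
    Integrable (fun y => moll n y * g (t - y)) := by
  have h : Integrable (fun y => moll n (y - t) * g y) :=
    hg.integrable_smul_left_of_hasCompactSupport (g := fun x => moll n (x - t))
      ((continuous_moll n).comp (continuous_id.sub continuous_const))
      ((hasCompactSupport_moll n).comp_homeomorph (Homeomorph.subRight t))
  refine (h.comp_sub_left t).congr (ae_of_all _ fun y => ?_)
  simp only
  rw [show t - y - t = -y by ring, moll_neg]

lemma contDiff_smoothed {X : ℝ → ℝ} (hX : Continuous X) (n : ℕ) :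
    ContDiff ℝ ∞ (smoothed X n) :=
  (hasCompactSupport_moll n).contDiff_convolution_left (ContinuousLinearMap.lsmul ℝ ℝ)
    (contDiff_moll n) hX.locallyIntegrable

lemma smoothed_mono {X Y : ℝ → ℝ} (hX : Continuous X) (hY : Continuous Y) (h : ∀ t, X t ≤ Y t)
    (n : ℕ) (t : ℝ) : smoothed X n t ≤ smoothed Y n t :=
  integral_mono (integrable_moll_mul hX.locallyIntegrable n t)
    (integrable_moll_mul hY.locallyIntegrable n t)
    fun y => mul_le_mul_of_nonneg_left (h _) (moll_nonneg n y)

lemma abs_smoothed_sub_le {X : ℝ → ℝ} {L : ℝ≥0} (hX : LipschitzWith L X) (n : ℕ) (t : ℝ) :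
    |smoothed X n t - X t| ≤ L * (1 / ((n : ℝ) + 1)) := by
  have h1 : X t = ∫ y, moll n y * X t := by rw [integral_mul_const, integral_moll, one_mul]
  have h2 : smoothed X n t - X t = ∫ y, moll n y * (X (t - y) - X t) := by
    conv_lhs => rw [h1]
    rw [smoothed, ← integral_sub (integrable_moll_mul hX.continuous.locallyIntegrable n t)
      ((integrable_moll n).mul_const _)]
    simp only [mul_sub]
  rw [h2, ← Real.norm_eq_abs]
  calc ‖∫ y, moll n y * (X (t - y) - X t)‖
      ≤ ∫ y, moll n y * (L * (1 / ((n : ℝ) + 1))) := by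
        apply norm_integral_le_of_norm_le ((integrable_moll n).mul_const _)
        refine ae_of_all _ fun y => ?_
        rw [norm_mul, Real.norm_of_nonneg (moll_nonneg n y)]
        by_cases hy : 1 / ((n : ℝ) + 1) ≤ |y|
        · simp [moll_eq_zero hy]
        · apply mul_le_mul_of_nonneg_left _ (moll_nonneg n y)
          have := hX.norm_sub_le (t - y) t
          simp only [sub_sub_cancel_left, norm_neg, Real.norm_eq_abs] at this ⊢
          exact this.trans (mul_le_mul_of_nonneg_left (not_le.1 hy).le L.2)
    _ = _ := by rw [integral_mul_const, integral_moll, one_mul]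

lemma abs_deriv_le_of_lipschitzWith {X : ℝ → ℝ} {L : ℝ≥0} (hX : LipschitzWith L X) (t : ℝ) :
    |deriv X t| ≤ L := by
  rw [← Real.norm_eq_abs]
  exact norm_deriv_le_of_lipschitz hX

lemma locallyIntegrable_of_abs_le {g : ℝ → ℝ} (hg : Measurable g) {C : ℝ} (h : ∀ t, |g t| ≤ C) :
    LocallyIntegrable g volume := by
  apply (locallyIntegrable_const C).mono hg.aestronglyMeasurable
  refine ae_of_all _ fun t => ?_
  rw [Real.norm_eq_abs, Real.norm_eq_abs]
  exact (h t).trans (le_abs_self C)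

lemma locallyIntegrable_deriv {X : ℝ → ℝ} {L : ℝ≥0} (hX : LipschitzWith L X) :
    LocallyIntegrable (deriv X) volume :=
  locallyIntegrable_of_abs_le (measurable_deriv X) (abs_deriv_le_of_lipschitzWith hX)

lemma hasDerivAt_smoothed {X : ℝ → ℝ} {L : ℝ≥0} (hX : LipschitzWith L X) (n : ℕ) (t : ℝ) :
    HasDerivAt (smoothed X n) (∫ y, moll n y * deriv X (t - y)) t := by
  have hd : ∀ᵐ y, DifferentiableAt ℝ X (t - y) := by
    have := hX.ae_differentiableAt_real
    exact (Measure.measurePreserving_sub_left volume t).quasiMeasurePreserving.ae this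
  refine (hasDerivAt_integral_of_dominated_loc_of_lip
    (F := fun t y => moll n y * X (t - y)) (F' := fun y => moll n y * deriv X (t - y))
    (bound := fun y => moll n y * L) (s := univ) (x₀ := t) Filter.univ_mem ?_ ?_ ?_ ?_ ?_ ?_).2
  · exact Eventually.of_forall fun s =>
      (integrable_moll_mul hX.continuous.locallyIntegrable n s).aestronglyMeasurable
  · exact integrable_moll_mul hX.continuous.locallyIntegrable n t
  · exact (integrable_moll_mul (locallyIntegrable_deriv hX) n t).aestronglyMeasurable
  · refine ae_of_all _ fun y => ?_
    apply LipschitzWith.lipschitzOnWith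
    apply LipschitzWith.of_dist_le_mul
    intro a b
    have := hX.dist_le_mul (a - y) (b - y)
    rw [dist_sub_right] at this
    rw [Real.dist_eq, ← mul_sub, abs_mul, abs_of_nonneg (moll_nonneg n y), ← Real.dist_eq,
      Real.coe_nnabs, abs_of_nonneg (mul_nonneg (moll_nonneg n y) L.coe_nonneg), mul_assoc]
    exact mul_le_mul_of_nonneg_left this (moll_nonneg n y)
  · exact (integrable_moll n).mul_const _
  · filter_upwards [hd] with y hy
    exact (hy.hasDerivAt.comp_sub_const t y).const_mul _

lemma abs_deriv_smoothed_le {X : ℝ → ℝ} {L : ℝ≥0} (hX : LipschitzWith L X) (n : ℕ) (t : ℝ) :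
    |deriv (smoothed X n) t| ≤ L := by
  rw [(hasDerivAt_smoothed hX n t).deriv, ← Real.norm_eq_abs]
  calc ‖∫ y, moll n y * deriv X (t - y)‖ ≤ ∫ y, moll n y * L := by
        apply norm_integral_le_of_norm_le ((integrable_moll n).mul_const _)
        refine ae_of_all _ fun y => ?_
        rw [norm_mul, Real.norm_of_nonneg (moll_nonneg n y)]
        exact mul_le_mul_of_nonneg_left (abs_deriv_le_of_lipschitzWith hX _) (moll_nonneg n y)
    _ = L := by rw [integral_mul_const, integral_moll, one_mul]

lemma ae_tendsto_deriv_smoothed {X : ℝ → ℝ} {L : ℝ≥0} (hX : LipschitzWith L X) :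
    ∀ᵐ t, Tendsto (fun n => deriv (smoothed X n) t) atTop (𝓝 (deriv X t)) := by
  filter_upwards [ae_tendsto_moll_sub (locallyIntegrable_deriv hX)] with t ht
  simpa only [(hasDerivAt_smoothed hX _ t).deriv] using ht

/-! ### The right-continuous representative in space -/

lemma frequently_nhdsLT_of_ae {P : ℝ → Prop} (h : ∀ᵐ t, P t) (p : ℝ) : ∃ᶠ q in 𝓝[<] p, P q := by
  intro hn
  obtain ⟨u, hu, hsub⟩ := mem_nhdsLT_iff_exists_Ioo_subset.1 hn
  obtain ⟨x, hx, hxP⟩ := (Measure.dense_of_ae h).exists_mem_open isOpen_Ioo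
    (nonempty_Ioo.2 (mem_Iio.1 hu))
  exact hsub hxP hx

lemma tendsto_rightLim_nhdsGT {p : ℝ → ℝ} (hp : Monotone p) (x : ℝ) :
    Tendsto (Function.rightLim p) (𝓝[>] x) (𝓝 (Function.rightLim p x)) := by
  have := (hp.stieltjesFunction.right_continuous x).tendsto
  exact this.mono_left (nhdsWithin_mono x Ioi_subset_Ici_self)

lemma tendsto_rightLim_nhdsLT {p : ℝ → ℝ} (hp : Monotone p) (x : ℝ) :
    Tendsto (Function.rightLim p) (𝓝[<] x) (𝓝 (Function.leftLim p x)) := by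
  apply tendsto_of_tendsto_of_tendsto_of_le_of_le' (hp.tendsto_leftLim x) tendsto_const_nhds
  · exact Eventually.of_forall fun y => hp.le_rightLim le_rfl
  · filter_upwards [self_mem_nhdsWithin] with y hy
    exact hp.rightLim_le_leftLim hy

lemma ae_leftLim_eq_rightLim {p : ℝ → ℝ} (hp : Monotone p) :
    ∀ᵐ x, Function.leftLim p x = Function.rightLim p x := by
  filter_upwards [hp.countable_not_continuousAt.ae_notMem volume] with x hx
  have hx : ContinuousAt p x := by simpa using hx
  exact hp.continuousAt_iff_leftLim_eq_rightLim.1 hx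

/-- A bounded function of locally bounded variation has a right-continuous representative with left
limits. -/
lemma IsBVLoc.exists_cadlag {v : ℝ → ℝ} (hv : IsBVLoc v) {M : ℝ} (hM : ∀ᵐ x, |v x| ≤ M) :
    ∃ G Gl : ℝ → ℝ, Measurable G ∧ v =ᵐ[volume] G ∧ (∀ x, |G x| ≤ M) ∧ (∀ x, |Gl x| ≤ M) ∧
      (∀ x, Tendsto G (𝓝[>] x) (𝓝 (G x))) ∧ (∀ x, Tendsto G (𝓝[<] x) (𝓝 (Gl x))) ∧
      ∀ᵐ x, Gl x = G x := by
  obtain ⟨p, q, hp, hq, hpq⟩ := hv.exists_monotone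
  set G : ℝ → ℝ := fun x => Function.rightLim p x - Function.rightLim q x with hG
  have hR : ∀ x, Tendsto G (𝓝[>] x) (𝓝 (G x)) := fun x =>
    (tendsto_rightLim_nhdsGT hp x).sub (tendsto_rightLim_nhdsGT hq x)
  have hL : ∀ x, Tendsto G (𝓝[<] x) (𝓝 (Function.leftLim p x - Function.leftLim q x)) := fun x =>
    (tendsto_rightLim_nhdsLT hp x).sub (tendsto_rightLim_nhdsLT hq x)
  have hvG : v =ᵐ[volume] G := by
    filter_upwards [hpq, hp.countable_not_continuousAt.ae_notMem volume,
      hq.countable_not_continuousAt.ae_notMem volume] with x hx h1 h2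
    have h1 : ContinuousAt p x := by simpa using h1
    have h2 : ContinuousAt q x := by simpa using h2
    rw [hx, hG]
    simp only
    rw [h1.continuousWithinAt.rightLim_eq, h2.continuousWithinAt.rightLim_eq]
  have hGM : ∀ᵐ x, G x ∈ Icc (-M) M := by
    filter_upwards [hvG, hM] with x h1 h2
    rw [← h1]; exact abs_le.1 h2
  refine ⟨G, _, hp.rightLim.measurable.sub hq.rightLim.measurable, hvG, ?_, ?_, hR, hL, ?_⟩
  · intro x
    exact abs_le.2 (isClosed_Icc.mem_of_frequently_of_tendsto (frequently_nhdsGT_of_ae hGM x) (hR x))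
  · intro x
    exact abs_le.2 (isClosed_Icc.mem_of_frequently_of_tendsto (frequently_nhdsLT_of_ae hGM x) (hL x))
  · filter_upwards [ae_leftLim_eq_rightLim hp, ae_leftLim_eq_rightLim hq] with x h1 h2
    simp only [hG, h1, h2]

/-- A bounded, jointly measurable function `U(x, t)` that is right-continuous in `x` at every time,
together with its left limits `UL`. -/
structure CadlagField (M : ℝ) (U UL : ℝ → ℝ → ℝ) : Prop where
  measurable : Measurable (Function.uncurry U)
  measurable_left : Measurable (Function.uncurry UL)
  abs_le : ∀ x t, |U x t| ≤ M
  abs_left_le : ∀ x t, |UL x t| ≤ M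
  tendsto_right : ∀ x t, Tendsto (fun y => U y t) (𝓝[>] x) (𝓝 (U x t))
  tendsto_left : ∀ x t, Tendsto (fun y => U y t) (𝓝[<] x) (𝓝 (UL x t))
  ae_left_eq : ∀ t, ∀ᵐ x, UL x t = U x t

lemma ae_comp_affine {P : ℝ → Prop} (h : ∀ᵐ z, P z) {a : ℝ} (ha : a ≠ 0) (x : ℝ) :
    ∀ᵐ y, P (x + a * y) := by
  have h1 : ∀ᵐ z, P (x + z) :=
    (measurePreserving_add_left volume x).quasiMeasurePreserving.ae h
  have h2 : Measure.QuasiMeasurePreserving (fun y : ℝ => a * y) volume volume := by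
    refine ⟨measurable_const_mul a, ?_⟩
    rw [Real.map_volume_mul_left ha]
    exact Measure.smul_absolutelyContinuous
  exact h2.ae h1

/-- Rescaled averages on one side of `x` converge to the one-sided limit. -/
lemma tendsto_average_affine {v G : ℝ → ℝ} (hvG : v =ᵐ[volume] G) (hG : Measurable G) {M : ℝ}
    (hM : ∀ x, |G x| ≤ M) {x l : ℝ} {a : ℕ → ℝ} (ha : ∀ n, a n ≠ 0) {F : Filter ℝ}
    (hF : ∀ y ∈ Ioc (0 : ℝ) 1, Tendsto (fun n => x + a n * y) atTop F)
    (hl : Tendsto G F (𝓝 l)) :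
    Tendsto (fun n => ∫ y in Ioc (0 : ℝ) 1, v (x + a n * y)) atTop (𝓝 l) := by
  have e : ∀ n, ∫ y in Ioc (0 : ℝ) 1, G (x + a n * y) = ∫ y in Ioc (0 : ℝ) 1, v (x + a n * y) :=
    fun n => integral_congr_ae (ae_restrict_of_ae
      ((ae_comp_affine hvG (ha n) x).mono fun y hy => hy.symm))
  refine Tendsto.congr e ?_
  have hc : ∫ _ in Ioc (0 : ℝ) 1, l = l := by simp
  rw [← hc]
  apply tendsto_integral_of_dominated_convergence (fun _ => M)
  · intro n
    exact (hG.comp (by fun_prop)).aestronglyMeasurable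
  · simp
  · exact fun n => ae_of_all _ fun y => hM _
  · filter_upwards [ae_restrict_mem measurableSet_Ioc] with y hy
    exact hl.comp (hF y hy)

lemma ae_ae_of_halfplane {P : ℝ → ℝ → Prop}
    (h : ∀ᵐ p : ℝ × ℝ ∂(volume.restrict (univ ×ˢ Ici (0 : ℝ))), P p.1 p.2) :
    ∀ᵐ t : ℝ, 0 ≤ t → ∀ᵐ x : ℝ, P x t := by
  have e : (volume : Measure (ℝ × ℝ)).restrict (univ ×ˢ Ici (0 : ℝ)) =
      (volume : Measure ℝ).prod ((volume : Measure ℝ).restrict (Ici 0)) := by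
    rw [Measure.volume_eq_prod, ← Measure.prod_restrict, Measure.restrict_univ]
  rw [e] at h
  have h2 : ∀ᵐ p : ℝ × ℝ ∂(((volume : Measure ℝ).restrict (Ici 0)).prod volume), P p.2 p.1 :=
    (Measure.measurePreserving_swap (μ := (volume : Measure ℝ).restrict (Ici 0))
      (ν := (volume : Measure ℝ))).quasiMeasurePreserving.ae h
  have h3 := Measure.ae_ae_of_ae_prod h2
  rwa [ae_restrict_iff' measurableSet_Ici] at h3

lemma IsBounded.ae_abs_le {u : ℝ → ℝ → ℝ} (hu : IsBounded u) :
    ∃ M : ℝ, 0 ≤ M ∧ ∃ w : ℝ × ℝ → ℝ, Measurable w ∧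
      ∀ᵐ t : ℝ, 0 ≤ t → ∀ᵐ x : ℝ, u x t = w (x, t) ∧ |u x t| ≤ M := by
  obtain ⟨h1, h2⟩ := hu
  refine ⟨(eLpNorm (Function.uncurry u) ⊤ (volume.restrict (univ ×ˢ Ici (0 : ℝ)))).toReal,
    ENNReal.toReal_nonneg, h1.mk _, h1.stronglyMeasurable_mk.measurable, ?_⟩
  apply ae_ae_of_halfplane (P := fun x t => u x t = h1.mk _ (x, t) ∧ |u x t| ≤ _)
  have h3 := ae_le_eLpNormEssSup (f := Function.uncurry u)
    (μ := volume.restrict (univ ×ˢ Ici (0 : ℝ)))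
  filter_upwards [h1.ae_eq_mk, h3] with p hp1 hp2
  refine ⟨hp1, ?_⟩
  rw [← eLpNorm_exponent_top] at hp2
  have := ENNReal.toReal_mono h2.ne hp2
  simpa [Function.uncurry] using this

lemma tendsto_affine_nhdsGT (x : ℝ) {y : ℝ} (hy : 0 < y) :
    Tendsto (fun n : ℕ => x + 1 / ((n : ℝ) + 1) * y) atTop (𝓝[>] x) := by
  apply tendsto_nhdsWithin_of_tendsto_nhds_of_eventually_within
  · simpa using ((tendsto_one_div_add_atTop_nhds_zero_nat (𝕜 := ℝ)).mul_const y).const_add x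
  · refine Eventually.of_forall fun n => ?_
    simp only [mem_Ioi]
    have : 0 < 1 / ((n : ℝ) + 1) * y := by positivity
    linarith

lemma tendsto_affine_nhdsLT (x : ℝ) {y : ℝ} (hy : 0 < y) :
    Tendsto (fun n : ℕ => x + -(1 / ((n : ℝ) + 1)) * y) atTop (𝓝[<] x) := by
  apply tendsto_nhdsWithin_of_tendsto_nhds_of_eventually_within
  · simpa using ((tendsto_one_div_add_atTop_nhds_zero_nat (𝕜 := ℝ)).neg.mul_const y).const_add x
  · refine Eventually.of_forall fun n => ?_
    simp only [mem_Iio]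
    have : 0 < 1 / ((n : ℝ) + 1) * y := by positivity
    linarith

/-- A bounded function of space and time whose time slices have locally bounded variation agrees
with a `CadlagField` on almost every slice. -/
theorem exists_cadlagField {u : ℝ → ℝ → ℝ} (hu : IsBounded u)
    (hbv : ∀ᵐ t : ℝ, 0 ≤ t → IsBVLoc (fun x => u x t)) :
    ∃ (M : ℝ) (U UL : ℝ → ℝ → ℝ), 0 ≤ M ∧ CadlagField M U UL ∧
      ∀ᵐ t : ℝ, 0 ≤ t → (fun x => u x t) =ᵐ[volume] fun x => U x t := by
  obtain ⟨M, hM0, w, hw, huw⟩ := hu.ae_abs_le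
  have hgood : ∀ᵐ t : ℝ, 0 ≤ t → ∃ G Gl : ℝ → ℝ, Measurable G ∧
      ((fun x => u x t) =ᵐ[volume] G ∧ (fun x => w (x, t)) =ᵐ[volume] G) ∧
      (∀ x, |G x| ≤ M) ∧ (∀ x, |Gl x| ≤ M) ∧
      (∀ x, Tendsto G (𝓝[>] x) (𝓝 (G x))) ∧ (∀ x, Tendsto G (𝓝[<] x) (𝓝 (Gl x))) ∧
      ∀ᵐ x, Gl x = G x := by
    filter_upwards [huw, hbv] with t h1 h2 ht
    obtain ⟨G, Gl, h3, h4, h5, h6, h7, h8, h9⟩ :=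
      (h2 ht).exists_cadlag ((h1 ht).mono fun x hx => hx.2)
    refine ⟨G, Gl, h3, ⟨h4, ?_⟩, h5, h6, h7, h8, h9⟩
    filter_upwards [h1 ht, h4] with x hx1 hx2
    rw [← hx1.1, hx2]
  -- A measurable set of good times of full measure; elsewhere the representative is set to `0`.
  obtain ⟨N, hN1, hN2, hN3⟩ := exists_measurable_superset_of_null (ae_iff.1 hgood)
  set S : Set ℝ := Nᶜ ∩ Ici 0 with hS
  have hSm : MeasurableSet S := hN2.compl.inter measurableSet_Ici
  have hSgood : ∀ t ∈ S, _ := fun t ht => by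
    have h : t ∉ {a | ¬_} := fun h => ht.1 (hN1 h)
    exact not_not.1 h ht.2
  choose! G Gl h1 h2 h3 h4 h5 h6 h7 using hSgood
  have key : ∀ (a : ℕ → ℝ), (∀ n, a n ≠ 0) → ∀ (K : ℝ → ℝ → ℝ),
      (∀ x t, t ∈ S → Tendsto (fun n => ∫ y in Ioc (0 : ℝ) 1, w (x + a n * y, t)) atTop
        (𝓝 (K t x))) →
      Measurable (Function.uncurry fun x t => S.indicator (fun t => K t x) t) := by
    intro a ha K hK
    have hm : ∀ n, Measurable (fun p : ℝ × ℝ =>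
        (univ ×ˢ S).indicator (fun p => ∫ y in Ioc (0 : ℝ) 1, w (p.1 + a n * y, p.2)) p) := by
      intro n
      apply Measurable.indicator _ (MeasurableSet.univ.prod hSm)
      have : StronglyMeasurable fun q : (ℝ × ℝ) × ℝ => w (q.1.1 + a n * q.2, q.1.2) :=
        (hw.comp (by fun_prop)).stronglyMeasurable
      exact this.integral_prod_right'.measurable
    refine measurable_of_tendsto_metrizable hm ?_
    rw [tendsto_pi_nhds]
    rintro ⟨x, t⟩
    by_cases ht : t ∈ S
    · have e : ((x, t) : ℝ × ℝ) ∈ (univ : Set ℝ) ×ˢ S := ⟨mem_univ _, ht⟩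
      simpa [Function.uncurry, e, ht] using hK x t ht
    · simp [Function.uncurry, ht]
  refine ⟨M, fun x t => S.indicator (fun t => G t x) t, fun x t => S.indicator (fun t => Gl t x) t,
    hM0, ⟨?_, ?_, ?_, ?_, ?_, ?_, ?_⟩, ?_⟩
  · refine key (fun n => 1 / ((n : ℝ) + 1)) (fun n => by positivity) G fun x t ht => ?_
    exact tendsto_average_affine (v := fun x => w (x, t)) (h2 t ht).2 (h1 t ht) (h3 t ht)
      (fun n => by positivity) (fun y hy => tendsto_affine_nhdsGT x hy.1) (h5 t ht x)
  · refine key (fun n => -(1 / ((n : ℝ) + 1))) (fun n => neg_ne_zero.2 (by positivity)) Gl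
      fun x t ht => ?_
    exact tendsto_average_affine (v := fun x => w (x, t)) (h2 t ht).2 (h1 t ht) (h3 t ht)
      (fun n => neg_ne_zero.2 (by positivity)) (fun y hy => tendsto_affine_nhdsLT x hy.1)
      (h6 t ht x)
  · intro x t
    by_cases ht : t ∈ S
    · simpa [ht] using h3 t ht x
    · simpa [ht] using hM0
  · intro x t
    by_cases ht : t ∈ S
    · simpa [ht] using h4 t ht x
    · simpa [ht] using hM0
  · intro x t
    by_cases ht : t ∈ S
    · simpa [ht] using h5 t ht x
    · simp [ht]
  · intro x t
    by_cases ht : t ∈ S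
    · simpa [ht] using h6 t ht x
    · simp [ht]
  · intro t
    by_cases ht : t ∈ S
    · simpa [ht] using h7 t ht
    · simp [ht]
  · have : ∀ᵐ t, t ∉ N := by rw [ae_iff]; simpa using hN3
    filter_upwards [this] with t ht ht0
    have hts : t ∈ S := ⟨ht, ht0⟩
    simpa [hts] using (h2 t hts).1

/-- The weak form only depends on almost every time slice. -/
lemma weakForm_congr {u U : ℝ → ℝ → ℝ}
    (h : ∀ᵐ t : ℝ, 0 ≤ t → (fun x => u x t) =ᵐ[volume] fun x => U x t)
    (η q u₀ : ℝ → ℝ) (φ : ℝ → ℝ → ℝ) : weakForm η q u₀ u φ = weakForm η q u₀ U φ := by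
  unfold weakForm
  congr 1
  apply setIntegral_congr_ae measurableSet_Ici
  filter_upwards [h] with t ht ht0
  apply integral_congr_ae
  filter_upwards [ht ht0] with x hx
  have hx : u x t = U x t := hx
  simp only [hx]

/-! ### Entropy balance in strips between Lipschitz curves -/

/-- The flux of `η` through a curve of speed `w` carrying the trace `v`. -/
def traceFlux (η q : ℝ → ℝ) (v w : ℝ) : ℝ := η v * w - q v

lemma integral_moll_rescale (g : ℝ → ℝ) {N : ℝ} (hN : 0 < N) (z k : ℝ) :
    ∫ x, N * moll 0 (N * (x - z) - k) * g x = ∫ y, moll 0 y * g (z + (y + k) / N) := by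
  have h1 := Measure.integral_comp_mul_left
    (fun y => moll 0 (y - (k + N * z)) * g (z + ((y - (k + N * z)) + k) / N)) N
  have h2 := integral_sub_right_eq_self (μ := volume)
    (fun y => moll 0 y * g (z + (y + k) / N)) (k + N * z)
  rw [h2, abs_of_pos (inv_pos.2 hN), smul_eq_mul] at h1
  have h3 : ∫ y, moll 0 y * g (z + (y + k) / N) = N * ∫ x, moll 0 (N * x - (k + N * z)) *
      g (z + (N * x - (k + N * z) + k) / N) := by
    rw [h1, ← mul_assoc, mul_inv_cancel₀ hN.ne', one_mul]
  rw [h3, ← integral_const_mul]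
  congr 1 with x
  rw [show N * (x - z) - k = N * x - (k + N * z) by ring,
    show z + (N * x - (k + N * z) + k) / N = x by field_simp; ring]
  ring

lemma abs_integral_moll_mul_le (n : ℕ) {g : ℝ → ℝ} {C : ℝ} (hg : ∀ x, |g x| ≤ C) :
    |∫ y, moll n y * g y| ≤ C := by
  rw [← Real.norm_eq_abs]
  calc ‖∫ y, moll n y * g y‖ ≤ ∫ y, moll n y * C := by
        apply norm_integral_le_of_norm_le ((integrable_moll n).mul_const _)
        refine ae_of_all _ fun y => ?_
        rw [norm_mul, Real.norm_of_nonneg (moll_nonneg n y)]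
        exact mul_le_mul_of_nonneg_left (hg _) (moll_nonneg n y)
    _ = C := by rw [integral_mul_const, integral_moll, one_mul]

lemma abs_integral_moll_rescale_le {g : ℝ → ℝ} {C : ℝ} (hg : ∀ x, |g x| ≤ C) {N : ℝ} (hN : 0 < N)
    (z k : ℝ) : |∫ x, N * moll 0 (N * (x - z) - k) * g x| ≤ C := by
  rw [integral_moll_rescale g hN]
  exact abs_integral_moll_mul_le 0 fun y => hg _

/-- Averages against a mollifier that is concentrated just to the right of `z` pick the right
limit at `z`. -/
lemma tendsto_integral_moll_rescale {g : ℝ → ℝ} (hgm : Measurable g) {C : ℝ}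
    (hg : ∀ x, |g x| ≤ C) {z l : ℝ} (hl : Tendsto g (𝓝[>] z) (𝓝 l)) {L : ℝ} {zn : ℕ → ℝ}
    (hz : ∀ n, |zn n - z| ≤ L * (1 / ((n : ℝ) + 1))) :
    Tendsto (fun n : ℕ => ∫ x, ((n : ℝ) + 1) * moll 0 (((n : ℝ) + 1) * (x - zn n) - (L + 1)) * g x)
      atTop (𝓝 l) := by
  have e : ∀ n : ℕ, ∫ y, moll 0 y * g (zn n + (y + (L + 1)) / ((n : ℝ) + 1)) =
      ∫ x, ((n : ℝ) + 1) * moll 0 (((n : ℝ) + 1) * (x - zn n) - (L + 1)) * g x :=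
    fun n => (integral_moll_rescale g (by positivity) _ _).symm
  refine Tendsto.congr e ?_
  have hc : ∫ y, moll 0 y * l = l := by rw [integral_mul_const, integral_moll, one_mul]
  rw [← hc]
  apply tendsto_integral_of_dominated_convergence (fun y => moll 0 y * C)
  · intro n
    exact ((continuous_moll 0).measurable.mul (hgm.comp (by fun_prop))).aestronglyMeasurable
  · exact (integrable_moll 0).mul_const _
  · intro n
    refine ae_of_all _ fun y => ?_
    rw [norm_mul, Real.norm_of_nonneg (moll_nonneg 0 y)]
    exact mul_le_mul_of_nonneg_left (hg _) (moll_nonneg 0 y)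
  · refine ae_of_all _ fun y => ?_
    by_cases hy : 1 ≤ |y|
    · have : moll 0 y = 0 := moll_eq_zero (by simpa using hy)
      simp [this]
    · refine Tendsto.const_mul _ (hl.comp ?_)
      have hy' := abs_lt.1 (not_le.1 hy)
      apply tendsto_nhdsWithin_of_tendsto_nhds_of_eventually_within
      · have h0 := tendsto_one_div_add_atTop_nhds_zero_nat (𝕜 := ℝ)
        have h1 : Tendsto zn atTop (𝓝 z) := by
          rw [tendsto_iff_norm_sub_tendsto_zero]
          refine squeeze_zero (fun n => norm_nonneg _) hz ?_
          simpa using h0.const_mul L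
        have h2 := h1.add (h0.const_mul (y + (L + 1)))
        simp only [mul_zero, add_zero] at h2
        refine h2.congr fun n => ?_
        ring
      · refine Eventually.of_forall fun n => ?_
        have hp : (0 : ℝ) < 1 / ((n : ℝ) + 1) := by positivity
        have h1 := (abs_le.1 (hz n)).1
        have h2 : (y + (L + 1)) / ((n : ℝ) + 1) =
          (y + 1) * (1 / ((n : ℝ) + 1)) + L * (1 / ((n : ℝ) + 1)) := by ring
        have h3 : 0 < (y + 1) * (1 / ((n : ℝ) + 1)) := mul_pos (by linarith) hp
        simp only [mem_Ioi, h2]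
        linarith

/-- The smoothed indicator function of the strip between two curves, with transition layers of width
of order `1 / N` around `X + k / N` and `Y + k / N`. For `k > 1` these layers lie to the right of the
curves, so that traces from the right appear as `N → ∞`. -/
noncomputable def strip (N k : ℝ) (X Y : ℝ → ℝ) (x t : ℝ) : ℝ :=
  step 0 (N * (x - X t) - k) - step 0 (N * (x - Y t) - k)

lemma strip_nonneg {N k : ℝ} (hN : 0 ≤ N) {X Y : ℝ → ℝ} {t : ℝ} (h : X t ≤ Y t) (x : ℝ) :
    0 ≤ strip N k X Y x t :=
  sub_nonneg.2 (step_mono 0 (by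
    have := mul_le_mul_of_nonneg_left h hN
    linarith))

lemma strip_le_one (N k : ℝ) (X Y : ℝ → ℝ) (x t : ℝ) : strip N k X Y x t ≤ 1 := by
  have h1 := step_le_one 0 (N * (x - X t) - k)
  have h2 := step_nonneg 0 (N * (x - Y t) - k)
  unfold strip; linarith

lemma strip_eq_zero {N k R : ℝ} (hN : 1 ≤ N) (hk : 0 ≤ k) {X Y : ℝ → ℝ} {x t : ℝ}
    (hX : |X t| ≤ R) (hY : |Y t| ≤ R) (hx : R + k + 1 < |x|) : strip N k X Y x t = 0 := by
  have hX := abs_le.1 hX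
  have hY := abs_le.1 hY
  unfold strip
  rcases lt_abs.1 hx with h | h
  · rw [step_eq_one, step_eq_one, sub_self]
    all_goals simp; nlinarith
  · rw [step_eq_zero, step_eq_zero, sub_self]
    all_goals simp; nlinarith

lemma contDiff_strip (N k : ℝ) {X Y : ℝ → ℝ} (hX : ContDiff ℝ ∞ X) (hY : ContDiff ℝ ∞ Y) :
    ContDiff ℝ ∞ (Function.uncurry (strip N k X Y)) := by
  have h : ∀ Z : ℝ → ℝ, ContDiff ℝ ∞ Z →
      ContDiff ℝ ∞ fun p : ℝ × ℝ => step 0 (N * (p.1 - Z p.2) - k) := fun Z hZ =>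
    (contDiff_step 0).comp ((contDiff_const.mul
      (contDiff_fst.sub (hZ.comp contDiff_snd))).sub contDiff_const)
  exact (h X hX).sub (h Y hY)

lemma hasDerivAt_strip_left (N k : ℝ) (X Y : ℝ → ℝ) (x t : ℝ) :
    HasDerivAt (fun y => strip N k X Y y t)
      (N * moll 0 (N * (x - X t) - k) - N * moll 0 (N * (x - Y t) - k)) x := by
  have h : ∀ z : ℝ, HasDerivAt (fun y => step 0 (N * (y - z) - k)) (N * moll 0 (N * (x - z) - k)) x :=
    fun z => by
      have h1 : HasDerivAt (fun y : ℝ => N * (y - z) - k) N x := by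
        simpa using (((hasDerivAt_id x).sub_const z).const_mul N).sub_const k
      have := (hasDerivAt_step 0 (N * (x - z) - k)).comp x h1
      rwa [mul_comm] at this
  exact (h _).sub (h _)

lemma hasDerivAt_strip_right (N k : ℝ) {X Y : ℝ → ℝ} (x t : ℝ) (hX : DifferentiableAt ℝ X t)
    (hY : DifferentiableAt ℝ Y t) :
    HasDerivAt (fun τ => strip N k X Y x τ)
      (deriv Y t * (N * moll 0 (N * (x - Y t) - k)) -
        deriv X t * (N * moll 0 (N * (x - X t) - k))) t := by
  have h : ∀ Z : ℝ → ℝ, DifferentiableAt ℝ Z t →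
      HasDerivAt (fun τ => step 0 (N * (x - Z τ) - k))
        (-(deriv Z t * (N * moll 0 (N * (x - Z t) - k)))) t :=
    fun Z hZ => by
      have h1 : HasDerivAt (fun τ : ℝ => N * (x - Z τ) - k) (N * -deriv Z t) t :=
        ((hZ.hasDerivAt.const_sub x).const_mul N).sub_const k
      have h2 := (hasDerivAt_step 0 (N * (x - Z t) - k)).comp t h1
      exact h2.congr_deriv (by ring)
  have h3 := (h X hX).sub (h Y hY)
  exact h3.congr_deriv (by ring)

lemma hasCompactSupport_exists {β : ℝ → ℝ} (hβ : HasCompactSupport β) :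
    ∃ T : ℝ, 0 < T ∧ ∀ t, T ≤ |t| → β t = 0 ∧ deriv β t = 0 := by
  obtain ⟨T, hT, h⟩ := hβ.exists_pos_le_norm
  obtain ⟨T', hT', h'⟩ := hβ.deriv.exists_pos_le_norm
  exact ⟨max T T', lt_max_of_lt_left hT, fun t ht =>
    ⟨h t ((le_max_left _ _).trans ht), h' t ((le_max_right _ _).trans ht)⟩⟩

lemma abs_le_of_lipschitzWith {X : ℝ → ℝ} {L : ℝ≥0} (hX : LipschitzWith L X) {T t : ℝ}
    (ht : |t| ≤ T) : |X t| ≤ |X 0| + L * T := by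
  have h := hX.dist_le_mul t 0
  rw [Real.dist_eq, Real.dist_eq, sub_zero] at h
  have h2 : (L : ℝ) * |t| ≤ L * T := mul_le_mul_of_nonneg_left ht L.2
  have h3 := abs_sub_abs_le_abs_sub (X t) (X 0)
  linarith

lemma isTest_strip {β : ℝ → ℝ} (hβ : ContDiff ℝ ∞ β) (hβc : HasCompactSupport β) {N k : ℝ}
    (hN : 1 ≤ N) (hk : 0 ≤ k) {X Y : ℝ → ℝ} (hX : ContDiff ℝ ∞ X) (hY : ContDiff ℝ ∞ Y) :
    IsTest fun x t => β t * strip N k X Y x t := by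
  refine ⟨(hβ.comp contDiff_snd).mul (contDiff_strip N k hX hY), ?_⟩
  obtain ⟨T, hT, h⟩ := hasCompactSupport_exists hβc
  obtain ⟨R₁, hR₁⟩ := (isCompact_Icc (a := -T) (b := T)).exists_bound_of_continuousOn
    hX.continuous.continuousOn
  obtain ⟨R₂, hR₂⟩ := (isCompact_Icc (a := -T) (b := T)).exists_bound_of_continuousOn
    hY.continuous.continuousOn
  apply hasCompactSupport_of_zero_off (z := (0, 0)) (R := max T (max R₁ R₂ + k + 1))
  rintro ⟨x, t⟩ hxt
  simp only [Function.uncurry]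
  by_cases ht : T ≤ |t|
  · rw [(h t ht).1, zero_mul]
  · have ht' : t ∈ Icc (-T) T := abs_le.1 (not_le.1 ht).le
    rw [strip_eq_zero (R := max R₁ R₂) hN hk ((hR₁ t ht').trans (le_max_left _ _))
      ((hR₂ t ht').trans (le_max_right _ _)), mul_zero]
    rw [Prod.dist_eq, Real.dist_eq, Real.dist_eq, sub_zero, sub_zero] at hxt
    rcases lt_max_iff.1 hxt with h1 | h1
    · exact (le_max_right _ _).trans_lt h1
    · exact absurd ((le_max_left _ _).trans_lt h1) (by linarith)

lemma tendsto_strip {L : ℝ} (hL : 0 ≤ L) {Xn Yn : ℕ → ℝ → ℝ} {X Y x t : ℝ}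
    (hXn : ∀ n, |Xn n t - X| ≤ L * (1 / ((n : ℝ) + 1)))
    (hYn : ∀ n, |Yn n t - Y| ≤ L * (1 / ((n : ℝ) + 1))) (hXY : X ≤ Y) :
    Tendsto (fun n : ℕ => strip ((n : ℝ) + 1) (L + 1) (Xn n) (Yn n) x t) atTop
      (𝓝 ((Ioc X Y).indicator (fun _ => (1 : ℝ)) x)) := by
  have h0 : ∀ (Zn : ℕ → ℝ → ℝ) (Z : ℝ), (∀ n, |Zn n t - Z| ≤ L * (1 / ((n : ℝ) + 1))) →
      x ≤ Z → ∀ n : ℕ, step 0 (((n : ℝ) + 1) * (x - Zn n t) - (L + 1)) = 0 := by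
    intro Zn Z hZ hx n
    apply step_eq_zero
    have h1 := (abs_le.1 (hZ n)).1
    have h2 : ((n : ℝ) + 1) * (x - Zn n t) ≤ ((n : ℝ) + 1) * (L * (1 / ((n : ℝ) + 1))) :=
      mul_le_mul_of_nonneg_left (by linarith) (by positivity)
    have h3 : ((n : ℝ) + 1) * (L * (1 / ((n : ℝ) + 1))) = L := by field_simp
    simp
    linarith
  have h1 : ∀ (Zn : ℕ → ℝ → ℝ) (Z : ℝ), (∀ n, |Zn n t - Z| ≤ L * (1 / ((n : ℝ) + 1))) →
      Z < x → ∀ᶠ n : ℕ in atTop, step 0 (((n : ℝ) + 1) * (x - Zn n t) - (L + 1)) = 1 := by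
    intro Zn Z hZ hx
    have hx' : 0 < (x - Z) / (2 * L + 2) := div_pos (by linarith) (by linarith)
    have := (tendsto_one_div_add_atTop_nhds_zero_nat (𝕜 := ℝ)).eventually (gt_mem_nhds hx')
    filter_upwards [this] with n hn
    apply step_eq_one
    have h1 := (abs_le.1 (hZ n)).2
    rw [lt_div_iff₀ (by linarith)] at hn
    have h2 : ((n : ℝ) + 1) * ((L + 2) * (1 / ((n : ℝ) + 1))) ≤ ((n : ℝ) + 1) * (x - Zn n t) := by
      apply mul_le_mul_of_nonneg_left _ (by positivity)
      linarith
    have h3 : ((n : ℝ) + 1) * ((L + 2) * (1 / ((n : ℝ) + 1))) = L + 2 := by field_simp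
    simp
    linarith
  apply tendsto_const_nhds.congr'
  unfold strip
  rcases le_or_gt x X with hx | hx
  · rw [indicator_of_notMem (by simp [hx])]
    refine Eventually.of_forall fun n => ?_
    simp only
    rw [h0 Xn X hXn hx, h0 Yn Y hYn (hx.trans hXY), sub_self]
  · rcases le_or_gt x Y with hx' | hx'
    · filter_upwards [h1 Xn X hXn hx] with n hn
      rw [hn, h0 Yn Y hYn hx', indicator_of_mem (mem_Ioc.2 ⟨hx, hx'⟩), sub_zero]
    · filter_upwards [h1 Xn X hXn hx, h1 Yn Y hYn hx'] with n hn hn'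
      rw [hn, hn', indicator_of_notMem (by simp [hx']), sub_self]

lemma norm_mul_strip_le {g : ℝ → ℝ} {C : ℝ} (hg : ∀ x, |g x| ≤ C) {N k R : ℝ}
    (hN : 1 ≤ N) (hk : 0 ≤ k) {X Y : ℝ → ℝ} {t : ℝ} (hXY : X t ≤ Y t)
    (hX : |X t| ≤ R) (hY : |Y t| ≤ R) (x : ℝ) :
    ‖g x * strip N k X Y x t‖ ≤
      (Icc (-(R + k + 1)) (R + k + 1)).indicator (fun _ => C) x := by
  by_cases hx : x ∈ Icc (-(R + k + 1)) (R + k + 1)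
  · rw [indicator_of_mem hx, norm_mul, Real.norm_eq_abs, Real.norm_of_nonneg
      (strip_nonneg (by linarith) hXY x)]
    exact (mul_le_of_le_one_right (abs_nonneg _) (strip_le_one _ _ _ _ _ _)).trans (hg x)
  · rw [indicator_of_notMem hx, strip_eq_zero hN hk hX hY, mul_zero, norm_zero]
    by_contra h
    exact hx (abs_le.1 (not_lt.1 h))

lemma measurable_strip (N k : ℝ) (X Y : ℝ → ℝ) (t : ℝ) :
    Measurable fun x => strip N k X Y x t := by
  unfold strip
  have := (contDiff_step 0).continuous.measurable
  exact (this.comp (by fun_prop)).sub (this.comp (by fun_prop))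

lemma integrable_mul_strip {g : ℝ → ℝ} (hgm : Measurable g) {C : ℝ} (hg : ∀ x, |g x| ≤ C)
    {N k : ℝ} (hN : 1 ≤ N) (hk : 0 ≤ k) {X Y : ℝ → ℝ} {t : ℝ} (hXY : X t ≤ Y t) :
    Integrable fun x => g x * strip N k X Y x t := by
  have h : Integrable ((Icc (-(max |X t| |Y t| + k + 1)) (max |X t| |Y t| + k + 1)).indicator
      (fun _ : ℝ => C)) := by
    rw [integrable_indicator_iff measurableSet_Icc]
    exact continuousOn_const.integrableOn_Icc
  exact h.mono' (hgm.mul (measurable_strip _ _ _ _ _)).aestronglyMeasurable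
    (ae_of_all _ fun x =>
      norm_mul_strip_le hg hN hk hXY (le_max_left _ _) (le_max_right _ _) x)

lemma abs_integral_mul_strip_le {g : ℝ → ℝ} {C : ℝ} (hg : ∀ x, |g x| ≤ C) {N k R : ℝ}
    (hN : 1 ≤ N) (hk : 0 ≤ k) {X Y : ℝ → ℝ} {t : ℝ} (hXY : X t ≤ Y t)
    (hX : |X t| ≤ R) (hY : |Y t| ≤ R) :
    |∫ x, g x * strip N k X Y x t| ≤ 2 * (R + k + 1) * C := by
  have hR : 0 ≤ R := (abs_nonneg _).trans hX
  rw [← Real.norm_eq_abs]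
  refine (norm_integral_le_of_norm_le ?_ (ae_of_all _ fun x =>
    norm_mul_strip_le hg hN hk hXY hX hY x)).trans_eq ?_
  · rw [integrable_indicator_iff measurableSet_Icc]
    exact continuousOn_const.integrableOn_Icc
  · rw [integral_indicator measurableSet_Icc, setIntegral_const, Real.volume_real_Icc_of_le
      (by linarith), smul_eq_mul]
    ring

lemma tendsto_integral_mul_strip {g : ℝ → ℝ} (hgm : Measurable g) {C : ℝ} (hg : ∀ x, |g x| ≤ C)
    {L : ℝ} (hL : 0 ≤ L) {Xn Yn : ℕ → ℝ → ℝ} {X Y t R : ℝ}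
    (hXn : ∀ n, |Xn n t - X| ≤ L * (1 / ((n : ℝ) + 1)))
    (hYn : ∀ n, |Yn n t - Y| ≤ L * (1 / ((n : ℝ) + 1))) (hXY : X ≤ Y)
    (hXYn : ∀ n, Xn n t ≤ Yn n t) (hXR : ∀ n, |Xn n t| ≤ R) (hYR : ∀ n, |Yn n t| ≤ R) :
    Tendsto (fun n : ℕ => ∫ x, g x * strip ((n : ℝ) + 1) (L + 1) (Xn n) (Yn n) x t) atTop
      (𝓝 (∫ x in Ioc X Y, g x)) := by
  rw [← integral_indicator measurableSet_Ioc]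
  apply tendsto_integral_of_dominated_convergence
    ((Icc (-(R + (L + 1) + 1)) (R + (L + 1) + 1)).indicator (fun _ => C))
  · exact fun n => (hgm.mul (measurable_strip _ _ _ _ _)).aestronglyMeasurable
  · rw [integrable_indicator_iff measurableSet_Icc]
    exact continuousOn_const.integrableOn_Icc
  · exact fun n => ae_of_all _ fun x => norm_mul_strip_le hg
      (by linarith [(Nat.cast_nonneg n : (0 : ℝ) ≤ n)]) (by linarith) (hXYn n) (hXR n) (hYR n) x
  · refine ae_of_all _ fun x => ?_
    convert (tendsto_strip hL hXn hYn hXY (x := x)).const_mul (g x) using 2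
    by_cases hx : x ∈ Ioc X Y <;> simp [hx]

lemma integrable_moll_rescale {g : ℝ → ℝ} (hgm : Measurable g) {C : ℝ} (hg : ∀ x, |g x| ≤ C)
    {N : ℝ} (hN : 0 < N) (z k : ℝ) : Integrable fun x => N * moll 0 (N * (x - z) - k) * g x := by
  have h1 : Integrable fun x => moll 0 (N * (x - z) - k) := by
    have := (((integrable_moll 0).comp_sub_right k).comp_mul_left' hN.ne').comp_sub_right z
    exact this
  exact (h1.const_mul N).mul_bdd (c := C) hgm.aestronglyMeasurable (ae_of_all _ fun x => hg x)

lemma CadlagField.comp_measurable {M : ℝ} {U UL : ℝ → ℝ → ℝ} (hU : CadlagField M U UL)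
    {g : ℝ → ℝ} (hg : Continuous g) (t : ℝ) : Measurable fun x => g (U x t) :=
  hg.measurable.comp (hU.measurable.comp measurable_prodMk_right)

lemma exists_abs_le_of_continuous {g : ℝ → ℝ} (hg : Continuous g) (M : ℝ) :
    ∃ C, 0 ≤ C ∧ ∀ v, |v| ≤ M → |g v| ≤ C := by
  obtain ⟨C, hC⟩ := (isCompact_Icc (a := -M) (b := M)).exists_bound_of_continuousOn hg.continuousOn
  exact ⟨max C 0, le_max_right _ _, fun v hv => (hC v (abs_le.1 hv)).trans (le_max_left _ _)⟩

/-- Testing with a smoothed strip: the inner integral splits into a bulk and two boundary terms. -/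
lemma integral_test_strip {M : ℝ} {U UL : ℝ → ℝ → ℝ} (hU : CadlagField M U UL) {η q : ℝ → ℝ}
    (hη : Continuous η) (hq : Continuous q) {β X Y : ℝ → ℝ} (hβ : Differentiable ℝ β)
    (hX : Differentiable ℝ X) (hY : Differentiable ℝ Y) {N k : ℝ}
    (hN : 1 ≤ N) (hk : 0 ≤ k) {t : ℝ} (hXY : X t ≤ Y t) :
    ∫ x, (η (U x t) * deriv (fun τ => β τ * strip N k X Y x τ) t +
        q (U x t) * deriv (fun y => β t * strip N k X Y y t) x) =
      deriv β t * (∫ x, η (U x t) * strip N k X Y x t) +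
      β t * ((deriv Y t * (∫ x, N * moll 0 (N * (x - Y t) - k) * η (U x t)) -
          ∫ x, N * moll 0 (N * (x - Y t) - k) * q (U x t)) -
        (deriv X t * (∫ x, N * moll 0 (N * (x - X t) - k) * η (U x t)) -
          ∫ x, N * moll 0 (N * (x - X t) - k) * q (U x t))) := by
  obtain ⟨C, -, hC⟩ := exists_abs_le_of_continuous hη M
  obtain ⟨D, -, hD⟩ := exists_abs_le_of_continuous hq M
  have hC' : ∀ x, |η (U x t)| ≤ C := fun x => hC _ (hU.abs_le x t)
  have hD' : ∀ x, |q (U x t)| ≤ D := fun x => hD _ (hU.abs_le x t)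
  have hηm := hU.comp_measurable hη t
  have hqm := hU.comp_measurable hq t
  have hN0 : 0 < N := by linarith
  have i1 := (integrable_mul_strip hηm hC' hN hk hXY).const_mul (deriv β t)
  have i2 := fun z => integrable_moll_rescale hηm hC' hN0 z k
  have i3 := fun z => integrable_moll_rescale hqm hD' hN0 z k
  have i4 := ((i2 (Y t)).const_mul (deriv Y t)).sub (i3 (Y t))
  have i5 := ((i2 (X t)).const_mul (deriv X t)).sub (i3 (X t))
  have e : ∀ x, η (U x t) * deriv (fun τ => β τ * strip N k X Y x τ) t +
        q (U x t) * deriv (fun y => β t * strip N k X Y y t) x =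
      deriv β t * (η (U x t) * strip N k X Y x t) +
      β t * ((deriv Y t * (N * moll 0 (N * (x - Y t) - k) * η (U x t)) -
          N * moll 0 (N * (x - Y t) - k) * q (U x t)) -
        (deriv X t * (N * moll 0 (N * (x - X t) - k) * η (U x t)) -
          N * moll 0 (N * (x - X t) - k) * q (U x t))) := by
    intro x
    have h1 : HasDerivAt (fun τ => β τ * strip N k X Y x τ) _ t :=
      (hβ t).hasDerivAt.mul (hasDerivAt_strip_right N k x t (hX t) (hY t))
    rw [h1.deriv, ((hasDerivAt_strip_left N k X Y x t).const_mul (β t)).deriv]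
    ring
  simp_rw [e]
  have j1 := integral_add i1 ((i4.sub i5).const_mul (β t))
  have j2 := integral_sub i4 i5
  have j3 := integral_sub ((i2 (Y t)).const_mul (deriv Y t)) (i3 (Y t))
  have j4 := integral_sub ((i2 (X t)).const_mul (deriv X t)) (i3 (X t))
  simp only [Pi.sub_apply, integral_const_mul] at j1 j2 j3 j4
  rw [j1, j2, j3, j4]

/-- **Entropy balance in a strip.** If `(η, q)` satisfies the entropy inequality, then the amount of
`η(U)` between two Lipschitz curves increases at most by what enters through the boundary,
computed with traces from the right. -/
theorem weakLE_strip {M : ℝ} {U UL : ℝ → ℝ → ℝ} (hU : CadlagField M U UL) {η q : ℝ → ℝ}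
    (hη : Continuous η) (hq : Continuous q) {u₀ : ℝ → ℝ} (hu₀ : Measurable u₀)
    (hu₀M : ∀ x, |u₀ x| ≤ M)
    (hW : ∀ φ, IsTest φ → (∀ x t, 0 ≤ t → 0 ≤ φ x t) → 0 ≤ weakForm η q u₀ U φ)
    {X Y : ℝ → ℝ} {L : ℝ≥0} (hX : LipschitzWith L X) (hY : LipschitzWith L Y)
    (hXY : ∀ t, X t ≤ Y t) :
    WeakLE (fun t => ∫ x in Ioc (X t) (Y t), η (U x t))
      (fun t => traceFlux η q (U (Y t) t) (deriv Y t) - traceFlux η q (U (X t) t) (deriv X t))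
      (∫ x in Ioc (X 0) (Y 0), η (u₀ x)) := by
  intro β hβ hβc hβ0
  obtain ⟨C, hC0, hC⟩ := exists_abs_le_of_continuous hη M
  obtain ⟨D, hD0, hD⟩ := exists_abs_le_of_continuous hq M
  obtain ⟨T, hT, hβT⟩ := hasCompactSupport_exists hβc
  obtain ⟨B, hB⟩ := hβc.exists_bound_of_continuous hβ.continuous
  obtain ⟨B', hB'⟩ := hβc.deriv.exists_bound_of_continuous (hβ.continuous_deriv (by simp))
  have hL0 : (0 : ℝ) ≤ L := L.2
  have hXc := hX.continuous
  have hYc := hY.continuous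
  have hsX := fun n => contDiff_smoothed hXc n
  have hsY := fun n => contDiff_smoothed hYc n
  have hsXY := fun n => smoothed_mono hXc hYc hXY n
  have hN : ∀ n : ℕ, (1 : ℝ) ≤ (n : ℝ) + 1 := fun n => by
    linarith [(Nat.cast_nonneg n : (0 : ℝ) ≤ n)]
  have hk : (0 : ℝ) ≤ (L : ℝ) + 1 := by linarith
  -- The curves are mollified at scale `1 / (n + 1)`, which moves them by at most `L / (n + 1)`;
  -- the shift `k = L + 1` keeps the transition layers to the right of the original curves.
  set φ : ℕ → ℝ → ℝ → ℝ := fun n x t =>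
    β t * strip ((n : ℝ) + 1) (L + 1) (smoothed X n) (smoothed Y n) x t with hφ
  have hpos : ∀ n, 0 ≤ weakForm η q u₀ U (φ n) := fun n =>
    hW _ (isTest_strip hβ hβc (hN n) hk (hsX n) (hsY n)) fun x t ht =>
      mul_nonneg (hβ0 t ht) (strip_nonneg (by linarith [hN n]) (hsXY n t) x)
  -- A common bound for the curves on the support of `β`.
  set R : ℝ := max |X 0| |Y 0| + L * T + L with hR
  have hle1 : ∀ n : ℕ, (L : ℝ) * (1 / ((n : ℝ) + 1)) ≤ L := fun n =>
    mul_le_of_le_one_right hL0 ((div_le_one (by positivity)).2 (hN n))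
  have hXR : ∀ n t, |t| ≤ T → |smoothed X n t| ≤ R := fun n t ht => by
    have h1 := abs_smoothed_sub_le hX n t
    have h2 := abs_le_of_lipschitzWith hX ht
    have h3 := abs_sub_abs_le_abs_sub (smoothed X n t) (X t)
    have h4 := le_max_left |X 0| |Y 0|
    linarith [hle1 n]
  have hYR : ∀ n t, |t| ≤ T → |smoothed Y n t| ≤ R := fun n t ht => by
    have h1 := abs_smoothed_sub_le hY n t
    have h2 := abs_le_of_lipschitzWith hY ht
    have h3 := abs_sub_abs_le_abs_sub (smoothed Y n t) (Y t)
    have h4 := le_max_right |X 0| |Y 0|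
    linarith [hle1 n]
  have hR0 : 0 ≤ R := by positivity
  have hlim : Tendsto (fun n => weakForm η q u₀ U (φ n)) atTop
      (𝓝 ((∫ t in Ici (0 : ℝ), (deriv β t * (∫ x in Ioc (X t) (Y t), η (U x t)) +
        β t * (traceFlux η q (U (Y t) t) (deriv Y t) -
          traceFlux η q (U (X t) t) (deriv X t)))) +
        β 0 * ∫ x in Ioc (X 0) (Y 0), η (u₀ x))) := by
    unfold weakForm
    refine Tendsto.add ?_ ?_
    · apply tendsto_integral_of_dominated_convergence
        ((Icc (-T) T).indicator fun _ => B' * (2 * (R + (L + 1) + 1) * C) +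
          B * ((L * C + D) + (L * C + D)))
      · intro n
        have hm : Measurable fun p : ℝ × ℝ => η (U p.2 p.1) *
            deriv (fun τ => φ n p.2 τ) p.1 + q (U p.2 p.1) * deriv (fun y => φ n y p.1) p.2 := by
          have e1 : ∀ x t, deriv (fun τ => φ n x τ) t = _ := fun x t =>
            (((hβ.differentiable (by simp)) t).hasDerivAt.mul (hasDerivAt_strip_right
              ((n : ℝ) + 1) (L + 1) x t ((hsX n).differentiable (by simp) t)
              ((hsY n).differentiable (by simp) t))).deriv
          have e2 : ∀ x t, deriv (fun y => φ n y t) x = _ := fun x t =>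
            ((hasDerivAt_strip_left ((n : ℝ) + 1) (L + 1) (smoothed X n)
              (smoothed Y n) x t).const_mul (β t)).deriv
          simp only [e1, e2]
          have hU' : Measurable fun p : ℝ × ℝ => U p.2 p.1 := hU.measurable.comp measurable_swap
          have m1 := hη.measurable.comp hU'
          have m2 := hq.measurable.comp hU'
          have m3 : Measurable fun p : ℝ × ℝ => strip ((n : ℝ) + 1) (L + 1) (smoothed X n)
              (smoothed Y n) p.2 p.1 :=
            (contDiff_strip _ _ (hsX n) (hsY n)).continuous.measurable.comp measurable_swap
          have m4 := (continuous_moll 0).measurable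
          have m5 := (hsX n).continuous.measurable
          have m6 := (hsY n).continuous.measurable
          have m7 := hβ.continuous.measurable
          have m8 := measurable_deriv β
          have m9 := measurable_deriv (smoothed X n)
          have m10 := measurable_deriv (smoothed Y n)
          have m11 : Measurable fun p : ℝ × ℝ =>
              moll 0 (((n : ℝ) + 1) * (p.2 - smoothed X n p.1) - (L + 1)) := m4.comp (by fun_prop)
          have m12 : Measurable fun p : ℝ × ℝ =>
              moll 0 (((n : ℝ) + 1) * (p.2 - smoothed Y n p.1) - (L + 1)) := m4.comp (by fun_prop)
          exact (m1.mul (((m8.comp measurable_fst).mul m3).add ((m7.comp measurable_fst).mul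
            (((m10.comp measurable_fst).mul (m12.const_mul _)).sub
              ((m9.comp measurable_fst).mul (m11.const_mul _)))))).add
            (m2.mul ((m7.comp measurable_fst).mul ((m11.const_mul _).sub (m12.const_mul _))))
        exact hm.stronglyMeasurable.integral_prod_right.aestronglyMeasurable
      · apply Integrable.restrict
        rw [integrable_indicator_iff measurableSet_Icc]
        exact continuousOn_const.integrableOn_Icc
      · intro n
        refine ae_of_all _ fun t => ?_
        simp only [hφ]
        rw [integral_test_strip hU hη hq (hβ.differentiable (by simp))
          ((hsX n).differentiable (by simp)) ((hsY n).differentiable (by simp)) (hN n) hk (hsXY n t)]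
        by_cases ht : T ≤ |t|
        · rw [(hβT t ht).1, (hβT t ht).2, zero_mul, zero_mul, add_zero, norm_zero]
          by_cases ht' : t ∈ Icc (-T) T
          · rw [indicator_of_mem ht']
            have b1 := (norm_nonneg _).trans (hB 0)
            have b2 := (norm_nonneg _).trans (hB' 0)
            positivity
          · rw [indicator_of_notMem ht']
        · have ht1 : |t| ≤ T := (not_le.1 ht).le
          rw [indicator_of_mem (show t ∈ Icc (-T) T from abs_le.1 ht1)]
          have c1 : ∀ z, |∫ x, ((n : ℝ) + 1) * moll 0 (((n : ℝ) + 1) * (x - z) - (L + 1)) *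
              η (U x t)| ≤ C := fun z => abs_integral_moll_rescale_le
                (fun x => hC _ (hU.abs_le x t)) (by positivity) z _
          have c2 : ∀ z, |∫ x, ((n : ℝ) + 1) * moll 0 (((n : ℝ) + 1) * (x - z) - (L + 1)) *
              q (U x t)| ≤ D := fun z => abs_integral_moll_rescale_le
                (fun x => hD _ (hU.abs_le x t)) (by positivity) z _
          have c3 : ∀ (w : ℝ) (z : ℝ), |w| ≤ L →
              ‖w * (∫ x, ((n : ℝ) + 1) * moll 0 (((n : ℝ) + 1) * (x - z) - (L + 1)) * η (U x t)) -
              ∫ x, ((n : ℝ) + 1) * moll 0 (((n : ℝ) + 1) * (x - z) - (L + 1)) * q (U x t)‖ ≤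
              L * C + D := fun w z hw => by
            refine (norm_sub_le _ _).trans (add_le_add ?_ (c2 z))
            rw [norm_mul]
            exact mul_le_mul hw (c1 z) (norm_nonneg _) hL0
          refine (norm_add_le _ _).trans (add_le_add ?_ ?_)
          · rw [norm_mul]
            exact mul_le_mul (hB' t) (abs_integral_mul_strip_le
              (fun x => hC _ (hU.abs_le x t)) (hN n) hk (hsXY n t) (hXR n t ht1) (hYR n t ht1))
              (norm_nonneg _) ((norm_nonneg _).trans (hB' t))
          · rw [norm_mul]
            refine mul_le_mul (hB t) ((norm_sub_le _ _).trans (add_le_add ?_ ?_)) (norm_nonneg _)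
              ((norm_nonneg _).trans (hB t))
            · exact c3 _ _ (abs_deriv_smoothed_le hY n t)
            · exact c3 _ _ (abs_deriv_smoothed_le hX n t)
      · filter_upwards [ae_restrict_of_ae (ae_tendsto_deriv_smoothed hX),
          ae_restrict_of_ae (ae_tendsto_deriv_smoothed hY)] with t hdX hdY
        have e : ∀ n, _ = _ := fun n => integral_test_strip hU hη hq
          (hβ.differentiable (by simp)) ((hsX n).differentiable (by simp))
          ((hsY n).differentiable (by simp)) (hN n) hk (hsXY n t)
        simp only [hφ, e]
        have hηr : ∀ z, Tendsto (fun x => η (U x t)) (𝓝[>] z) (𝓝 (η (U z t))) := fun z =>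
          (hη.tendsto _).comp (hU.tendsto_right z t)
        have hqr : ∀ z, Tendsto (fun x => q (U x t)) (𝓝[>] z) (𝓝 (q (U z t))) := fun z =>
          (hq.tendsto _).comp (hU.tendsto_right z t)
        have r1 := fun (Z : ℝ → ℝ) (hZ : LipschitzWith L Z) => tendsto_integral_moll_rescale
          (hU.comp_measurable hη t) (fun x => hC _ (hU.abs_le x t)) (hηr (Z t))
          (fun n => abs_smoothed_sub_le hZ n t)
        have r2 := fun (Z : ℝ → ℝ) (hZ : LipschitzWith L Z) => tendsto_integral_moll_rescale
          (hU.comp_measurable hq t) (fun x => hD _ (hU.abs_le x t)) (hqr (Z t))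
          (fun n => abs_smoothed_sub_le hZ n t)
        have r3 := tendsto_integral_mul_strip (t := t) (Xn := smoothed X) (Yn := smoothed Y)
          (R := max |X t| |Y t| + L) (hU.comp_measurable hη t)
          (fun x => hC _ (hU.abs_le x t)) hL0 (fun n => abs_smoothed_sub_le hX n t)
          (fun n => abs_smoothed_sub_le hY n t) (hXY t) (fun n => hsXY n t)
          (fun n => by
            have h1 := abs_smoothed_sub_le hX n t
            have h3 := abs_sub_abs_le_abs_sub (smoothed X n t) (X t)
            have h4 := le_max_left |X t| |Y t|
            linarith [hle1 n])
          (fun n => by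
            have h1 := abs_smoothed_sub_le hY n t
            have h3 := abs_sub_abs_le_abs_sub (smoothed Y n t) (Y t)
            have h4 := le_max_right |X t| |Y t|
            linarith [hle1 n])
        have := (r3.const_mul (deriv β t)).add ((((hdY.mul (r1 Y hY)).sub (r2 Y hY)).sub
          ((hdX.mul (r1 X hX)).sub (r2 X hX))).const_mul (β t))
        convert this using 2
        simp only [traceFlux]
        ring
    · have r3 := tendsto_integral_mul_strip (t := 0) (Xn := smoothed X) (Yn := smoothed Y)
          (R := R) (hη.measurable.comp hu₀)
          (fun x => hC _ (hu₀M x)) hL0 (fun n => abs_smoothed_sub_le hX n 0)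
          (fun n => abs_smoothed_sub_le hY n 0) (hXY 0) (fun n => hsXY n 0)
          (fun n => hXR n 0 (by simpa using hT.le)) (fun n => hYR n 0 (by simpa using hT.le))
      refine (r3.const_mul (β 0)).congr fun n => ?_
      rw [← integral_const_mul]
      congr 1 with x
      simp only [hφ, Function.comp]
      ring
  exact ge_of_tendsto' hlim hpos

/-! ### Traces from the left and jump conditions along curves -/

lemma WeakLE.of_tendsto {m F : ℕ → ℝ → ℝ} {m₀ : ℕ → ℝ} {m' F' : ℝ → ℝ} {m₀' : ℝ}
    (h : ∀ᶠ n in atTop, WeakLE (m n) (F n) (m₀ n)) (hmm : ∀ n, Measurable (m n))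
    (hFm : ∀ n, Measurable (F n)) {K : ℝ → ℝ} (hK : Continuous K)
    (hmK : ∀ n t, |m n t| ≤ K t) (hFK : ∀ n t, |F n t| ≤ K t)
    (hm : ∀ t, Tendsto (fun n => m n t) atTop (𝓝 (m' t)))
    (hF : ∀ t, Tendsto (fun n => F n t) atTop (𝓝 (F' t)))
    (h₀ : Tendsto m₀ atTop (𝓝 m₀')) : WeakLE m' F' m₀' := by
  intro β hβ hβc hβ0
  have hβ1 : Continuous (deriv β) := hβ.continuous_deriv (by simp)
  have hlim : Tendsto (fun n => (∫ t in Ici (0 : ℝ), (deriv β t * m n t + β t * F n t)) + β 0 * m₀ n)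
      atTop (𝓝 ((∫ t in Ici (0 : ℝ), (deriv β t * m' t + β t * F' t)) + β 0 * m₀')) := by
    refine Tendsto.add ?_ (h₀.const_mul _)
    apply tendsto_integral_of_dominated_convergence (fun t => |deriv β t| * K t + |β t| * K t)
    · exact fun n => ((hβ1.measurable.mul (hmm n)).add
        (hβ.continuous.measurable.mul (hFm n))).aestronglyMeasurable
    · apply Integrable.restrict
      have h1 : Continuous fun t => |deriv β t| * K t + |β t| * K t :=
        (hβ1.abs.mul hK).add (hβ.continuous.abs.mul hK)
      apply h1.integrable_of_hasCompactSupport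
      exact (hβc.deriv.norm.mul_right (f' := K)).add (hβc.norm.mul_right (f' := K))
    · intro n
      refine ae_of_all _ fun t => (norm_add_le _ _).trans (add_le_add ?_ ?_)
      · rw [norm_mul]
        exact mul_le_mul_of_nonneg_left (hmK n t) (norm_nonneg _)
      · rw [norm_mul]
        exact mul_le_mul_of_nonneg_left (hFK n t) (norm_nonneg _)
    · exact ae_of_all _ fun t => ((hm t).const_mul _).add ((hF t).const_mul _)
  apply ge_of_tendsto hlim
  filter_upwards [h] with n hn
  exact hn β hβ hβc hβ0

section Traces

variable {M : ℝ} {U UL : ℝ → ℝ → ℝ} {η q : ℝ → ℝ} {X Y : ℝ → ℝ} {L : ℝ≥0}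

lemma CadlagField.measurable_mass (hU : CadlagField M U UL) (hη : Continuous η)
    (hX : Continuous X) (hY : Continuous Y) :
    Measurable fun t => ∫ x in Ioc (X t) (Y t), η (U x t) := by
  have h : ∀ t, ∫ x in Ioc (X t) (Y t), η (U x t) =
      ∫ x, {p : ℝ × ℝ | X p.1 < p.2 ∧ p.2 ≤ Y p.1}.indicator (fun p => η (U p.2 p.1)) (t, x) := by
    intro t
    rw [← integral_indicator measurableSet_Ioc]
    congr 1
  simp_rw [h]
  apply StronglyMeasurable.measurable
  have hm : MeasurableSet {p : ℝ × ℝ | X p.1 < p.2 ∧ p.2 ≤ Y p.1} :=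
    (measurableSet_lt (hX.measurable.comp measurable_fst) measurable_snd).inter
      (measurableSet_le measurable_snd (hY.measurable.comp measurable_fst))
  have h2 : Measurable fun p : ℝ × ℝ => η (U p.2 p.1) :=
    hη.measurable.comp (hU.measurable.comp measurable_swap)
  exact ((h2.indicator hm).stronglyMeasurable).integral_prod_right'

lemma CadlagField.measurable_flux (hU : CadlagField M U UL) (hη : Continuous η)
    (hq : Continuous q) (hX : Continuous X) :
    Measurable fun t => traceFlux η q (U (X t) t) (deriv X t) := by
  have h : Measurable fun t => U (X t) t :=
    hU.measurable.comp (hX.measurable.prodMk measurable_id)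
  exact ((hη.measurable.comp h).mul (measurable_deriv X)).sub (hq.measurable.comp h)

lemma abs_traceFlux_le {C D : ℝ} (hC : ∀ v, |v| ≤ M → |η v| ≤ C)
    (hD : ∀ v, |v| ≤ M → |q v| ≤ D) {v w : ℝ} (hv : |v| ≤ M) (hw : |w| ≤ L) :
    |traceFlux η q v w| ≤ C * L + D := by
  unfold traceFlux
  refine (abs_sub _ _).trans (add_le_add ?_ (hD v hv))
  rw [abs_mul]
  exact mul_le_mul (hC v hv) hw (abs_nonneg _) ((abs_nonneg _).trans (hC v hv))

lemma CadlagField.integrableOn_comp (hU : CadlagField M U UL) (hη : Continuous η) (t a b : ℝ) :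
    IntegrableOn (fun x => η (U x t)) (Ioc a b) := by
  obtain ⟨C, hC0, hC⟩ := exists_abs_le_of_continuous hη M
  apply Measure.integrableOn_of_bounded (M := C) (by simp)
    (hU.comp_measurable hη t).aestronglyMeasurable
  exact ae_of_all _ fun x => hC _ (hU.abs_le x t)

lemma CadlagField.abs_mass_le (hU : CadlagField M U UL) {C : ℝ}
    (hC : ∀ v, |v| ≤ M → |η v| ≤ C) {a b t : ℝ} (hab : a ≤ b) :
    |∫ x in Ioc a b, η (U x t)| ≤ C * (b - a) := by
  have h := norm_setIntegral_le_of_norm_le_const (μ := volume) (s := Ioc a b)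
    (f := fun x => η (U x t)) (C := C) (by simp) (fun x _ => hC _ (hU.abs_le x t))
  rwa [Real.volume_real_Ioc_of_le hab] at h

lemma CadlagField.locallyIntegrable_mass (hU : CadlagField M U UL) (hη : Continuous η)
    (hX : Continuous X) (hY : Continuous Y) (hXY : ∀ t, X t ≤ Y t) :
    LocallyIntegrable (fun t => ∫ x in Ioc (X t) (Y t), η (U x t)) volume := by
  obtain ⟨C, hC0, hC⟩ := exists_abs_le_of_continuous hη M
  refine (Continuous.locallyIntegrable (f := fun t => C * (Y t - X t)) (by fun_prop)).mono
    (hU.measurable_mass hη hX hY).aestronglyMeasurable (ae_of_all _ fun t => ?_)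
  rw [Real.norm_eq_abs, Real.norm_eq_abs]
  exact (hU.abs_mass_le hC (hXY t)).trans (le_abs_self _)

lemma CadlagField.locallyIntegrable_flux (hU : CadlagField M U UL) (hη : Continuous η)
    (hq : Continuous q) (hX : LipschitzWith L X) :
    LocallyIntegrable (fun t => traceFlux η q (U (X t) t) (deriv X t)) volume := by
  obtain ⟨C, -, hC⟩ := exists_abs_le_of_continuous hη M
  obtain ⟨D, -, hD⟩ := exists_abs_le_of_continuous hq M
  exact locallyIntegrable_of_abs_le (hU.measurable_flux hη hq hX.continuous) fun t =>
    abs_traceFlux_le hC hD (hU.abs_le _ _) (abs_deriv_le_of_lipschitzWith hX t)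

lemma CadlagField.locallyIntegrable_flux_left (hU : CadlagField M U UL) (hη : Continuous η)
    (hq : Continuous q) (hX : LipschitzWith L X) :
    LocallyIntegrable (fun t => traceFlux η q (UL (X t) t) (deriv X t)) volume := by
  obtain ⟨C, -, hC⟩ := exists_abs_le_of_continuous hη M
  obtain ⟨D, -, hD⟩ := exists_abs_le_of_continuous hq M
  have h : Measurable fun t => UL (X t) t :=
    hU.measurable_left.comp (hX.continuous.measurable.prodMk measurable_id)
  exact locallyIntegrable_of_abs_le (((hη.measurable.comp h).mul (measurable_deriv X)).sub
    (hq.measurable.comp h)) fun t =>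
    abs_traceFlux_le hC hD (hU.abs_left_le _ _) (abs_deriv_le_of_lipschitzWith hX t)

lemma tendsto_traceFlux {ι : Type*} {F : Filter ι} {v : ι → ℝ} {v' : ℝ} (hη : Continuous η)
    (hq : Continuous q) (hv : Tendsto v F (𝓝 v')) (w : ℝ) :
    Tendsto (fun i => traceFlux η q (v i) w) F (𝓝 (traceFlux η q v' w)) :=
  (((hη.tendsto _).comp hv).mul_const w).sub ((hq.tendsto _).comp hv)

lemma lipschitzWith_sub_const (hY : LipschitzWith L Y) (d : ℝ) :
    LipschitzWith L fun t => Y t - d :=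
  LipschitzWith.of_dist_le_mul fun s t => by
    rw [dist_sub_right]; exact hY.dist_le_mul s t

lemma deriv_sub_const' (Y : ℝ → ℝ) (d t : ℝ) : deriv (fun s => Y s - d) t = deriv Y t := by
  simp

lemma tendsto_shift_left (x : ℝ) :
    Tendsto (fun n : ℕ => x - 1 / ((n : ℝ) + 1)) atTop (𝓝[<] x) := by
  refine (tendsto_affine_nhdsLT x one_pos).congr fun n => ?_
  ring

/-- Across a Lipschitz curve, the flux of an entropy seen from the right is at least the flux seen
from the left. -/
theorem ae_traceFlux_left_le_right (hU : CadlagField M U UL)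
    (hη : Continuous η) (hq : Continuous q) {u₀ : ℝ → ℝ} (hu₀ : Measurable u₀)
    (hu₀M : ∀ x, |u₀ x| ≤ M)
    (hW : ∀ φ, IsTest φ → (∀ x t, 0 ≤ t → 0 ≤ φ x t) → 0 ≤ weakForm η q u₀ U φ)
    (hY : LipschitzWith L Y) :
    ∀ᵐ t, 0 < t → traceFlux η q (UL (Y t) t) (deriv Y t) ≤
      traceFlux η q (U (Y t) t) (deriv Y t) := by
  obtain ⟨C, hC0, hC⟩ := exists_abs_le_of_continuous hη M
  obtain ⟨D, hD0, hD⟩ := exists_abs_le_of_continuous hq M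
  have hd : ∀ n : ℕ, 0 ≤ 1 / ((n : ℝ) + 1) := fun n => by positivity
  have hd1 : ∀ n : ℕ, 1 / ((n : ℝ) + 1) ≤ 1 := fun n =>
    (div_le_one (by positivity)).2 (by linarith [(Nat.cast_nonneg n : (0 : ℝ) ≤ n)])
  have hX : ∀ n : ℕ, LipschitzWith L fun t => Y t - 1 / ((n : ℝ) + 1) := fun n =>
    lipschitzWith_sub_const hY _
  have hd0 := tendsto_one_div_add_atTop_nhds_zero_nat (𝕜 := ℝ)
  have hb : ∀ w : ℝ → ℝ, (∀ x, |w x| ≤ C) → ∀ (a : ℝ) (n : ℕ),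
      |∫ x in Ioc (a - 1 / ((n : ℝ) + 1)) a, w x| ≤ C * (1 / ((n : ℝ) + 1)) := by
    intro w hw a n
    have h := norm_setIntegral_le_of_norm_le_const (μ := volume)
      (s := Ioc (a - 1 / ((n : ℝ) + 1)) a) (f := w) (C := C) (by simp) (fun x _ => hw x)
    rwa [Real.volume_real_Ioc_of_le (by linarith [hd n]), sub_sub_cancel] at h
  have hz : ∀ w : ℝ → ℝ, (∀ x, |w x| ≤ C) → ∀ a : ℝ,
      Tendsto (fun n : ℕ => ∫ x in Ioc (a - 1 / ((n : ℝ) + 1)) a, w x) atTop (𝓝 0) := by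
    intro w hw a
    apply squeeze_zero_norm (fun n => hb w hw a n)
    simpa using hd0.const_mul C
  -- The strips between `Y - 1 / (n + 1)` and `Y` lose their mass in the limit.
  have key : WeakLE (fun _ => 0) (fun t => traceFlux η q (U (Y t) t) (deriv Y t) -
      traceFlux η q (UL (Y t) t) (deriv Y t)) 0 := by
    refine WeakLE.of_tendsto (K := fun _ => C + ((C * L + D) + (C * L + D)))
      (Eventually.of_forall fun n => weakLE_strip hU hη hq hu₀ hu₀M hW (hX n) hY
        (fun t => by linarith [hd n])) ?_ ?_ continuous_const ?_ ?_ ?_ ?_ ?_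
    · exact fun n => hU.measurable_mass hη (hX n).continuous hY.continuous
    · exact fun n => (hU.measurable_flux hη hq hY.continuous).sub
        (hU.measurable_flux hη hq (hX n).continuous)
    · intro n t
      refine (hb _ (fun x => hC _ (hU.abs_le x t)) (Y t) n).trans ?_
      have : C * (1 / ((n : ℝ) + 1)) ≤ C := mul_le_of_le_one_right hC0 (hd1 n)
      have hL := L.2
      have : 0 ≤ C * (L : ℝ) + D := add_nonneg (mul_nonneg hC0 L.2) hD0
      linarith
    · intro n t
      refine (abs_sub _ _).trans ?_
      have h1 := abs_traceFlux_le hC hD (hU.abs_le (Y t) t) (abs_deriv_le_of_lipschitzWith hY t)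
      have h2 := abs_traceFlux_le hC hD (hU.abs_le (Y t - 1 / ((n : ℝ) + 1)) t)
        (abs_deriv_le_of_lipschitzWith (hX n) t)
      linarith
    · exact fun t => hz _ (fun x => hC _ (hU.abs_le x t)) (Y t)
    · intro t
      simp only [deriv_sub_const']
      exact tendsto_const_nhds.sub (tendsto_traceFlux hη hq
        ((hU.tendsto_left (Y t) t).comp (tendsto_shift_left (Y t))) _)
    · exact hz _ (fun x => hC _ (hu₀M x)) (Y 0)
  filter_upwards [key.ae_nonneg ((hU.locallyIntegrable_flux hη hq hY).sub
    (hU.locallyIntegrable_flux_left hη hq hY))] with t ht ht0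
  exact sub_nonneg.1 (ht ht0)

/-- Entropy balance in a strip of positive width, with the traces taken from inside the strip. -/
theorem weakLE_strip_inner (hU : CadlagField M U UL)
    (hη : Continuous η) (hq : Continuous q) {u₀ : ℝ → ℝ} (hu₀ : Measurable u₀)
    (hu₀M : ∀ x, |u₀ x| ≤ M)
    (hW : ∀ φ, IsTest φ → (∀ x t, 0 ≤ t → 0 ≤ φ x t) → 0 ≤ weakForm η q u₀ U φ)
    (hX : LipschitzWith L X) (hY : LipschitzWith L Y) {d : ℝ} (hd : 0 < d)
    (hXY : ∀ t, X t + d ≤ Y t) :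
    WeakLE (fun t => ∫ x in Ioc (X t) (Y t), η (U x t))
      (fun t => traceFlux η q (UL (Y t) t) (deriv Y t) - traceFlux η q (U (X t) t) (deriv X t))
      (∫ x in Ioc (X 0) (Y 0), η (u₀ x)) := by
  obtain ⟨C, hC0, hC⟩ := exists_abs_le_of_continuous hη M
  obtain ⟨D, hD0, hD⟩ := exists_abs_le_of_continuous hq M
  have hd0 : ∀ n : ℕ, 0 ≤ 1 / ((n : ℝ) + 1) := fun n => by positivity
  have hY' : ∀ n : ℕ, LipschitzWith L fun t => Y t - 1 / ((n : ℝ) + 1) := fun n =>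
    lipschitzWith_sub_const hY _
  have hdlim := tendsto_one_div_add_atTop_nhds_zero_nat (𝕜 := ℝ)
  have hz : ∀ w : ℝ → ℝ, Measurable w → (∀ x, |w x| ≤ C) → ∀ a b : ℝ, a + d ≤ b →
      Tendsto (fun n : ℕ => ∫ x in Ioc a (b - 1 / ((n : ℝ) + 1)), w x) atTop
        (𝓝 (∫ x in Ioc a b, w x)) := by
    intro w hwm hw a b hab
    have hwi : LocallyIntegrable w volume := locallyIntegrable_of_abs_le hwm hw
    have hii : ∀ a b, IntervalIntegrable w volume a b := fun a b =>
      (hwi.integrableOn_isCompact isCompact_uIcc).intervalIntegrable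
    have hc := (intervalIntegral.continuous_primitive hii a).tendsto b
    have h1 : Tendsto (fun n : ℕ => b - 1 / ((n : ℝ) + 1)) atTop (𝓝 b) := by
      simpa using hdlim.const_sub b
    have h2 := hc.comp h1
    rw [intervalIntegral.integral_of_le (by linarith)] at h2
    refine h2.congr' ?_
    filter_upwards [hdlim.eventually (gt_mem_nhds hd)] with n hn
    simp only [Function.comp]
    rw [intervalIntegral.integral_of_le (by linarith)]
  -- The right boundary is approached by the curves `Y - 1 / (n + 1)`, whose right traces tend to
  -- the left trace at `Y`.
  refine WeakLE.of_tendsto (K := fun t => C * (Y t - X t) + ((C * L + D) + (C * L + D)))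
      (m := fun n t => ∫ x in Ioc (X t) (Y t - 1 / ((n : ℝ) + 1)), η (U x t))
      (F := fun n t => traceFlux η q (U (Y t - 1 / ((n : ℝ) + 1)) t)
        (deriv (fun t => Y t - 1 / ((n : ℝ) + 1)) t) - traceFlux η q (U (X t) t) (deriv X t))
      (m₀ := fun n => ∫ x in Ioc (X 0) (Y 0 - 1 / ((n : ℝ) + 1)), η (u₀ x))
      ?_ ?_ ?_ ?_ ?_ ?_ ?_ ?_ ?_
  · filter_upwards [hdlim.eventually (gt_mem_nhds hd)] with n hn
    exact weakLE_strip hU hη hq hu₀ hu₀M hW hX (hY' n) fun t => by linarith [hXY t]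
  · exact fun n => hU.measurable_mass hη hX.continuous (hY' n).continuous
  · exact fun n => (hU.measurable_flux hη hq (hY' n).continuous).sub
      (hU.measurable_flux hη hq hX.continuous)
  · exact (continuous_const.mul (hY.continuous.sub hX.continuous)).add continuous_const
  · intro n t
    have hL : 0 ≤ C * (L : ℝ) + D := add_nonneg (mul_nonneg hC0 L.2) hD0
    have h1 : 0 ≤ C * (Y t - X t) := mul_nonneg hC0 (by linarith [hXY t])
    rcases le_or_gt (X t) (Y t - 1 / ((n : ℝ) + 1)) with h | h
    · have h2 := hU.abs_mass_le hC h (t := t)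
      have h3 : C * (Y t - 1 / ((n : ℝ) + 1) - X t) ≤ C * (Y t - X t) :=
        mul_le_mul_of_nonneg_left (by linarith [hd0 n]) hC0
      linarith
    · rw [Ioc_eq_empty (not_lt.2 h.le)]
      simp only [Measure.restrict_empty, integral_zero_measure, abs_zero]
      linarith
  · intro n t
    refine (abs_sub _ _).trans ?_
    have h1 := abs_traceFlux_le hC hD (hU.abs_le (Y t - 1 / ((n : ℝ) + 1)) t)
      (abs_deriv_le_of_lipschitzWith (hY' n) t)
    have h2 := abs_traceFlux_le hC hD (hU.abs_le (X t) t) (abs_deriv_le_of_lipschitzWith hX t)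
    have h3 : 0 ≤ C * (Y t - X t) := mul_nonneg hC0 (by linarith [hXY t])
    linarith
  · exact fun t => hz _ (hU.comp_measurable hη t) (fun x => hC _ (hU.abs_le x t)) _ _ (hXY t)
  · intro t
    simp only [deriv_sub_const']
    exact (tendsto_traceFlux hη hq
        ((hU.tendsto_left (Y t) t).comp (tendsto_shift_left (Y t))) _).sub tendsto_const_nhds
  · exact hz _ (hη.measurable.comp hu₀) (fun x => hC _ (hu₀M x)) _ _ (hXY 0)

end Traces

/-! ### The potential of a weak solution -/

/-- The potential `V` with `∂ₓ V = u` and `∂ₜ V = -f(u)`, normalised by `V(0, 0) = 0`. -/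
noncomputable def potential (f u₀ : ℝ → ℝ) (U : ℝ → ℝ → ℝ) (x t : ℝ) : ℝ :=
  (∫ y in (0 : ℝ)..x, u₀ y) - ∫ τ in (0 : ℝ)..t, f (U x τ)

lemma intervalIntegrable_of_abs_le {g : ℝ → ℝ} (hg : Measurable g) {C : ℝ} (h : ∀ t, |g t| ≤ C)
    (a b : ℝ) : IntervalIntegrable g volume a b :=
  ((locallyIntegrable_of_abs_le hg h).integrableOn_isCompact isCompact_uIcc).intervalIntegrable

lemma weakForm_neg (η q u₀ : ℝ → ℝ) (U φ : ℝ → ℝ → ℝ) :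
    weakForm (fun v => -η v) (fun v => -q v) u₀ U φ = -weakForm η q u₀ U φ := by
  unfold weakForm
  have h1 : ∀ t x : ℝ, -η (U x t) * deriv (fun τ => φ x τ) t + -q (U x t) * deriv (fun y => φ y t) x =
    -(η (U x t) * deriv (fun τ => φ x τ) t + q (U x t) * deriv (fun y => φ y t) x) := by
    intro t x; ring
  have h2 : ∀ x : ℝ, -η (u₀ x) * φ x 0 = -(η (u₀ x) * φ x 0) := by
    intro x; ring
  simp only [h1, h2, integral_neg]
  ring

lemma dist_le_of_lipschitz_comp {X : ℝ → ℝ} {L : ℝ≥0} (hX : LipschitzWith L X) (s t : ℝ) :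
    |X s - X t| ≤ L * |s - t| := hX.dist_le_mul s t

/-- A bounded field in right-continuous form that solves the conservation law weakly with bounded
initial data. -/
structure WeakField (f u₀ : ℝ → ℝ) (M : ℝ) (U UL : ℝ → ℝ → ℝ) : Prop
    extends CadlagField M U UL where
  continuous_flux : Continuous f
  measurable_init : Measurable u₀
  abs_init_le : ∀ x, |u₀ x| ≤ M
  weak : ∀ φ, IsTest φ → weakForm id f u₀ U φ = 0

section Potential

variable {f u₀ : ℝ → ℝ} {M : ℝ} {U UL : ℝ → ℝ → ℝ} {X Y : ℝ → ℝ} {L : ℝ≥0}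

/-- Conservation of mass in strips, at almost all times. -/
lemma WeakField.ae_mass_eq (h : WeakField f u₀ M U UL) (hX : LipschitzWith L X)
    (hY : LipschitzWith L Y) (hXY : ∀ t, X t ≤ Y t) :
    ∀ᵐ q, 0 < q → ∫ x in Ioc (X q) (Y q), U x q = (∫ x in Ioc (X 0) (Y 0), u₀ x) +
      ∫ t in Ioc 0 q, (traceFlux id f (U (Y t) t) (deriv Y t) -
        traceFlux id f (U (X t) t) (deriv X t)) := by
  have hU := h.toCadlagField
  have w1 := weakLE_strip hU continuous_id h.continuous_flux h.measurable_init h.abs_init_le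
    (fun φ hφ _ => (h.weak φ hφ).ge) hX hY hXY
  have w2 := weakLE_strip (η := fun v => -id v) (q := fun v => -f v) hU continuous_id.neg
    h.continuous_flux.neg h.measurable_init h.abs_init_le
    (fun φ hφ _ => by rw [weakForm_neg, h.weak φ hφ, neg_zero]) hX hY hXY
  obtain ⟨S₁, hS₁, a₁, -⟩ := w1.ae_le
    (hU.locallyIntegrable_mass continuous_id hX.continuous hY.continuous hXY)
    ((hU.locallyIntegrable_flux continuous_id h.continuous_flux hY).sub
      (hU.locallyIntegrable_flux continuous_id h.continuous_flux hX))
  obtain ⟨S₂, hS₂, a₂, -⟩ := w2.ae_le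
    (hU.locallyIntegrable_mass continuous_id.neg hX.continuous hY.continuous hXY)
    ((hU.locallyIntegrable_flux continuous_id.neg h.continuous_flux.neg hY).sub
      (hU.locallyIntegrable_flux continuous_id.neg h.continuous_flux.neg hX))
  filter_upwards [hS₁, hS₂] with q h₁ h₂ hq
  have e₁ := a₁ q h₁ hq
  have e₂ := a₂ q h₂ hq
  have e₃ : ∀ v w, traceFlux (fun v => -id v) (fun v => -f v) v w = -traceFlux id f v w := by
    intro v w; simp only [traceFlux]; ring
  simp only [e₃, ← neg_sub', integral_neg] at e₂
  simp only [id] at e₁ e₂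
  linarith

lemma WeakField.exists_flux_bound (h : WeakField f u₀ M U UL) :
    ∃ D, 0 ≤ D ∧ ∀ x t, |f (U x t)| ≤ D := by
  obtain ⟨D, hD0, hD⟩ := exists_abs_le_of_continuous h.continuous_flux M
  exact ⟨D, hD0, fun x t => hD _ (h.abs_le x t)⟩

lemma WeakField.measurable_flux_time (h : WeakField f u₀ M U UL) (x : ℝ) :
    Measurable fun t => f (U x t) :=
  h.continuous_flux.measurable.comp (h.measurable.comp measurable_prodMk_left)

lemma WeakField.intervalIntegrable_flux (h : WeakField f u₀ M U UL) (x a b : ℝ) :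
    IntervalIntegrable (fun t => f (U x t)) volume a b := by
  obtain ⟨D, -, hD⟩ := h.exists_flux_bound
  exact intervalIntegrable_of_abs_le (h.measurable_flux_time x) (fun t => hD x t) a b

lemma WeakField.intervalIntegrable_init (h : WeakField f u₀ M U UL) (a b : ℝ) :
    IntervalIntegrable u₀ volume a b :=
  intervalIntegrable_of_abs_le h.measurable_init h.abs_init_le a b

lemma WeakField.measurable_slice (h : WeakField f u₀ M U UL) (t : ℝ) : Measurable fun x => U x t :=
  h.measurable.comp measurable_prodMk_right

lemma WeakField.intervalIntegrable_slice (h : WeakField f u₀ M U UL) (t a b : ℝ) :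
    IntervalIntegrable (fun x => U x t) volume a b :=
  intervalIntegrable_of_abs_le (h.measurable_slice t) (fun x => h.abs_le x t) a b

lemma tendsto_potential_right (h : WeakField f u₀ M U UL) (x t : ℝ) :
    Tendsto (fun y => potential f u₀ U y t) (𝓝[>] x) (𝓝 (potential f u₀ U x t)) := by
  obtain ⟨D, hD0, hD⟩ := h.exists_flux_bound
  unfold potential
  refine Tendsto.sub ?_ ?_
  · exact ((intervalIntegral.continuous_primitive h.intervalIntegrable_init 0).tendsto x).mono_left
      nhdsWithin_le_nhds
  · apply intervalIntegral.tendsto_integral_filter_of_dominated_convergence (fun _ => D)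
    · exact Eventually.of_forall fun y => (h.measurable_flux_time y).aestronglyMeasurable
    · exact Eventually.of_forall fun y => ae_of_all _ fun τ _ => hD y τ
    · exact intervalIntegrable_const
    · exact ae_of_all _ fun τ _ => (h.continuous_flux.tendsto _).comp (h.tendsto_right x τ)

/-- At almost every time the potential is a primitive of the solution. -/
lemma WeakField.ae_integral_eq_potential (h : WeakField f u₀ M U UL) :
    ∀ᵐ t, 0 < t → ∀ a b, ∫ x in a..b, U x t = potential f u₀ U b t - potential f u₀ U a t := by
  have hrat : ∀ᵐ t, ∀ a b : ℚ, (a : ℝ) ≤ b → 0 < t → ∫ x in (a : ℝ)..b, U x t =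
      potential f u₀ U b t - potential f u₀ U a t := by
    rw [ae_all_iff]; intro a
    rw [ae_all_iff]; intro b
    by_cases hab : (a : ℝ) ≤ b
    · have h1 := h.ae_mass_eq (L := 0) (LipschitzWith.const (a : ℝ)) (LipschitzWith.const (b : ℝ))
        (fun _ => hab)
      filter_upwards [h1] with t ht _ ht0
      have ht := ht ht0
      have e : ∀ τ, traceFlux id f (U b τ) (deriv (fun _ : ℝ => (b : ℝ)) τ) -
        traceFlux id f (U a τ) (deriv (fun _ : ℝ => (a : ℝ)) τ) = f (U a τ) - f (U b τ) := by
        intro τ; simp [traceFlux]; ring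
      simp only [e] at ht
      rw [← intervalIntegral.integral_of_le hab, ← intervalIntegral.integral_of_le hab,
        ← intervalIntegral.integral_of_le ht0.le,
        intervalIntegral.integral_sub (h.intervalIntegrable_flux _ _ _)
          (h.intervalIntegrable_flux _ _ _),
        ← intervalIntegral.integral_interval_sub_left (h.intervalIntegrable_init 0 b)
          (h.intervalIntegrable_init 0 a)] at ht
      rw [ht, potential, potential]
      ring
    · exact ae_of_all _ fun t hab' => absurd hab' hab
  filter_upwards [hrat] with t ht ht0
  -- The difference between the potential and the primitive of the slice is right-continuous and
  -- constant on the rationals.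
  set E : ℝ → ℝ := fun x => potential f u₀ U x t - ∫ y in (0 : ℝ)..x, U y t with hE
  have hEq : ∀ r : ℚ, E r = E 0 := by
    intro r
    simp only [hE, intervalIntegral.integral_same, sub_zero]
    rcases le_total (0 : ℝ) r with h0 | h0
    · have := ht 0 r (by simpa using h0) ht0
      simp only [Rat.cast_zero] at this
      linarith
    · have := ht r 0 (by simpa using h0) ht0
      simp only [Rat.cast_zero] at this
      rw [intervalIntegral.integral_symm] at this
      linarith
  have hEc : ∀ x, E x = E 0 := by
    intro x
    have hr : Tendsto E (𝓝[>] x) (𝓝 (E x)) := (tendsto_potential_right h x t).sub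
      (((intervalIntegral.continuous_primitive (h.intervalIntegrable_slice t) 0).tendsto x).mono_left
        nhdsWithin_le_nhds)
    have hf : ∃ᶠ y in 𝓝[>] x, E y ∈ ({E 0} : Set ℝ) := by
      intro hn
      obtain ⟨w, hw, hsub⟩ := mem_nhdsGT_iff_exists_Ioo_subset.1 hn
      obtain ⟨r, hr1, hr2⟩ := exists_rat_btwn (mem_Ioi.1 hw)
      exact hsub ⟨hr1, hr2⟩ (hEq r)
    exact isClosed_singleton.mem_of_frequently_of_tendsto hf hr
  intro a b
  have ha := hEc a
  have hb := hEc b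
  rw [← intervalIntegral.integral_interval_sub_left (h.intervalIntegrable_slice t 0 b)
    (h.intervalIntegrable_slice t 0 a)]
  simp only [hE] at ha hb
  linarith

lemma WeakField.integral_init_eq_potential (h : WeakField f u₀ M U UL) (a b : ℝ) :
    ∫ x in a..b, u₀ x = potential f u₀ U b 0 - potential f u₀ U a 0 := by
  simp only [potential, intervalIntegral.integral_same, sub_zero]
  rw [intervalIntegral.integral_interval_sub_left (h.intervalIntegrable_init 0 b)
    (h.intervalIntegrable_init 0 a)]

lemma WeakField.continuous_potential_time (h : WeakField f u₀ M U UL) (x : ℝ) :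
    Continuous fun t => potential f u₀ U x t :=
  continuous_const.sub (intervalIntegral.continuous_primitive (h.intervalIntegrable_flux x) 0)

lemma WeakField.abs_potential_sub_time_le (h : WeakField f u₀ M U UL) {D : ℝ}
    (hD : ∀ x t, |f (U x t)| ≤ D) (x s t : ℝ) :
    |potential f u₀ U x s - potential f u₀ U x t| ≤ D * |s - t| := by
  have e : potential f u₀ U x s - potential f u₀ U x t = ∫ τ in s..t, f (U x τ) := by
    rw [← intervalIntegral.integral_interval_sub_left (h.intervalIntegrable_flux x 0 t)
      (h.intervalIntegrable_flux x 0 s)]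
    unfold potential; ring
  rw [e, ← Real.norm_eq_abs, abs_sub_comm]
  exact intervalIntegral.norm_integral_le_of_norm_le_const fun τ _ => hD x τ

lemma closure_of_ae_pos {P : ℝ → Prop} (hP : ∀ᵐ t, 0 < t → P t) {G : ℝ → ℝ} {c : ℝ}
    (hG : ∀ t, 0 ≤ t → ContinuousWithinAt G (Ioi t) t) (h : ∀ t, 0 < t → P t → G t ≤ c) {t : ℝ}
    (ht : 0 ≤ t) : G t ≤ c := by
  refine isClosed_Iic.mem_of_frequently_of_tendsto (s := Iic c) ?_ (hG t ht)
  refine ((frequently_nhdsGT_of_ae hP t).and_eventually self_mem_nhdsWithin).mono ?_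
  rintro s ⟨hs, hts⟩
  have : 0 < s := ht.trans_lt hts
  exact h s this (hs this)

lemma WeakField.abs_potential_sub_space_le (h : WeakField f u₀ M U UL) (x y : ℝ) {t : ℝ}
    (ht : 0 ≤ t) : |potential f u₀ U x t - potential f u₀ U y t| ≤ M * |x - y| := by
  refine closure_of_ae_pos (G := fun t => |potential f u₀ U x t - potential f u₀ U y t|)
    h.ae_integral_eq_potential (fun t _ => (((h.continuous_potential_time x).sub
      (h.continuous_potential_time y)).abs).continuousWithinAt) ?_ ht
  intro s _ hs
  rw [← hs y x, ← Real.norm_eq_abs]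
  exact intervalIntegral.norm_integral_le_of_norm_le_const fun z _ => h.abs_le z s

lemma WeakField.continuousWithinAt_potential_curve (h : WeakField f u₀ M U UL) (hX : Continuous X)
    (t : ℝ) : ContinuousWithinAt (fun t => potential f u₀ U (X t) t) (Ici 0) t := by
  obtain ⟨D, hD0, hD⟩ := h.exists_flux_bound
  unfold ContinuousWithinAt
  rw [tendsto_iff_norm_sub_tendsto_zero]
  have hb : Tendsto (fun s => M * |X s - X t| + D * |s - t|) (𝓝[Ici 0] t) (𝓝 0) := by
    have hc : Continuous fun s => M * |X s - X t| + D * |s - t| := by fun_prop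
    have := hc.tendsto t
    simp only [sub_self, abs_zero, mul_zero, add_zero] at this
    exact this.mono_left nhdsWithin_le_nhds
  refine squeeze_zero' (Eventually.of_forall fun s => norm_nonneg _) ?_ hb
  filter_upwards [self_mem_nhdsWithin] with s hs
  have h1 := h.abs_potential_sub_space_le (X s) (X t) hs
  have h2 := h.abs_potential_sub_time_le hD (X t) s t
  rw [Real.norm_eq_abs]
  calc _ ≤ _ := abs_sub_le _ (potential f u₀ U (X t) s) _
    _ ≤ _ := add_le_add h1 h2

/-- Conservation of mass in strips, expressed through the potential, at all times. -/
theorem WeakField.potential_strip (h : WeakField f u₀ M U UL) (hX : LipschitzWith L X)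
    (hY : LipschitzWith L Y) (hXY : ∀ t, X t ≤ Y t) {t : ℝ} (ht : 0 ≤ t) :
    potential f u₀ U (Y t) t - potential f u₀ U (X t) t =
      potential f u₀ U (Y 0) 0 - potential f u₀ U (X 0) 0 +
      ∫ τ in (0 : ℝ)..t, (traceFlux id f (U (Y τ) τ) (deriv Y τ) -
        traceFlux id f (U (X τ) τ) (deriv X τ)) := by
  have hU := h.toCadlagField
  have hF := (hU.locallyIntegrable_flux continuous_id h.continuous_flux hY).sub
    (hU.locallyIntegrable_flux continuous_id h.continuous_flux hX)
  set F : ℝ → ℝ := fun τ => traceFlux id f (U (Y τ) τ) (deriv Y τ) -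
        traceFlux id f (U (X τ) τ) (deriv X τ)
  have hFi : ∀ a b, IntervalIntegrable F volume a b := fun a b =>
    (hF.integrableOn_isCompact isCompact_uIcc).intervalIntegrable
  have hae : ∀ᵐ s, 0 < s → potential f u₀ U (Y s) s - potential f u₀ U (X s) s =
      potential f u₀ U (Y 0) 0 - potential f u₀ U (X 0) 0 + ∫ τ in (0 : ℝ)..s, F τ := by
    filter_upwards [h.ae_mass_eq hX hY hXY, h.ae_integral_eq_potential] with s h1 h2 hs
    rw [← h2 hs, intervalIntegral.integral_of_le (hXY s), h1 hs,
      ← intervalIntegral.integral_of_le (hXY 0), h.integral_init_eq_potential,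
      intervalIntegral.integral_of_le hs.le]
  have hc : ∀ s, 0 ≤ s → ContinuousWithinAt (fun s =>
      |potential f u₀ U (Y s) s - potential f u₀ U (X s) s - (∫ τ in (0 : ℝ)..s, F τ) -
      (potential f u₀ U (Y 0) 0 - potential f u₀ U (X 0) 0)|) (Ioi s) s := by
    intro s hs
    have hsub : Ioi s ⊆ Ici (0 : ℝ) := fun r hr => hs.trans (le_of_lt hr)
    refine ContinuousWithinAt.abs ?_
    exact ((((h.continuousWithinAt_potential_curve hY.continuous s).mono hsub).sub
      ((h.continuousWithinAt_potential_curve hX.continuous s).mono hsub)).sub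
      (intervalIntegral.continuous_primitive hFi 0).continuousWithinAt).sub
      continuousWithinAt_const
  have := closure_of_ae_pos (c := 0) hae hc (fun s _ hs => by rw [hs]; simp) ht
  have := abs_nonpos_iff.1 this
  linarith

/-- The Rankine–Hugoniot condition along Lipschitz curves. -/
theorem WeakField.ae_traceFlux_eq (h : WeakField f u₀ M U UL) (hY : LipschitzWith L Y) :
    ∀ᵐ t, 0 < t → traceFlux id f (UL (Y t) t) (deriv Y t) =
      traceFlux id f (U (Y t) t) (deriv Y t) := by
  have hU := h.toCadlagField
  have w1 := ae_traceFlux_left_le_right hU continuous_id h.continuous_flux h.measurable_init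
    h.abs_init_le (fun φ hφ _ => (h.weak φ hφ).ge) hY
  have w2 := ae_traceFlux_left_le_right (η := fun v => -id v) (q := fun v => -f v) hU
    continuous_id.neg h.continuous_flux.neg h.measurable_init h.abs_init_le
    (fun φ hφ _ => by rw [weakForm_neg, h.weak φ hφ, neg_zero]) hY
  filter_upwards [w1, w2] with t h1 h2 ht
  have h1 := h1 ht
  have h2 := h2 ht
  simp only [traceFlux, id] at h1 h2 ⊢
  linarith

end Potential

/-! ### Filippov curves of a right-continuous velocity field -/

lemma CadlagField.comp {M C : ℝ} {U UL : ℝ → ℝ → ℝ} (hU : CadlagField M U UL) {g : ℝ → ℝ}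
    (hg : Continuous g) (hC : ∀ v, |v| ≤ M → |g v| ≤ C) :
    CadlagField C (fun x t => g (U x t)) (fun x t => g (UL x t)) where
  measurable := hg.measurable.comp hU.measurable
  measurable_left := hg.measurable.comp hU.measurable_left
  abs_le x t := hC _ (hU.abs_le x t)
  abs_left_le x t := hC _ (hU.abs_left_le x t)
  tendsto_right x t := (hg.tendsto _).comp (hU.tendsto_right x t)
  tendsto_left x t := (hg.tendsto _).comp (hU.tendsto_left x t)
  ae_left_eq t := (hU.ae_left_eq t).mono fun x hx => by simp only [hx]

/-- A Filippov curve from time `s` on, for the field `a` with left limits `aL`: a Lipschitz curve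
whose speed lies between the two one-sided limits of the field at almost every later time. -/
structure FilippovCurve (a aL : ℝ → ℝ → ℝ) (Λ : ℝ≥0) (s : ℝ) (X : ℝ → ℝ) : Prop where
  lipschitz : LipschitzWith Λ X
  deriv_mem : ∀ᵐ t, s < t → deriv X t ∈ uIcc (aL (X t) t) (a (X t) t)

/-- The supremum of the field over the ball of radius `δ` in space, taken over rational shifts so
that it is measurable. -/
noncomputable def localSup (a : ℝ → ℝ → ℝ) (δ x t : ℝ) : ℝ :=
  ⨆ r : {r : ℚ // |(r : ℝ)| < δ}, a (x + (r : ℚ)) t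

section LocalSup

variable {Λ : ℝ≥0} {a aL : ℝ → ℝ → ℝ}

lemma CadlagField.bddAbove_localSup (ha : CadlagField Λ a aL) (δ x t : ℝ) :
    BddAbove (range fun r : {r : ℚ // |(r : ℝ)| < δ} => a (x + (r : ℚ)) t) :=
  ⟨Λ, by rintro _ ⟨r, rfl⟩; exact (le_abs_self _).trans (ha.abs_le _ _)⟩

lemma nonempty_shift {δ : ℝ} (hδ : 0 < δ) : Nonempty {r : ℚ // |(r : ℝ)| < δ} :=
  ⟨⟨0, by simpa using hδ⟩⟩

lemma CadlagField.measurable_localSup (ha : CadlagField Λ a aL) (δ : ℝ) :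
    Measurable (Function.uncurry (localSup a δ)) := by
  unfold localSup
  apply Measurable.iSup (f := fun (r : {r : ℚ // |(r : ℝ)| < δ}) (p : ℝ × ℝ) =>
    a (p.1 + (r : ℚ)) p.2)
  intro r
  exact ha.measurable.comp ((measurable_fst.add_const _).prodMk measurable_snd)

lemma CadlagField.localSup_le (_ : CadlagField Λ a aL) {δ : ℝ} (hδ : 0 < δ) {x t c : ℝ}
    (h : ∀ y, |y - x| < δ → a y t ≤ c) : localSup a δ x t ≤ c := by
  have := nonempty_shift hδ
  exact ciSup_le fun r => h _ (by simpa using r.2)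

lemma CadlagField.le_localSup (ha : CadlagField Λ a aL) {δ x y t : ℝ} (h : |y - x| < δ) :
    a y t ≤ localSup a δ x t := by
  refine isClosed_Iic.mem_of_frequently_of_tendsto (s := Iic (localSup a δ x t)) ?_
    (ha.tendsto_right y t)
  have hev : ∀ᶠ z in 𝓝[>] y, |z - x| < δ :=
    ((continuous_abs.comp (continuous_id.sub continuous_const)).tendsto y).mono_left
      nhdsWithin_le_nhds |>.eventually (gt_mem_nhds h)
  intro hn
  obtain ⟨w, hw, hsub⟩ := mem_nhdsGT_iff_exists_Ioo_subset.1 (hev.and hn)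
  obtain ⟨r, hr1, hr2⟩ := exists_rat_btwn (show y - x < w - x from sub_lt_sub_right hw x)
  have hmem := hsub (⟨by linarith, by linarith⟩ : x + (r : ℝ) ∈ Ioo y w)
  refine hmem.2 ?_
  exact le_ciSup (ha.bddAbove_localSup δ x t) ⟨r, by simpa using hmem.1⟩

lemma CadlagField.left_le_localSup (ha : CadlagField Λ a aL) {δ x y t : ℝ} (h : |y - x| < δ) :
    aL y t ≤ localSup a δ x t := by
  have hev : ∀ᶠ z in 𝓝[<] y, |z - x| < δ :=
    ((continuous_abs.comp (continuous_id.sub continuous_const)).tendsto y).mono_left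
      nhdsWithin_le_nhds |>.eventually (gt_mem_nhds h)
  exact le_of_tendsto (ha.tendsto_left y t) (hev.mono fun z hz => ha.le_localSup hz)

lemma CadlagField.abs_localSup_le (ha : CadlagField Λ a aL) {δ : ℝ} (hδ : 0 < δ) (x t : ℝ) :
    |localSup a δ x t| ≤ Λ := by
  refine _root_.abs_le.2 ⟨?_, ha.localSup_le hδ fun y _ => (le_abs_self _).trans (ha.abs_le y t)⟩
  exact (_root_.abs_le.1 (ha.abs_le x t)).1.trans (ha.le_localSup (by simpa using hδ))

/-- As the radius shrinks, the local supremum tends to the larger one-sided limit. -/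
lemma CadlagField.tendsto_localSup (ha : CadlagField Λ a aL) (x t : ℝ) :
    Tendsto (fun n : ℕ => localSup a (1 / ((n : ℝ) + 1)) x t) atTop
      (𝓝 (max (aL x t) (a x t))) := by
  have hpos : ∀ n : ℕ, 0 < 1 / ((n : ℝ) + 1) := fun n => by positivity
  rw [tendsto_order]
  constructor
  · intro c hc
    refine Eventually.of_forall fun n => hc.trans_le (max_le ?_ ?_)
    · exact ha.left_le_localSup (by simpa using hpos n)
    · exact ha.le_localSup (by simpa using hpos n)
  · intro c hc
    obtain ⟨c', hc1, hc2⟩ := exists_between hc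
    obtain ⟨w, hw, hw'⟩ := mem_nhdsGT_iff_exists_Ioo_subset.1
      ((ha.tendsto_right x t).eventually (gt_mem_nhds ((le_max_right _ _).trans_lt hc1)))
    obtain ⟨v, hv, hv'⟩ := mem_nhdsLT_iff_exists_Ioo_subset.1
      ((ha.tendsto_left x t).eventually (gt_mem_nhds ((le_max_left _ _).trans_lt hc1)))
    have hw : x < w := hw
    have hv : v < x := hv
    have hm : 0 < min (w - x) (x - v) := lt_min (by linarith) (by linarith)
    filter_upwards [(tendsto_one_div_add_atTop_nhds_zero_nat (𝕜 := ℝ)).eventually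
      (gt_mem_nhds hm)] with n hn
    refine lt_of_le_of_lt (ha.localSup_le (hpos n) fun y hy => ?_) hc2
    have hy := abs_lt.1 (hy.trans hn)
    have h1 := min_le_left (w - x) (x - v)
    have h2 := min_le_right (w - x) (x - v)
    rcases lt_trichotomy y x with h | h | h
    · exact le_of_lt (hv' ⟨by linarith, h⟩)
    · rw [h]; exact ((le_max_right _ _).trans_lt hc1).le
    · exact le_of_lt (hw' ⟨h, by linarith⟩)

lemma CadlagField.neg (ha : CadlagField Λ a aL) :
    CadlagField Λ (fun x t => -a x t) (fun x t => -aL x t) :=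
  ha.comp continuous_neg fun v hv => by rwa [abs_neg]

/-- Any value between the one-sided limits near `x` is bounded by the local supremum. -/
lemma CadlagField.le_localSup_of_mem (ha : CadlagField Λ a aL) {δ x y t w : ℝ} (h : |y - x| < δ)
    (hw : w ∈ uIcc (aL y t) (a y t)) :
    w ≤ localSup a δ x t ∧ -w ≤ localSup (fun x t => -a x t) δ x t := by
  have h1 := ha.le_localSup h (t := t)
  have h2 := ha.left_le_localSup h (t := t)
  have h3 := ha.neg.le_localSup h (t := t)
  have h4 := ha.neg.left_le_localSup h (t := t)
  rcases mem_uIcc.1 hw with h5 | h5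
  · exact ⟨h5.2.trans h1, (neg_le_neg h5.1).trans h4⟩
  · exact ⟨h5.2.trans h2, (neg_le_neg h5.1).trans h3⟩

lemma CadlagField.locallyIntegrable_localSup (ha : CadlagField Λ a aL) {δ : ℝ} (hδ : 0 < δ)
    {X : ℝ → ℝ} (hX : Continuous X) :
    LocallyIntegrable (fun t => localSup a δ (X t) t) volume :=
  locallyIntegrable_of_abs_le
    ((ha.measurable_localSup δ).comp (hX.measurable.prodMk measurable_id))
    fun _ => ha.abs_localSup_le hδ _ _

lemma ae_deriv_le_of_increment_le {X g : ℝ → ℝ} (hX : LipschitzWith Λ X)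
    (hg : LocallyIntegrable g volume) {s : ℝ}
    (h : ∀ p q, s ≤ p → p ≤ q → X q - X p ≤ ∫ t in Ioc p q, g t) :
    ∀ᵐ t, s < t → deriv X t ≤ g t := by
  filter_upwards [hX.ae_differentiableAt_real, ae_tendsto_average_right hg] with t hd ht hst
  have h1 : Tendsto (slope X t) (𝓝[>] t) (𝓝 (deriv X t)) :=
    ((hasDerivAt_iff_tendsto_slope.1 hd.hasDerivAt).mono_left
    (nhdsWithin_mono t (fun q (hq : t < q) => hq.ne')))
  refine le_of_tendsto_of_tendsto h1 ht ?_
  filter_upwards [self_mem_nhdsWithin] with q hq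
  have hq : t < q := hq
  rw [slope_def_field, div_eq_inv_mul]
  exact mul_le_mul_of_nonneg_left (h t q hst.le hq.le) (inv_nonneg.2 (by linarith))

/-- A Lipschitz curve whose increments are controlled by the local suprema of the field at all small
radii is a Filippov curve. -/
lemma CadlagField.filippovCurve_of_increment (ha : CadlagField Λ a aL) {X : ℝ → ℝ}
    (hX : LipschitzWith Λ X) {s : ℝ}
    (h1 : ∀ δ, 0 < δ → ∀ p q, s ≤ p → p ≤ q → X q - X p ≤ ∫ t in Ioc p q, localSup a δ (X t) t)
    (h2 : ∀ δ, 0 < δ → ∀ p q, s ≤ p → p ≤ q → -(X q - X p) ≤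
      ∫ t in Ioc p q, localSup (fun x t => -a x t) δ (X t) t) :
    FilippovCurve a aL Λ s X := by
  refine ⟨hX, ?_⟩
  have hpos : ∀ n : ℕ, 0 < 1 / ((n : ℝ) + 1) := fun n => by positivity
  have e1 : ∀ᵐ t, ∀ n : ℕ, s < t → deriv X t ≤ localSup a (1 / ((n : ℝ) + 1)) (X t) t := by
    rw [ae_all_iff]
    exact fun n => ae_deriv_le_of_increment_le hX
      (ha.locallyIntegrable_localSup (hpos n) hX.continuous) (h1 _ (hpos n))
  have e2 : ∀ᵐ t, ∀ n : ℕ, s < t →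
      deriv (fun t => -X t) t ≤ localSup (fun x t => -a x t) (1 / ((n : ℝ) + 1)) (X t) t := by
    rw [ae_all_iff]
    exact fun n => ae_deriv_le_of_increment_le (X := fun t => -X t) hX.neg
      (ha.neg.locallyIntegrable_localSup (hpos n) hX.continuous)
      (fun p q hp hq => by
        have := h2 _ (hpos n) p q hp hq
        linarith)
  filter_upwards [e1, e2] with t ht1 ht2 hst
  have k1 := ge_of_tendsto' (ha.tendsto_localSup (X t) t) fun n => ht1 n hst
  have k2 := ge_of_tendsto' (ha.neg.tendsto_localSup (X t) t) fun n => ht2 n hst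
  rw [max_neg_neg, deriv.fun_neg] at k2
  exact ⟨neg_le_neg_iff.1 k2, k1⟩

lemma LipschitzWith.integral_deriv {X : ℝ → ℝ} (hX : LipschitzWith Λ X) (p q : ℝ) :
    ∫ t in p..q, deriv X t = X q - X p :=
  (hX.lipschitzOnWith.absolutelyContinuousOnInterval).integral_deriv_eq_sub

lemma eventually_abs_sub_lt_of_equiLipschitz {ι : Type*} {l : Filter ι} {Xi : ι → ℝ → ℝ} {X : ℝ → ℝ}
    (hXi : ∀ i, LipschitzWith Λ (Xi i)) (hX : LipschitzWith Λ X)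
    (hlim : ∀ t, Tendsto (fun i => Xi i t) l (𝓝 (X t))) (p q : ℝ) {δ : ℝ} (hδ : 0 < δ) :
    ∀ᶠ i in l, ∀ t ∈ Icc p q, |Xi i t - X t| < δ := by
  have he : 0 < δ / (3 * (Λ + 1)) := div_pos hδ (by positivity)
  obtain ⟨T, -, hTf, hT⟩ := (isCompact_Icc (a := p) (b := q)).finite_cover_balls he
  have h1 : ∀ᶠ i in l, ∀ t ∈ T, |Xi i t - X t| < δ / 3 := by
    rw [hTf.eventually_all]
    intro t _
    have := (tendsto_iff_norm_sub_tendsto_zero.1 (hlim t)).eventually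
      (gt_mem_nhds (show 0 < δ / 3 by linarith))
    exact this
  filter_upwards [h1] with i hi t ht
  obtain ⟨r, hr, htr⟩ := mem_iUnion₂.1 (hT ht)
  have hd : |t - r| < δ / (3 * (Λ + 1)) := htr
  have h2 := dist_le_of_lipschitz_comp (hXi i) t r
  have h3 := dist_le_of_lipschitz_comp hX r t
  have h4 := hi r hr
  have h5 : (Λ : ℝ) * |t - r| ≤ δ / 3 := by
    have : (Λ : ℝ) * |t - r| ≤ (Λ + 1) * (δ / (3 * (Λ + 1))) :=
      mul_le_mul (by linarith) hd.le (abs_nonneg _) (by positivity)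
    refine this.trans_eq ?_
    field_simp
  rw [abs_sub_comm r t] at h3
  have h6 : Xi i t - X t = (Xi i t - Xi i r) + (Xi i r - X r) + (X r - X t) := by ring
  rw [h6]
  refine (abs_add_three _ _ _).trans_lt ?_
  linarith

/-- Pointwise limits of approximate Filippov curves are Filippov curves. The speed of the `i`-th
curve is taken from the field along a nearby path `Zi i`. -/
theorem CadlagField.filippovCurve_of_tendsto (ha : CadlagField Λ a aL) {ι : Type*} {l : Filter ι}
    [l.NeBot] {Xi Zi wi : ι → ℝ → ℝ} {X : ℝ → ℝ} {s : ℝ} (hXi : ∀ i, LipschitzWith Λ (Xi i))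
    (hX : LipschitzWith Λ X) (hlim : ∀ t, Tendsto (fun i => Xi i t) l (𝓝 (X t)))
    (hwi : ∀ i, LocallyIntegrable (wi i) volume)
    (hinc : ∀ i p q, s ≤ p → p ≤ q → Xi i q - Xi i p = ∫ t in Ioc p q, wi i t)
    (hmem : ∀ i, ∀ᵐ t, s < t → wi i t ∈ uIcc (aL (Zi i t) t) (a (Zi i t) t))
    (hZ : ∀ δ, 0 < δ → ∀ᶠ i in l, ∀ t, s < t → |Zi i t - Xi i t| < δ) :
    FilippovCurve a aL Λ s X := by
  have hclose : ∀ δ, 0 < δ → ∀ p q, s ≤ p → ∀ᶠ i in l, ∀ t ∈ Ioc p q, |Zi i t - X t| < δ := by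
    intro δ hδ p q hp
    filter_upwards [hZ (δ / 2) (by linarith), eventually_abs_sub_lt_of_equiLipschitz hXi hX hlim p q
      (show 0 < δ / 2 by linarith)] with i h1 h2 t ht
    have h3 := h1 t (hp.trans_lt ht.1)
    have h4 := h2 t ⟨ht.1.le, ht.2⟩
    have := abs_sub_le (Zi i t) (Xi i t) (X t)
    linarith
  have hint : ∀ {g : ℝ → ℝ}, LocallyIntegrable g volume → ∀ p q, IntegrableOn g (Ioc p q) :=
    fun hg p q => (hg.integrableOn_isCompact isCompact_Icc).mono_set Ioc_subset_Icc_self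
  apply ha.filippovCurve_of_increment hX
  · intro δ hδ p q hp hpq
    refine le_of_tendsto ((hlim q).sub (hlim p)) ?_
    filter_upwards [hclose δ hδ p q hp] with i hi
    rw [hinc i p q hp hpq]
    refine setIntegral_mono_on_ae (hint (hwi i) p q)
      (hint (ha.locallyIntegrable_localSup hδ hX.continuous) p q) measurableSet_Ioc ?_
    filter_upwards [hmem i] with t ht htm
    exact (ha.le_localSup_of_mem (hi t htm) (ht (hp.trans_lt htm.1))).1
  · intro δ hδ p q hp hpq
    refine le_of_tendsto ((hlim q).sub (hlim p)).neg ?_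
    filter_upwards [hclose δ hδ p q hp] with i hi
    rw [hinc i p q hp hpq, ← integral_neg]
    refine setIntegral_mono_on_ae (hint (hwi i) p q).neg
      (hint (ha.neg.locallyIntegrable_localSup hδ hX.continuous) p q) measurableSet_Ioc ?_
    filter_upwards [hmem i] with t ht htm
    exact (ha.le_localSup_of_mem (hi t htm) (ht (hp.trans_lt htm.1))).2

/-- The set of Filippov curves is closed under pointwise limits. -/
theorem FilippovCurve.of_tendsto (ha : CadlagField Λ a aL) {ι : Type*} {l : Filter ι}
    [l.NeBot] {Xi : ι → ℝ → ℝ} {X : ℝ → ℝ} {s : ℝ} (hXi : ∀ i, FilippovCurve a aL Λ s (Xi i))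
    (hlim : ∀ t, Tendsto (fun i => Xi i t) l (𝓝 (X t))) : FilippovCurve a aL Λ s X := by
  have hX : LipschitzWith Λ X := LipschitzWith.of_dist_le_mul fun p q =>
    le_of_tendsto' ((hlim p).dist (hlim q)) fun i => (hXi i).lipschitz.dist_le_mul p q
  refine ha.filippovCurve_of_tendsto (Zi := Xi) (wi := fun i => deriv (Xi i))
    (fun i => (hXi i).lipschitz) hX hlim (fun i => locallyIntegrable_deriv (hXi i).lipschitz)
    (fun i p q _ hpq => ?_) (fun i => (hXi i).deriv_mem)
    (fun δ hδ => Eventually.of_forall fun i t _ => by simpa using hδ)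
  rw [← intervalIntegral.integral_of_le hpq, LipschitzWith.integral_deriv (hXi i).lipschitz]

end LocalSup

/-! ### Existence of Filippov curves by the Euler scheme -/

/-- The nodes of the Euler polygon with step size `h` started from `x` at time `s`. -/
noncomputable def eulerNode (a : ℝ → ℝ → ℝ) (s x h : ℝ) : ℕ → ℝ
  | 0 => x
  | k + 1 => eulerNode a s x h k + ∫ t in (s + k * h)..(s + (k + 1) * h), a (eulerNode a s x h k) t

/-- The piecewise constant path through the Euler nodes. -/
noncomputable def eulerPath (a : ℝ → ℝ → ℝ) (s x h t : ℝ) : ℝ := eulerNode a s x h ⌊(t - s) / h⌋₊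

/-- The Lipschitz interpolation of the Euler nodes along the field. -/
noncomputable def eulerCurve (a : ℝ → ℝ → ℝ) (s x h t : ℝ) : ℝ :=
  x + ∫ τ in s..t, a (eulerPath a s x h τ) τ

section Euler

variable {Λ : ℝ≥0} {a aL : ℝ → ℝ → ℝ}

lemma CadlagField.measurable_euler (ha : CadlagField Λ a aL) (s x h : ℝ) :
    Measurable fun τ => a (eulerPath a s x h τ) τ := by
  have h1 : Measurable fun τ : ℝ => ⌊(τ - s) / h⌋₊ :=
    Nat.measurable_floor.comp (by fun_prop)
  have h2 : Measurable (eulerPath a s x h) :=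
    (measurable_from_top (f := eulerNode a s x h)).comp h1
  exact ha.measurable.comp (h2.prodMk measurable_id)

lemma CadlagField.intervalIntegrable_euler (ha : CadlagField Λ a aL) (s x h p q : ℝ) :
    IntervalIntegrable (fun τ => a (eulerPath a s x h τ) τ) volume p q :=
  intervalIntegrable_of_abs_le (ha.measurable_euler s x h) (fun _ => ha.abs_le _ _) p q

lemma CadlagField.eulerCurve_sub (ha : CadlagField Λ a aL) (s x h p q : ℝ) :
    eulerCurve a s x h q - eulerCurve a s x h p = ∫ τ in p..q, a (eulerPath a s x h τ) τ := by
  unfold eulerCurve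
  rw [add_sub_add_left_eq_sub, intervalIntegral.integral_interval_sub_left
    (ha.intervalIntegrable_euler s x h s q) (ha.intervalIntegrable_euler s x h s p)]

lemma CadlagField.lipschitz_eulerCurve (ha : CadlagField Λ a aL) (s x h : ℝ) :
    LipschitzWith Λ (eulerCurve a s x h) :=
  LipschitzWith.of_dist_le_mul fun q p => by
    rw [Real.dist_eq, ha.eulerCurve_sub, Real.dist_eq, ← Real.norm_eq_abs]
    exact intervalIntegral.norm_integral_le_of_norm_le_const fun _ _ => ha.abs_le _ _

lemma eulerPath_eq {s x h t : ℝ} (hh : 0 < h) {k : ℕ}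
    (ht : t ∈ Ico (s + k * h) (s + (k + 1) * h)) : eulerPath a s x h t = eulerNode a s x h k := by
  unfold eulerPath
  congr 1
  have h1 : (k : ℝ) ≤ (t - s) / h := by rw [le_div_iff₀ hh]; linarith [ht.1]
  rw [Nat.floor_eq_iff ((Nat.cast_nonneg k).trans h1)]
  exact ⟨h1, by rw [div_lt_iff₀ hh]; linarith [ht.2]⟩

lemma CadlagField.eulerCurve_node (ha : CadlagField Λ a aL) (s x : ℝ) {h : ℝ} (hh : 0 < h) (k : ℕ) :
    eulerCurve a s x h (s + k * h) = eulerNode a s x h k := by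
  induction k with
  | zero => simp [eulerCurve, eulerNode]
  | succ k ih =>
    have h1 := ha.eulerCurve_sub s x h (s + k * h) (s + (k + 1) * h)
    have hle : s + k * h ≤ s + (k + 1) * h := by linarith
    have h2 : ∫ τ in (s + k * h)..(s + (k + 1) * h), a (eulerPath a s x h τ) τ =
        ∫ τ in (s + k * h)..(s + (k + 1) * h), a (eulerNode a s x h k) τ := by
      apply intervalIntegral.integral_congr_ae
      have hne : ∀ᵐ τ : ℝ, τ ≠ s + (k + 1) * h := by
        rw [ae_iff]; simp
      filter_upwards [hne] with τ hτ hmem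
      rw [uIoc_of_le hle] at hmem
      rw [eulerPath_eq hh ⟨hmem.1.le, lt_of_le_of_ne hmem.2 hτ⟩]
    rw [ih, h2] at h1
    simp only [eulerNode]
    push_cast
    linarith

lemma CadlagField.abs_eulerPath_sub_le (ha : CadlagField Λ a aL) {s x h t : ℝ} (hh : 0 < h)
    (hst : s ≤ t) : |eulerPath a s x h t - eulerCurve a s x h t| ≤ Λ * h := by
  set k := ⌊(t - s) / h⌋₊ with hk
  have hpos : 0 ≤ (t - s) / h := div_nonneg (by linarith) hh.le
  have h1 : (k : ℝ) * h ≤ t - s := (le_div_iff₀ hh).1 (Nat.floor_le hpos)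
  have h2 : t - s < (k + 1) * h := (div_lt_iff₀ hh).1 (Nat.lt_floor_add_one _)
  have h3 : eulerPath a s x h t = eulerCurve a s x h (s + k * h) :=
    (ha.eulerCurve_node s x hh k).symm
  rw [h3]
  refine (dist_le_of_lipschitz_comp (ha.lipschitz_eulerCurve s x h) _ _).trans ?_
  apply mul_le_mul_of_nonneg_left _ Λ.2
  rw [_root_.abs_le]
  constructor <;> linarith

/-- Filippov curves exist from every starting point. -/
theorem CadlagField.exists_filippovCurve (ha : CadlagField Λ a aL) (s x : ℝ) :
    ∃ X, FilippovCurve a aL Λ s X ∧ X s = x := by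
  -- A limit of Euler polygons along a nonprincipal ultrafilter exists pointwise by compactness.
  set E : ℕ → ℝ → ℝ := fun n => eulerCurve a s x (1 / ((n : ℝ) + 1)) with hE
  have hpos : ∀ n : ℕ, 0 < 1 / ((n : ℝ) + 1) := fun n => by positivity
  have hEs : ∀ n, E n s = x := fun n => by simp [hE, eulerCurve]
  have hLip : ∀ n, LipschitzWith Λ (E n) := fun n => ha.lipschitz_eulerCurve _ _ _
  have hex : ∀ t, ∃ y, Tendsto (fun n => E n t) (hyperfilter ℕ) (𝓝 y) := by
    intro t
    have hmem : ∀ n, E n t ∈ Metric.closedBall x (Λ * dist t s) := fun n => by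
      have := (hLip n).dist_le_mul t s
      rwa [hEs] at this
    obtain ⟨y, -, hy⟩ := (isCompact_closedBall x (Λ * dist t s)).ultrafilter_le_nhds
      ((hyperfilter ℕ).map fun n => E n t)
      (by
        rw [Ultrafilter.coe_map, Filter.le_principal_iff, Filter.mem_map]
        exact Filter.univ_mem' hmem)
    exact ⟨y, hy⟩
  choose X hX using hex
  have hXLip : LipschitzWith Λ X := LipschitzWith.of_dist_le_mul fun p q =>
    le_of_tendsto' ((hX p).dist (hX q)) fun i => (hLip i).dist_le_mul p q
  refine ⟨X, ?_, tendsto_nhds_unique (hX s) (by simp only [hEs]; exact tendsto_const_nhds)⟩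
  refine ha.filippovCurve_of_tendsto (l := (hyperfilter ℕ : Filter ℕ))
    (Zi := fun n => eulerPath a s x (1 / ((n : ℝ) + 1)))
    (wi := fun n τ => a (eulerPath a s x (1 / ((n : ℝ) + 1)) τ) τ) hLip hXLip hX
    (fun n => locallyIntegrable_of_abs_le (ha.measurable_euler _ _ _) fun _ => ha.abs_le _ _)
    (fun n p q _ hpq => ?_) (fun n => ae_of_all _ fun t _ => right_mem_uIcc) (fun δ hδ => ?_)
  · rw [ha.eulerCurve_sub, intervalIntegral.integral_of_le hpq]
  · have hlim : Tendsto (fun n : ℕ => (Λ : ℝ) * (1 / ((n : ℝ) + 1))) atTop (𝓝 0) := by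
      simpa using (tendsto_one_div_add_atTop_nhds_zero_nat (𝕜 := ℝ)).const_mul (Λ : ℝ)
    have hev := (hlim.eventually (gt_mem_nhds hδ)).filter_mono
      (Nat.hyperfilter_le_atTop)
    filter_upwards [hev] with n hn t hst
    exact (ha.abs_eulerPath_sub_le (hpos n) hst.le).trans_lt hn

end Euler

/-! ### Essential envelopes and Filippov solutions -/

section Envelopes

variable {Λ : ℝ≥0} {a aL b : ℝ → ℝ → ℝ}

lemma mem_of_ae_restrict_mem {g : ℝ → ℝ} {x δ : ℝ} {F : Filter ℝ} {l : ℝ} {S : Set EReal}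
    (hS : IsClosed S) (hfreq : ∀ {P : ℝ → Prop}, (∀ᵐ z, P z) → ∃ᶠ z in F, P z) (hF : F ≤ 𝓝 x)
    (hδ : 0 < δ) (hl : Tendsto g F (𝓝 l))
    (h : ∀ᵐ z ∂(volume.restrict (Ioo (x - δ) (x + δ))), (g z : EReal) ∈ S) : (l : EReal) ∈ S := by
  rw [ae_restrict_iff' measurableSet_Ioo] at h
  have hl' : Tendsto (fun z => (g z : EReal)) F (𝓝 (l : EReal)) :=
    (continuous_coe_real_ereal.tendsto l).comp hl
  refine hS.mem_of_frequently_of_tendsto ?_ hl'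
  have hnhds : ∀ᶠ z in F, z ∈ Ioo (x - δ) (x + δ) :=
    hF (Ioo_mem_nhds (by linarith) (by linarith))
  exact ((hfreq h).and_eventually hnhds).mono fun z hz => hz.1 hz.2

/-- For a field with one-sided limits, the lower envelope is the smaller one-sided limit. -/
lemma CadlagField.lowerEnvelope_eq (ha : CadlagField Λ a aL) {t : ℝ}
    (hb : (fun x => b x t) =ᵐ[volume] fun x => a x t) (x : ℝ) :
    lowerEnvelope b x t = ((min (aL x t) (a x t) : ℝ) : EReal) := by
  unfold lowerEnvelope
  apply le_antisymm
  · refine iSup₂_le fun δ hδ => ?_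
    have h1 : ∀ᵐ z ∂(volume.restrict (Ioo (x - δ) (x + δ))),
        essInf (fun y => (b y t : EReal)) (volume.restrict (Ioo (x - δ) (x + δ))) ≤
          (a z t : EReal) := by
      filter_upwards [ae_essInf_le (f := fun y => (b y t : EReal))
        (μ := volume.restrict (Ioo (x - δ) (x + δ))), ae_restrict_of_ae hb] with z h1 h2
      have h2 : b z t = a z t := h2
      rwa [h2] at h1
    rcases min_choice (aL x t) (a x t) with h | h <;> rw [h]
    · exact mem_of_ae_restrict_mem (S := Ici _) isClosed_Ici
        (fun hP => frequently_nhdsLT_of_ae hP x) nhdsWithin_le_nhds hδ (ha.tendsto_left x t) h1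
    · exact mem_of_ae_restrict_mem (S := Ici _) isClosed_Ici
        (fun hP => frequently_nhdsGT_of_ae hP x) nhdsWithin_le_nhds hδ (ha.tendsto_right x t) h1
  · refine le_of_forall_lt fun r hr => ?_
    obtain ⟨r', hr1, hr2⟩ := EReal.lt_iff_exists_real_btwn.1 hr
    have hr2 := lt_min_iff.1 (EReal.coe_lt_coe_iff.1 hr2)
    obtain ⟨w, hw, hw'⟩ := mem_nhdsGT_iff_exists_Ioo_subset.1
      ((ha.tendsto_right x t).eventually (lt_mem_nhds hr2.2))
    obtain ⟨v, hv, hv'⟩ := mem_nhdsLT_iff_exists_Ioo_subset.1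
      ((ha.tendsto_left x t).eventually (lt_mem_nhds hr2.1))
    have hw : x < w := hw
    have hv : v < x := hv
    have hm : 0 < min (w - x) (x - v) := lt_min (by linarith) (by linarith)
    refine hr1.trans_le (le_iSup₂_of_le (min (w - x) (x - v)) hm ?_)
    refine le_essInf_of_ae_le _ ?_
    filter_upwards [ae_restrict_of_ae hb, ae_restrict_mem measurableSet_Ioo] with y hy hym
    have hy : b y t = a y t := hy
    rw [hy]
    have h1 := min_le_left (w - x) (x - v)
    have h2 := min_le_right (w - x) (x - v)
    apply EReal.coe_le_coe_iff.2
    rcases lt_trichotomy y x with h | h | h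
    · exact le_of_lt (hv' ⟨by linarith [hym.1], h⟩)
    · rw [h]; exact hr2.2.le
    · exact le_of_lt (hw' ⟨h, by linarith [hym.2]⟩)

/-- For a field with one-sided limits, the upper envelope is the larger one-sided limit. -/
lemma CadlagField.upperEnvelope_eq (ha : CadlagField Λ a aL) {t : ℝ}
    (hb : (fun x => b x t) =ᵐ[volume] fun x => a x t) (x : ℝ) :
    upperEnvelope b x t = ((max (aL x t) (a x t) : ℝ) : EReal) := by
  unfold upperEnvelope
  apply le_antisymm
  · refine le_of_forall_gt fun r hr => ?_
    obtain ⟨r', hr1, hr2⟩ := EReal.lt_iff_exists_real_btwn.1 hr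
    have hr1 := max_lt_iff.1 (EReal.coe_lt_coe_iff.1 hr1)
    obtain ⟨w, hw, hw'⟩ := mem_nhdsGT_iff_exists_Ioo_subset.1
      ((ha.tendsto_right x t).eventually (gt_mem_nhds hr1.2))
    obtain ⟨v, hv, hv'⟩ := mem_nhdsLT_iff_exists_Ioo_subset.1
      ((ha.tendsto_left x t).eventually (gt_mem_nhds hr1.1))
    have hw : x < w := hw
    have hv : v < x := hv
    have hm : 0 < min (w - x) (x - v) := lt_min (by linarith) (by linarith)
    refine (iInf₂_le_of_le (min (w - x) (x - v)) hm ?_).trans_lt hr2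
    refine essSup_le_of_ae_le _ ?_
    filter_upwards [ae_restrict_of_ae hb, ae_restrict_mem measurableSet_Ioo] with y hy hym
    have hy : b y t = a y t := hy
    rw [hy]
    have h1 := min_le_left (w - x) (x - v)
    have h2 := min_le_right (w - x) (x - v)
    apply EReal.coe_le_coe_iff.2
    rcases lt_trichotomy y x with h | h | h
    · exact le_of_lt (hv' ⟨by linarith [hym.1], h⟩)
    · rw [h]; exact hr1.2.le
    · exact le_of_lt (hw' ⟨h, by linarith [hym.2]⟩)
  · refine le_iInf₂ fun δ hδ => ?_
    have h1 : ∀ᵐ z ∂(volume.restrict (Ioo (x - δ) (x + δ))),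
        (a z t : EReal) ≤
          essSup (fun y => (b y t : EReal)) (volume.restrict (Ioo (x - δ) (x + δ))) := by
      filter_upwards [ae_le_essSup (f := fun y => (b y t : EReal))
        (μ := volume.restrict (Ioo (x - δ) (x + δ))), ae_restrict_of_ae hb] with z h1 h2
      have h2 : b z t = a z t := h2
      rwa [h2] at h1
    rcases max_choice (aL x t) (a x t) with h | h <;> rw [h]
    · exact mem_of_ae_restrict_mem (S := Iic _) isClosed_Iic
        (fun hP => frequently_nhdsLT_of_ae hP x) nhdsWithin_le_nhds hδ (ha.tendsto_left x t) h1
    · exact mem_of_ae_restrict_mem (S := Iic _) isClosed_Iic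
        (fun hP => frequently_nhdsGT_of_ae hP x) nhdsWithin_le_nhds hδ (ha.tendsto_right x t) h1

end Envelopes

/-! ### Reformulation of well-posedness -/

section WellPosed

variable {Λ : ℝ≥0} {a aL b : ℝ → ℝ → ℝ}

lemma FilippovCurve.isFilippovSolution (ha : CadlagField Λ a aL) {s : ℝ} (hs : 0 ≤ s)
    (hb : ∀ᵐ t : ℝ, 0 ≤ t → (fun x => b x t) =ᵐ[volume] fun x => a x t) {X : ℝ → ℝ}
    (hX : FilippovCurve a aL Λ s X) : IsFilippovSolution b (X s) s X := by
  refine ⟨rfl, fun T _ => hX.lipschitz.lipschitzOnWith.absolutelyContinuousOnInterval, ?_⟩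
  filter_upwards [hb, hX.deriv_mem, hX.lipschitz.ae_differentiableAt_real] with t h1 h2 h3 hst
  refine ⟨deriv X t, h3.hasDerivAt, ?_⟩
  have hb' := h1 (hs.trans hst.le)
  rw [ha.lowerEnvelope_eq hb', ha.upperEnvelope_eq hb', EReal.coe_le_coe_iff, EReal.coe_le_coe_iff]
  exact h2 hst

lemma IsFilippovSolution.filippovCurve (ha : CadlagField Λ a aL) {s x : ℝ} (hs : 0 ≤ s)
    (hb : ∀ᵐ t : ℝ, 0 ≤ t → (fun x => b x t) =ᵐ[volume] fun x => a x t) {X : ℝ → ℝ}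
    (hX : IsFilippovSolution b x s X) : FilippovCurve a aL Λ s fun t => X (max s t) := by
  obtain ⟨-, hac, hd⟩ := hX
  have hd' : ∀ᵐ t, s < t → deriv X t ∈ uIcc (aL (X t) t) (a (X t) t) := by
    filter_upwards [hb, hd] with t h1 h2 hst
    obtain ⟨w, hw, hl, hu⟩ := h2 hst
    have hb' := h1 (hs.trans hst.le)
    rw [ha.lowerEnvelope_eq hb', EReal.coe_le_coe_iff] at hl
    rw [ha.upperEnvelope_eq hb', EReal.coe_le_coe_iff] at hu
    rw [hw.deriv]
    exact ⟨hl, hu⟩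
  have hbd : ∀ᵐ t, s < t → |deriv X t| ≤ Λ := by
    filter_upwards [hd'] with t ht hst
    have h1 := _root_.abs_le.1 (ha.abs_le (X t) t)
    have h2 := _root_.abs_le.1 (ha.abs_left_le (X t) t)
    have h3 := ht hst
    rw [_root_.abs_le]
    rcases mem_uIcc.1 h3 with h | h
    · exact ⟨h2.1.trans h.1, h.2.trans h1.2⟩
    · exact ⟨h1.1.trans h.1, h.2.trans h2.2⟩
  have hle : ∀ p q, s ≤ p → p ≤ q → |X q - X p| ≤ Λ * (q - p) := by
    intro p q hp hpq
    have hac' : AbsolutelyContinuousOnInterval X p q := (hac q (hp.trans hpq)).mono (by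
      rw [uIcc_of_le hpq, uIcc_of_le (hp.trans hpq)]
      exact Icc_subset_Icc_left hp)
    rw [← hac'.integral_deriv_eq_sub, ← Real.norm_eq_abs]
    refine (intervalIntegral.norm_integral_le_of_norm_le_const_ae (C := Λ) ?_).trans_eq ?_
    · filter_upwards [hbd] with t ht htm
      rw [uIoc_of_le hpq] at htm
      exact ht (hp.trans_lt htm.1)
    · rw [abs_of_nonneg (by linarith)]
  refine ⟨LipschitzWith.of_dist_le_mul fun p q => ?_, ?_⟩
  · rw [Real.dist_eq, Real.dist_eq]
    have key : ∀ p q, p ≤ q → |X (max s p) - X (max s q)| ≤ Λ * |p - q| := by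
      intro p q hpq
      rw [abs_sub_comm, abs_sub_comm p q]
      refine (hle _ _ (le_max_left _ _) (max_le_max_left s hpq)).trans ?_
      apply mul_le_mul_of_nonneg_left _ Λ.2
      have h1 := abs_max_sub_max_le_abs q p s
      rw [max_comm q s, max_comm p s] at h1
      exact (le_abs_self _).trans h1
    rcases le_total p q with h | h
    · exact key p q h
    · rw [abs_sub_comm, abs_sub_comm p q]; exact key q p h
  · filter_upwards [hd'] with t ht hst
    have he : (fun t => X (max s t)) =ᶠ[𝓝 t] X := by
      filter_upwards [lt_mem_nhds hst] with r hr
      rw [max_eq_right hr.le]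
    rw [he.deriv_eq, max_eq_right hst.le]
    exact ht hst

/-- Filippov well-posedness amounts to uniqueness of Filippov curves, since these always exist. -/
theorem CadlagField.filippovWellPosed_iff (ha : CadlagField Λ a aL) {s : ℝ} (hs : 0 ≤ s)
    (hb : ∀ᵐ t : ℝ, 0 ≤ t → (fun x => b x t) =ᵐ[volume] fun x => a x t) (x : ℝ) :
    FilippovWellPosed b x s ↔ ∀ X Y, FilippovCurve a aL Λ s X → FilippovCurve a aL Λ s Y →
      X s = x → Y s = x → ∀ t, s ≤ t → X t = Y t := by
  constructor
  · rintro ⟨-, hu⟩ X Y hX hY rfl hYs t ht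
    have hY' := hY.isFilippovSolution ha hs hb
    rw [hYs] at hY'
    exact hu X Y (hX.isFilippovSolution ha hs hb) hY' t ht
  · intro hu
    constructor
    · obtain ⟨X, hX, rfl⟩ := ha.exists_filippovCurve s x
      exact ⟨X, hX.isFilippovSolution ha hs hb⟩
    · intro X Y hX hY t ht
      have := hu _ _ (hX.filippovCurve ha hs hb) (hY.filippovCurve ha hs hb)
        (by simpa using hX.1) (by simpa using hY.1) t ht
      simpa [max_eq_right ht] using this

end WellPosed

/-! ### Entropy solutions have unique Filippov curves -/

lemma sub_mul_secantSpeed (f : ℝ → ℝ) (v c : ℝ) : (v - c) * secantSpeed f v c = f v - f c := by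
  unfold secantSpeed
  split_ifs with h
  · rw [h]; ring
  · rw [mul_div_cancel₀ _ (sub_ne_zero.2 h)]

lemma secantSpeed_comm (f : ℝ → ℝ) (v c : ℝ) : secantSpeed f v c = secantSpeed f c v := by
  unfold secantSpeed
  by_cases h : v = c
  · simp [h]
  · rw [if_neg h, if_neg (Ne.symm h), ← neg_sub (f c), ← neg_sub c, neg_div_neg_eq]

lemma secantSpeed_self (f : ℝ → ℝ) (c : ℝ) : secantSpeed f c c = deriv f c := by
  simp [secantSpeed]

lemma secantSpeed_eq_dslope (f : ℝ → ℝ) (c : ℝ) : (fun v => secantSpeed f v c) = dslope f c := by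
  funext v
  by_cases h : v = c
  · rw [h, dslope_same, secantSpeed_self]
  · rw [dslope_of_ne _ h, slope_def_field, secantSpeed, if_neg h]

lemma continuous_secantSpeed {f : ℝ → ℝ} (hf : ContDiff ℝ 1 f) (c : ℝ) :
    Continuous fun v => secantSpeed f v c := by
  rw [secantSpeed_eq_dslope, ← continuousOn_univ]
  exact (continuousOn_dslope Filter.univ_mem).2
    ⟨hf.continuous.continuousOn, hf.differentiable (by simp) c⟩

/-- The Kruzkov entropy. -/
def kruzkov (k v : ℝ) : ℝ := |v - k|

/-- The flux of the Kruzkov entropy. -/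
noncomputable def kruzkovFlux (f : ℝ → ℝ) (k v : ℝ) : ℝ := |v - k| * secantSpeed f v k

lemma continuous_kruzkov (k : ℝ) : Continuous (kruzkov k) :=
  (continuous_id.sub continuous_const).abs

lemma continuous_kruzkovFlux {f : ℝ → ℝ} (hf : ContDiff ℝ 1 f) (k : ℝ) :
    Continuous (kruzkovFlux f k) :=
  (continuous_kruzkov k).mul (continuous_secantSpeed hf k)

lemma traceFlux_kruzkov (f : ℝ → ℝ) (k v w : ℝ) :
    traceFlux (kruzkov k) (kruzkovFlux f k) v w = |v - k| * (w - secantSpeed f v k) := by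
  simp only [traceFlux, kruzkov, kruzkovFlux]; ring

lemma CadlagField.exists_velocity {M : ℝ} {U UL : ℝ → ℝ → ℝ} (hU : CadlagField M U UL) {f : ℝ → ℝ}
    (hf : ContDiff ℝ 1 f) (c : ℝ) :
    ∃ Λ : ℝ≥0, CadlagField Λ (velocity f U c) (velocity f UL c) := by
  obtain ⟨C, hC0, hC⟩ := exists_abs_le_of_continuous (continuous_secantSpeed hf c) M
  exact ⟨⟨C, hC0⟩, hU.comp (continuous_secantSpeed hf c) hC⟩

/-- The Kruzkov inequalities: the entropy inequality for all entropies `|v - k|`. -/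
def KruzkovInequalities (f u₀ : ℝ → ℝ) (U : ℝ → ℝ → ℝ) : Prop :=
  ∀ k φ, IsTest φ → (∀ x t, 0 ≤ t → 0 ≤ φ x t) →
    0 ≤ weakForm (kruzkov k) (kruzkovFlux f k) u₀ U φ

section Algebra

/-- If the relative speed changes sign across the curve and the entropy flux does not decrease, then
the entropy flows into the curve from both sides. -/
lemma flux_signs {p p' α α' : ℝ} (hp : 0 ≤ p) (hp' : 0 ≤ p') (hle : p' * α' ≤ p * α)
    (hs : α * α' ≤ 0) : p' * α' ≤ 0 ∧ 0 ≤ p * α := by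
  constructor
  · by_contra! h
    have h1 : 0 < α' := pos_of_mul_pos_right h hp'
    have h2 : 0 < α := pos_of_mul_pos_right (h.trans_le hle) hp
    nlinarith [mul_pos h1 h2]
  · by_contra! h
    have h1 : α < 0 := by
      by_contra! h'
      exact absurd (mul_nonneg hp h') (not_le.2 h)
    have h2 : α' < 0 := by
      by_contra! h'
      exact absurd (hle.trans_lt h) (not_lt.2 (mul_nonneg hp' h'))
    nlinarith [mul_pos_of_neg_of_neg h1 h2]

lemma mul_nonpos_of_mem_uIcc {w x y : ℝ} (h : w ∈ uIcc x y) : (w - y) * (w - x) ≤ 0 := by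
  rcases mem_uIcc.1 h with h | h
  · exact mul_nonpos_of_nonpos_of_nonneg (by linarith) (by linarith)
  · exact mul_nonpos_of_nonneg_of_nonpos (by linarith) (by linarith)

/-- Under the Rankine–Hugoniot condition the fluxes of `|v - k|` on both sides of a jump from `v` to
`c` are opposite, for `k` between `v` and `c`. -/
lemma kruzkov_jump {f : ℝ → ℝ} {v c k w : ℝ} (hRH : v * w - f v = c * w - f c)
    (hk : k ∈ Ioo v c ∨ k ∈ Ioo c v) :
    |v - k| * (w - secantSpeed f v k) = -(|c - k| * (w - secantSpeed f c k)) := by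
  have h1 := sub_mul_secantSpeed f v k
  have h2 := sub_mul_secantSpeed f c k
  rcases hk with hk | hk
  · rw [abs_of_neg (by linarith [hk.1]), abs_of_pos (by linarith [hk.2])]
    linear_combination h1 - h2 - hRH
  · rw [abs_of_pos (by linarith [hk.2]), abs_of_neg (by linarith [hk.1])]
    linear_combination hRH - h1 + h2

end Algebra

section Uniqueness

variable {f u₀ : ℝ → ℝ} {M : ℝ} {U UL : ℝ → ℝ → ℝ} {X Y : ℝ → ℝ} {L Λ : ℝ≥0} {c s : ℝ}

lemma WeakField.ae_kruzkov_le (h : WeakField f u₀ M U UL) (hf : ContDiff ℝ 1 f)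
    (hK : KruzkovInequalities f u₀ U) (hY : LipschitzWith L Y) (k : ℝ) :
    ∀ᵐ t, 0 < t → |UL (Y t) t - k| * (deriv Y t - secantSpeed f (UL (Y t) t) k) ≤
      |U (Y t) t - k| * (deriv Y t - secantSpeed f (U (Y t) t) k) := by
  filter_upwards [ae_traceFlux_left_le_right h.toCadlagField (continuous_kruzkov k)
    (continuous_kruzkovFlux hf k) h.measurable_init h.abs_init_le (hK k) hY] with t ht ht0
  have := ht ht0
  rwa [traceFlux_kruzkov, traceFlux_kruzkov] at this

/-- Along a Filippov curve of an entropy solution, `|u - c|` flows into the curve from both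
sides. -/
lemma FilippovCurve.ae_flux_signs (h : WeakField f u₀ M U UL) (hf : ContDiff ℝ 1 f)
    (hK : KruzkovInequalities f u₀ U) (hs : 0 ≤ s)
    (hY : FilippovCurve (velocity f U c) (velocity f UL c) Λ s Y) :
    ∀ᵐ t, s < t →
      traceFlux (kruzkov c) (kruzkovFlux f c) (UL (Y t) t) (deriv Y t) ≤ 0 ∧
      0 ≤ traceFlux (kruzkov c) (kruzkovFlux f c) (U (Y t) t) (deriv Y t) := by
  filter_upwards [h.ae_kruzkov_le hf hK hY.lipschitz c, hY.deriv_mem] with t h1 h2 hst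
  rw [traceFlux_kruzkov, traceFlux_kruzkov]
  exact flux_signs (abs_nonneg _) (abs_nonneg _) (h1 (hs.trans_lt hst))
    (mul_nonpos_of_mem_uIcc (h2 hst))

lemma le_of_rat_between {g : ℝ → ℝ} {v c w : ℝ} (hg : ContinuousAt g c) (hv : v ≠ c)
    (h : ∀ k : ℚ, ((k : ℝ) ∈ Ioo v c ∨ (k : ℝ) ∈ Ioo c v) → g k ≤ w) : g c ≤ w := by
  rcases lt_or_gt_of_ne hv with hv | hv
  · refine isClosed_Iic.mem_of_frequently_of_tendsto (s := Iic w) (f := g) ?_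
      (hg.tendsto.mono_left (nhdsWithin_le_nhds (s := Iio c)))
    intro hn
    obtain ⟨z, hz, hsub⟩ := mem_nhdsLT_iff_exists_Ioo_subset.1 hn
    obtain ⟨r, hr1, hr2⟩ := exists_rat_btwn (max_lt hv (mem_Iio.1 hz))
    exact hsub ⟨(le_max_right _ _).trans_lt hr1, hr2⟩
      (h r (Or.inl ⟨(le_max_left _ _).trans_lt hr1, hr2⟩))
  · refine isClosed_Iic.mem_of_frequently_of_tendsto (s := Iic w) (f := g) ?_
      (hg.tendsto.mono_left (nhdsWithin_le_nhds (s := Ioi c)))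
    intro hn
    obtain ⟨z, hz, hsub⟩ := mem_nhdsGT_iff_exists_Ioo_subset.1 hn
    obtain ⟨r, hr1, hr2⟩ := exists_rat_btwn (lt_min hv (mem_Ioi.1 hz))
    exact hsub ⟨hr1, hr2.trans_le (min_le_right _ _)⟩
      (h r (Or.inr ⟨hr1, hr2.trans_le (min_le_left _ _)⟩))

/-- A curve with the constant `c` on one side moves no slower (constant on the right), respectively
no faster (constant on the left), than the characteristic speed `f'(c)`. -/
lemma FilippovCurve.ae_speed_of_const (h : WeakField f u₀ M U UL) (hf : ContDiff ℝ 1 f)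
    (hK : KruzkovInequalities f u₀ U) (hs : 0 ≤ s)
    (hY : FilippovCurve (velocity f U c) (velocity f UL c) Λ s Y) :
    ∀ᵐ t, s < t → (U (Y t) t = c → deriv f c ≤ deriv Y t) ∧
      (UL (Y t) t = c → deriv Y t ≤ deriv f c) := by
  have hKr : ∀ᵐ t, ∀ k : ℚ, 0 < t →
      |UL (Y t) t - k| * (deriv Y t - secantSpeed f (UL (Y t) t) k) ≤
      |U (Y t) t - k| * (deriv Y t - secantSpeed f (U (Y t) t) k) := by
    rw [ae_all_iff]
    exact fun k => h.ae_kruzkov_le hf hK hY.lipschitz k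
  filter_upwards [hKr, hY.deriv_mem, h.ae_traceFlux_eq hY.lipschitz] with t hk hm hRH hst
  have ht0 := hs.trans_lt hst
  have hm := hm hst
  have hRH := hRH ht0
  simp only [velocity, traceFlux, id] at hm hRH
  have hne : ∀ k v : ℝ, (k ∈ Ioo v c ∨ k ∈ Ioo c v) → 0 < |c - k| := by
    rintro k v (hk | hk)
    · exact abs_pos.2 (by linarith [hk.2])
    · exact abs_pos.2 (by linarith [hk.1])
  have hcont := (continuous_secantSpeed hf c).continuousAt (x := c)
  constructor
  · intro hU
    rw [hU] at hRH hm
    rw [← secantSpeed_self f c]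
    by_cases hv : UL (Y t) t = c
    · rw [hv, uIcc_self] at hm
      exact (mem_singleton_iff.1 hm).ge
    · refine le_of_rat_between (g := fun v => secantSpeed f v c) hcont hv fun k hkm => ?_
      have h1 := hk k ht0
      rw [hU, kruzkov_jump hRH hkm, secantSpeed_comm f c k] at h1
      have h2 : 0 ≤ |c - k| * (deriv Y t - secantSpeed f k c) := by linarith
      have h3 := nonneg_of_mul_nonneg_right h2 (hne k _ hkm)
      linarith
  · intro hU
    rw [hU] at hRH hm
    rw [← neg_le_neg_iff, ← secantSpeed_self f c]
    by_cases hv : U (Y t) t = c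
    · rw [hv, uIcc_self] at hm
      rw [mem_singleton_iff.1 hm]
    · refine le_of_rat_between (g := fun v => -secantSpeed f v c) hcont.neg hv fun k hkm => ?_
      have h1 := hk k ht0
      rw [hU, kruzkov_jump hRH.symm hkm, secantSpeed_comm f c k] at h1
      have h2 : 0 ≤ |c - k| * (secantSpeed f k c - deriv Y t) := by
        have : |c - k| * (secantSpeed f k c - deriv Y t) =
          -(|c - k| * (deriv Y t - secantSpeed f k c)) := by ring
        linarith
      have h3 := nonneg_of_mul_nonneg_right h2 (hne k _ hkm)
      linarith

/-- The curve `X`, frozen outside the time interval `[p, q]`. -/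
def frozen (p q : ℝ) (X : ℝ → ℝ) (t : ℝ) : ℝ := X (max p (min q t))

lemma lipschitzWith_frozen (hX : LipschitzWith L X) (p q : ℝ) : LipschitzWith L (frozen p q X) := by
  have := hX.comp ((LipschitzWith.id.const_min q).const_max p)
  rwa [mul_one] at this

lemma frozen_eq {p q t : ℝ} (ht : t ∈ Icc p q) : frozen p q X t = X t := by
  unfold frozen
  rw [min_eq_right ht.2, max_eq_right ht.1]

lemma deriv_frozen {p q t : ℝ} (ht : t ∈ Ioo p q) : deriv (frozen p q X) t = deriv X t := by
  apply Filter.EventuallyEq.deriv_eq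
  filter_upwards [Ioo_mem_nhds ht.1 ht.2] with r hr
  exact frozen_eq (Ioo_subset_Icc_self hr)

lemma exists_gap (hX : Continuous X) (hY : Continuous Y) {p q : ℝ} (hpq : p ≤ q)
    (hXY : ∀ t ∈ Icc p q, X t < Y t) : ∃ d, 0 < d ∧ ∀ t, frozen p q X t + d ≤ frozen p q Y t := by
  obtain ⟨z, hz, hmin⟩ := (isCompact_Icc (a := p) (b := q)).exists_isMinOn (nonempty_Icc.2 hpq)
    (hY.sub hX).continuousOn
  refine ⟨Y z - X z, sub_pos.2 (hXY z hz), fun t => ?_⟩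
  have : max p (min q t) ∈ Icc p q := ⟨le_max_left _ _, max_le hpq (min_le_left _ _)⟩
  have h2 := hmin this
  simp only [mem_ofPred_eq, Pi.sub_apply] at h2
  unfold frozen
  linarith

/-- The mass of `|u - c|` between two Filippov curves does not increase. -/
lemma FilippovCurve.ae_mass_le (h : WeakField f u₀ M U UL) (hf : ContDiff ℝ 1 f)
    (hK : KruzkovInequalities f u₀ U) (hs : 0 ≤ s)
    (hX : FilippovCurve (velocity f U c) (velocity f UL c) Λ s X)
    (hY : FilippovCurve (velocity f U c) (velocity f UL c) Λ s Y) {C : ℝ}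
    (hC : ∀ v, |v| ≤ M → |kruzkov c v| ≤ C) {p q : ℝ} (hsp : s < p) (hpq : p ≤ q)
    (hXY : ∀ t ∈ Icc p q, X t < Y t) :
    ∀ᵐ t, t ∈ Ioo p q → ∫ x in Ioc (X t) (Y t), kruzkov c (U x t) ≤ C * (Y p - X p) := by
  -- Freezing the curves outside `[p, q]` separates them uniformly, so that traces can be taken from
  -- inside the strip.
  obtain ⟨d, hd, hgap⟩ := exists_gap hX.lipschitz.continuous hY.lipschitz.continuous hpq hXY
  have hX' := lipschitzWith_frozen hX.lipschitz p q
  have hY' := lipschitzWith_frozen hY.lipschitz p q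
  have hU := h.toCadlagField
  have hq := continuous_kruzkovFlux hf c
  have w := weakLE_strip_inner hU (continuous_kruzkov c) hq h.measurable_init h.abs_init_le (hK c)
    hX' hY' hd hgap
  obtain ⟨S, hS, -, hS2⟩ := w.ae_le
    (hU.locallyIntegrable_mass (continuous_kruzkov c) hX'.continuous hY'.continuous
      fun t => by linarith [hgap t])
    ((hU.locallyIntegrable_flux_left (continuous_kruzkov c) hq hY').sub
      (hU.locallyIntegrable_flux (continuous_kruzkov c) hq hX'))
  filter_upwards [hS] with t ht htm
  have hp0 : 0 < p := hs.trans_lt hsp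
  have hfreq : ∃ᶠ r in 𝓝[>] p, (∫ x in Ioc (X t) (Y t), kruzkov c (U x t)) ≤ C * (Y r - X r) := by
    have hev : ∀ᶠ r in 𝓝[>] p, r ∈ Ioo p t := Ioo_mem_nhdsGT htm.1
    refine ((frequently_nhdsGT_of_ae hS p).and_eventually hev).mono ?_
    rintro r ⟨hr, hrm⟩
    have hrm' : r ∈ Icc p q := ⟨hrm.1.le, (hrm.2.trans htm.2).le⟩
    have h1 := hS2 r hr t ht (hp0.trans hrm.1) hrm.2
    simp only [frozen_eq hrm', frozen_eq (Ioo_subset_Icc_self htm)] at h1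
    have h2 : ∫ τ in Ioc r t, (traceFlux (kruzkov c) (kruzkovFlux f c) (UL (frozen p q Y τ) τ)
        (deriv (frozen p q Y) τ) - traceFlux (kruzkov c) (kruzkovFlux f c) (U (frozen p q X τ) τ)
        (deriv (frozen p q X) τ)) ≤ 0 := by
      apply setIntegral_nonpos_ae measurableSet_Ioc
      filter_upwards [hX.ae_flux_signs h hf hK hs, hY.ae_flux_signs h hf hK hs] with τ k1 k2 hτ
      have hτm : τ ∈ Ioo p q := ⟨hrm.1.trans hτ.1, hτ.2.trans_lt htm.2⟩
      have k1 := (k1 (hsp.trans hτm.1)).2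
      have k2 := (k2 (hsp.trans hτm.1)).1
      rw [deriv_frozen hτm, deriv_frozen hτm, frozen_eq (Ioo_subset_Icc_self hτm),
        frozen_eq (Ioo_subset_Icc_self hτm)]
      linarith
    have h3 := (le_abs_self _).trans (hU.abs_mass_le hC (hXY r hrm').le (t := r))
    linarith
  have hlim : Tendsto (fun r => C * (Y r - X r)) (𝓝[>] p) (𝓝 (C * (Y p - X p))) :=
    ((continuous_const.mul (hY.lipschitz.continuous.sub hX.lipschitz.continuous)).tendsto p).mono_left
      nhdsWithin_le_nhds
  exact isClosed_Ici.mem_of_frequently_of_tendsto (s := Ici _) hfreq hlim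

lemma exists_last_meeting (hX : Continuous X) (hY : Continuous Y) (hXs : X s = Y s) {r : ℝ}
    (hsr : s ≤ r) (hr : X r < Y r) :
    ∃ p, s ≤ p ∧ p < r ∧ X p = Y p ∧ ∀ t ∈ Ioc p r, X t < Y t := by
  have hcl : IsCompact (Icc s r ∩ {t | X t = Y t}) :=
    isCompact_Icc.inter_right (isClosed_eq hX hY)
  obtain ⟨p, ⟨hp, hpe⟩, hmax⟩ := hcl.exists_isGreatest ⟨s, ⟨le_rfl, hsr⟩, hXs⟩
  have hpe : X p = Y p := hpe
  have hpr : p < r := lt_of_le_of_ne hp.2 (fun h => hr.ne (h ▸ hpe))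
  refine ⟨p, hp.1, hpr, hpe, fun t ht => ?_⟩
  by_contra! hle
  obtain ⟨z, hz, hz0⟩ := intermediate_value_Icc ht.2 (hY.sub hX).continuousOn
    (show (0 : ℝ) ∈ Icc _ _ from ⟨sub_nonpos.2 hle, (sub_pos.2 hr).le⟩)
  have : z ≤ p := hmax ⟨⟨hp.1.trans (ht.1.le.trans hz.1), hz.2⟩, (sub_eq_zero.1 hz0).symm⟩
  linarith [hz.1, ht.1]

/-- Filippov curves of an entropy solution cannot separate: from the last meeting time on, the right
one moves no faster than the left one. -/
lemma FilippovCurve.eq_of_kruzkov_aux (h : WeakField f u₀ M U UL) (hf : ContDiff ℝ 1 f)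
    (hK : KruzkovInequalities f u₀ U) (hs : 0 ≤ s)
    (hX : FilippovCurve (velocity f U c) (velocity f UL c) Λ s X)
    (hY : FilippovCurve (velocity f U c) (velocity f UL c) Λ s Y) (hXY : X s = Y s) {r : ℝ}
    (hsr : s ≤ r) : Y r ≤ X r := by
  by_contra! hr
  have hXc := hX.lipschitz.continuous
  have hYc := hY.lipschitz.continuous
  obtain ⟨p, hsp, hpr, hpe, hlt⟩ := exists_last_meeting hXc hYc hXY hsr hr
  have hU := h.toCadlagField
  obtain ⟨C, hC0, hC⟩ := exists_abs_le_of_continuous (continuous_kruzkov c) M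
  -- There is no mass of `|u - c|` between the curves.
  have hmass : ∀ᵐ t, t ∈ Ioo p r → ∫ x in Ioc (X t) (Y t), kruzkov c (U x t) ≤ 0 := by
    have hall : ∀ᵐ t, ∀ n : ℕ, p + 1 / ((n : ℝ) + 1) ≤ r → t ∈ Ioo (p + 1 / ((n : ℝ) + 1)) r →
        ∫ x in Ioc (X t) (Y t), kruzkov c (U x t) ≤
          C * (Y (p + 1 / ((n : ℝ) + 1)) - X (p + 1 / ((n : ℝ) + 1))) := by
      rw [ae_all_iff]
      intro n
      have hn : 0 < 1 / ((n : ℝ) + 1) := by positivity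
      by_cases hle : p + 1 / ((n : ℝ) + 1) ≤ r
      · filter_upwards [hX.ae_mass_le h hf hK hs hY hC (p := p + 1 / ((n : ℝ) + 1)) (by linarith) hle
          (fun t ht => hlt t ⟨by linarith [ht.1], ht.2⟩)] with t ht _ htm using ht htm
      · exact ae_of_all _ fun t h' => absurd h' hle
    filter_upwards [hall] with t ht htm
    have h0 := tendsto_one_div_add_atTop_nhds_zero_nat (𝕜 := ℝ)
    have hc : Tendsto (fun n : ℕ => C * (Y (p + 1 / ((n : ℝ) + 1)) - X (p + 1 / ((n : ℝ) + 1))))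
        atTop (𝓝 (C * (Y (p + 0) - X (p + 0)))) := by
      have hcont : Continuous fun z => C * (Y (p + z) - X (p + z)) := by fun_prop
      exact (hcont.tendsto 0).comp h0
    rw [add_zero, hpe, sub_self, mul_zero] at hc
    refine ge_of_tendsto hc ?_
    filter_upwards [h0.eventually (gt_mem_nhds (sub_pos.2 htm.1))] with n hn
    exact ht n (by linarith [htm.2]) ⟨by linarith, htm.2⟩
  -- Hence the solution is equal to `c` there, and the curves approach each other.
  have hder : ∀ᵐ t, t ∈ Ioo p r → deriv Y t ≤ deriv X t := by
    filter_upwards [hmass, hX.ae_speed_of_const h hf hK hs, hY.ae_speed_of_const h hf hK hs]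
      with t hm hsX hsY htm
    have hst : s < t := hsp.trans_lt htm.1
    have hXYt := hlt t ⟨htm.1, htm.2.le⟩
    have hz : ∫ x in Ioc (X t) (Y t), kruzkov c (U x t) = 0 :=
      le_antisymm (hm htm) (setIntegral_nonneg measurableSet_Ioc fun x _ => abs_nonneg _)
    have hnn : 0 ≤ᵐ[volume.restrict (Ioc (X t) (Y t))] fun x => kruzkov c (U x t) :=
      ae_of_all _ fun x => abs_nonneg _
    rw [setIntegral_eq_zero_iff_of_nonneg_ae hnn
      (hU.integrableOn_comp (continuous_kruzkov c) t _ _)] at hz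
    have hz : ∀ᵐ x, x ∈ Ioc (X t) (Y t) → U x t = c := by
      rw [← ae_restrict_iff' measurableSet_Ioc]
      filter_upwards [hz] with x hx
      exact sub_eq_zero.1 (abs_eq_zero.1 hx)
    have e1 : U (X t) t = c := by
      have hev : ∀ᶠ x in 𝓝[>] (X t), x ∈ Ioc (X t) (Y t) := Ioc_mem_nhdsGT hXYt
      exact isClosed_singleton.mem_of_frequently_of_tendsto (s := {c})
        (((frequently_nhdsGT_of_ae hz _).and_eventually hev).mono fun x hx => hx.1 hx.2)
        (hU.tendsto_right (X t) t)
    have e2 : UL (Y t) t = c := by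
      have hev : ∀ᶠ x in 𝓝[<] (Y t), x ∈ Ioc (X t) (Y t) := by
        filter_upwards [Ioo_mem_nhdsLT hXYt] with x hx using Ioo_subset_Ioc_self hx
      exact isClosed_singleton.mem_of_frequently_of_tendsto (s := {c})
        (((frequently_nhdsLT_of_ae hz _).and_eventually hev).mono fun x hx => hx.1 hx.2)
        (hU.tendsto_left (Y t) t)
    exact ((hsY hst).2 e2).trans ((hsX hst).1 e1)
  have h1 := LipschitzWith.integral_deriv hX.lipschitz p r
  have h2 := LipschitzWith.integral_deriv hY.lipschitz p r
  have h3 : ∫ t in p..r, deriv Y t ≤ ∫ t in p..r, deriv X t := by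
    rw [intervalIntegral.integral_of_le hpr.le, intervalIntegral.integral_of_le hpr.le,
      integral_Ioc_eq_integral_Ioo, integral_Ioc_eq_integral_Ioo]
    refine setIntegral_mono_on_ae ?_ ?_ measurableSet_Ioo hder
    · exact ((locallyIntegrable_deriv hY.lipschitz).integrableOn_isCompact isCompact_Icc).mono_set
        Ioo_subset_Icc_self
    · exact ((locallyIntegrable_deriv hX.lipschitz).integrableOn_isCompact isCompact_Icc).mono_set
        Ioo_subset_Icc_self
  linarith

/-- Filippov curves of an entropy solution are determined by their starting point. -/
theorem FilippovCurve.eq_of_kruzkov (h : WeakField f u₀ M U UL) (hf : ContDiff ℝ 1 f)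
    (hK : KruzkovInequalities f u₀ U) (hs : 0 ≤ s)
    (hX : FilippovCurve (velocity f U c) (velocity f UL c) Λ s X)
    (hY : FilippovCurve (velocity f U c) (velocity f UL c) Λ s Y) (hXY : X s = Y s) {r : ℝ}
    (hsr : s ≤ r) : X r = Y r :=
  le_antisymm (hY.eq_of_kruzkov_aux h hf hK hs hX hXY.symm hsr)
    (hX.eq_of_kruzkov_aux h hf hK hs hY hXY hsr)

end Uniqueness

/-! ### The flow of Filippov curves -/

section Flow

variable {Λ : ℝ≥0} {a aL : ℝ → ℝ → ℝ} {X Y : ℝ → ℝ} {s : ℝ}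

/-- Uniqueness: Filippov curves starting at nonnegative times are determined by their starting
point. -/
def UniqueCurves (a aL : ℝ → ℝ → ℝ) (Λ : ℝ≥0) : Prop :=
  ∀ s X Y, 0 ≤ s → FilippovCurve a aL Λ s X → FilippovCurve a aL Λ s Y → X s = Y s →
    ∀ t, s ≤ t → X t = Y t

lemma FilippovCurve.restart (hX : FilippovCurve a aL Λ s X) {p : ℝ} (hsp : s ≤ p) :
    FilippovCurve a aL Λ p X :=
  ⟨hX.lipschitz, hX.deriv_mem.mono fun _ h hp => h (hsp.trans_lt hp)⟩

/-- Filippov curves do not cross. -/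
lemma UniqueCurves.mono (hu : UniqueCurves a aL Λ) (hs : 0 ≤ s) (hX : FilippovCurve a aL Λ s X)
    (hY : FilippovCurve a aL Λ s Y) (hXY : X s ≤ Y s) {t : ℝ} (hst : s ≤ t) : X t ≤ Y t := by
  by_contra! hlt
  obtain ⟨p, hp, hp0⟩ := intermediate_value_Icc' hst
    (hY.lipschitz.continuous.sub hX.lipschitz.continuous).continuousOn
    (show (0 : ℝ) ∈ Icc _ _ from ⟨sub_nonpos.2 hlt.le, sub_nonneg.2 hXY⟩)
  have := hu p X Y (hs.trans hp.1) (hX.restart hp.1) (hY.restart hp.1) (sub_eq_zero.1 hp0).symm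
    t hp.2
  exact hlt.ne' this

lemma UniqueCurves.lt_of_lt (hu : UniqueCurves a aL Λ) (hs : 0 ≤ s) (hX : FilippovCurve a aL Λ s X)
    (hY : FilippovCurve a aL Λ s Y) {t : ℝ} (hXY : X t < Y t) {p : ℝ} (hsp : s ≤ p)
    (hpt : p ≤ t) : X p < Y p := by
  by_contra! hle
  exact absurd (hu.mono (hs.trans hsp) (hY.restart hsp) (hX.restart hsp) hle hpt) (not_le.2 hXY)

/-- A Filippov curve from the point `y` at time `s`, constant before time `s`. -/
noncomputable def filippovFlow (ha : CadlagField Λ a aL) (s y t : ℝ) : ℝ :=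
  (ha.exists_filippovCurve s y).choose (max s t)

lemma filippovFlow_of_le (ha : CadlagField Λ a aL) {t : ℝ} (h : t ≤ s) (y : ℝ) :
    filippovFlow ha s y t = y := by
  rw [filippovFlow, max_eq_left h]
  exact (ha.exists_filippovCurve s y).choose_spec.2

lemma filippovCurve_filippovFlow (ha : CadlagField Λ a aL) (s y : ℝ) :
    FilippovCurve a aL Λ s (filippovFlow ha s y) := by
  have h := (ha.exists_filippovCurve s y).choose_spec.1
  constructor
  · have := h.lipschitz.comp (LipschitzWith.id.const_max s)
    rwa [mul_one] at this
  · filter_upwards [h.deriv_mem] with t ht hst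
    have e : filippovFlow ha s y =ᶠ[𝓝 t] (ha.exists_filippovCurve s y).choose := by
      filter_upwards [Ioi_mem_nhds hst] with r hr
      rw [filippovFlow, max_eq_right (mem_Ioi.1 hr).le]
    rw [e.deriv_eq, e.eq_of_nhds]
    exact ht hst

lemma abs_filippovFlow_sub_le (ha : CadlagField Λ a aL) {t : ℝ} (hst : s ≤ t) (y : ℝ) :
    |filippovFlow ha s y t - y| ≤ Λ * (t - s) := by
  have := dist_le_of_lipschitz_comp (filippovCurve_filippovFlow ha s y).lipschitz t s
  rwa [filippovFlow_of_le ha le_rfl, abs_of_nonneg (sub_nonneg.2 hst)] at this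

lemma UniqueCurves.monotone_flow (hu : UniqueCurves a aL Λ) (ha : CadlagField Λ a aL) (hs : 0 ≤ s)
    {t : ℝ} (hst : s ≤ t) : Monotone fun y => filippovFlow ha s y t := fun y z hyz =>
  hu.mono hs (filippovCurve_filippovFlow ha s y) (filippovCurve_filippovFlow ha s z)
    (by rwa [filippovFlow_of_le ha le_rfl, filippovFlow_of_le ha le_rfl]) hst

/-- Continuous dependence on the starting point, by compactness and uniqueness. -/
lemma UniqueCurves.continuous_flow (hu : UniqueCurves a aL Λ) (ha : CadlagField Λ a aL)
    (hs : 0 ≤ s) (t : ℝ) : Continuous fun y => filippovFlow ha s y t := by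
  rw [continuous_iff_continuousAt]
  intro y
  unfold ContinuousAt
  rw [tendsto_iff_ultrafilter]
  intro 𝒰 h𝒰
  have hbd : ∀ τ, ∃ z, Tendsto (fun y => filippovFlow ha s y τ) 𝒰 (𝓝 z) := by
    intro τ
    have hmem : ∀ᶠ y' in (𝒰 : Filter ℝ),
        filippovFlow ha s y' τ ∈ Metric.closedBall y (1 + Λ * |τ - s|) := by
      filter_upwards [h𝒰 (Metric.ball_mem_nhds y one_pos)] with y' hy'
      have h1 := dist_le_of_lipschitz_comp (filippovCurve_filippovFlow ha s y').lipschitz τ s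
      rw [filippovFlow_of_le ha le_rfl] at h1
      rw [Metric.mem_closedBall]
      refine (dist_triangle _ y' _).trans ?_
      rw [Real.dist_eq]
      have := Metric.mem_ball.1 hy'
      linarith
    obtain ⟨z, -, hz⟩ := (isCompact_closedBall y (1 + Λ * |τ - s|)).ultrafilter_le_nhds
      (𝒰.map fun y => filippovFlow ha s y τ) (le_principal_iff.2 hmem)
    exact ⟨z, hz⟩
  choose Z hZ using hbd
  have hZc : FilippovCurve a aL Λ s Z :=
    FilippovCurve.of_tendsto ha (fun y => filippovCurve_filippovFlow ha s y) hZ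
  have hZ0 : ∀ τ ≤ s, Z τ = y := by
    intro τ hτ
    refine tendsto_nhds_unique (hZ τ) ?_
    simp only [filippovFlow_of_le ha hτ]
    exact h𝒰
  have : Z t = filippovFlow ha s y t := by
    rcases le_total t s with h | h
    · rw [hZ0 t h, filippovFlow_of_le ha h]
    · exact hu s _ _ hs hZc (filippovCurve_filippovFlow ha s y)
        (by rw [hZ0 s le_rfl, filippovFlow_of_le ha le_rfl]) t h
  change Tendsto _ _ (𝓝 (filippovFlow ha s y t))
  rw [← this]
  exact hZ t

/-- Among the points transported to `(-∞, z]` by the flow there is a largest one, and it is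
transported to `z`. -/
lemma UniqueCurves.exists_origin (hu : UniqueCurves a aL Λ) (ha : CadlagField Λ a aL) (hs : 0 ≤ s)
    {t : ℝ} (hst : s ≤ t) (z : ℝ) :
    ∃ β, filippovFlow ha s β t = z ∧ ∀ y, filippovFlow ha s y t ≤ z ↔ y ≤ β := by
  have hc := hu.continuous_flow ha hs t
  have hb := fun y => _root_.abs_le.1 (abs_filippovFlow_sub_le ha hst y)
  have hcl : IsClosed {y | filippovFlow ha s y t ≤ z} := isClosed_le hc continuous_const
  have hne : (z - Λ * (t - s)) ∈ {y | filippovFlow ha s y t ≤ z} := by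
    have := (hb (z - Λ * (t - s))).2
    rw [mem_ofPred_eq]; linarith
  have hbdd : BddAbove {y | filippovFlow ha s y t ≤ z} := by
    refine ⟨z + Λ * (t - s), fun y hy => ?_⟩
    have := (hb y).1
    rw [mem_ofPred_eq] at hy; linarith
  obtain ⟨β, hβ⟩ : ∃ β, IsGreatest {y | filippovFlow ha s y t ≤ z} β :=
    ⟨_, hcl.csSup_mem ⟨_, hne⟩ hbdd, fun y hy => le_csSup hbdd hy⟩
  have hmem : filippovFlow ha s β t ≤ z := hβ.1
  refine ⟨β, le_antisymm hmem ?_, fun y => ⟨fun h => hβ.2 h, fun h =>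
    (hu.monotone_flow ha hs hst h).trans hmem⟩⟩
  by_contra! hlt
  obtain ⟨y, hy1, hy2⟩ := ((hc.continuousAt.eventually_lt continuousAt_const hlt).filter_mono
    (nhdsWithin_le_nhds (s := Ioi β))).and self_mem_nhdsWithin |>.exists
  exact absurd (hβ.2 (show filippovFlow ha s y t ≤ z from hy1.le)) (not_le.2 hy2)

lemma CadlagField.tendsto_left_nhdsGT (ha : CadlagField Λ a aL) (x t : ℝ) :
    Tendsto (fun y => aL y t) (𝓝[>] x) (𝓝 (a x t)) := by
  rw [(closed_nhds_basis (a x t)).tendsto_right_iff]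
  rintro S ⟨hS, hcl⟩
  obtain ⟨w, hw, hsub⟩ := mem_nhdsGT_iff_exists_Ioo_subset.1 (ha.tendsto_right x t hS)
  filter_upwards [Ioo_mem_nhdsGT (mem_Ioi.1 hw)] with y hy
  refine hcl.mem_of_tendsto (ha.tendsto_left y t) ?_
  filter_upwards [Ioo_mem_nhdsLT hy.1] with z hz
  exact hsub ⟨hz.1, hz.2.trans hy.2⟩

/-- A Filippov curve approached by Filippov curves from the right moves with the speed prescribed by
the right limits of the field. -/
lemma FilippovCurve.ae_deriv_eq_of_tendsto (ha : CadlagField Λ a aL) (hY : FilippovCurve a aL Λ s Y)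
    {Z : ℕ → ℝ → ℝ} (hZ : ∀ n, FilippovCurve a aL Λ s (Z n)) {t : ℝ}
    (hlt : ∀ n, ∀ τ ∈ Icc s t, Y τ < Z n τ) (hlim : ∀ τ, Tendsto (fun n => Z n τ) atTop (𝓝 (Y τ))) :
    ∀ᵐ τ, τ ∈ Ioo s t → deriv Y τ = a (Y τ) τ := by
  have hYm : Measurable fun τ => a (Y τ) τ :=
    ha.measurable.comp (hY.lipschitz.continuous.measurable.prodMk measurable_id)
  have hder : ∀ᵐ τ, τ ∈ Icc s t → s < τ →
      Tendsto (fun n => deriv (Z n) τ) atTop (𝓝 (a (Y τ) τ)) := by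
    have hall : ∀ᵐ τ, ∀ n, s < τ → deriv (Z n) τ ∈ uIcc (aL (Z n τ) τ) (a (Z n τ) τ) := by
      rw [ae_all_iff]
      exact fun n => (hZ n).deriv_mem
    filter_upwards [hall] with τ hτ hm hs
    have hright : Tendsto (fun n => Z n τ) atTop (𝓝[>] (Y τ)) :=
      tendsto_nhdsWithin_iff.2 ⟨hlim τ, Eventually.of_forall fun n => hlt n τ hm⟩
    have h1 := (ha.tendsto_right (Y τ) τ).comp hright
    have h2 := (ha.tendsto_left_nhdsGT (Y τ) τ).comp hright
    have hmin := h2.min h1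
    have hmax := h2.max h1
    rw [min_self] at hmin
    rw [max_self] at hmax
    exact tendsto_of_tendsto_of_tendsto_of_le_of_le hmin hmax (fun n => (hτ n hs).1)
      (fun n => (hτ n hs).2)
  have hinc : ∀ p q, s ≤ p → p ≤ q → q ≤ t → Y q - Y p = ∫ τ in Ioc p q, a (Y τ) τ := by
    intro p q hp hpq hq
    refine tendsto_nhds_unique ((hlim q).sub (hlim p)) ?_
    have e : ∀ n, Z n q - Z n p = ∫ τ in Ioc p q, deriv (Z n) τ := fun n => by
      rw [← intervalIntegral.integral_of_le hpq, LipschitzWith.integral_deriv (hZ n).lipschitz]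
    simp only [e]
    refine tendsto_integral_of_dominated_convergence (fun _ => (Λ : ℝ))
      (fun n => (measurable_deriv _).aestronglyMeasurable) (integrable_const _)
      (fun n => ae_of_all _ fun τ => abs_deriv_le_of_lipschitzWith (hZ n).lipschitz τ) ?_
    rw [ae_restrict_iff' measurableSet_Ioc]
    filter_upwards [hder] with τ hτ hm
    exact hτ ⟨hp.trans hm.1.le, hm.2.trans hq⟩ (hp.trans_lt hm.1)
  filter_upwards [hY.lipschitz.ae_differentiableAt_real,
    ae_tendsto_average_right (locallyIntegrable_of_abs_le hYm fun τ => ha.abs_le _ _)] with τ hd hav hm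
  have h1 : Tendsto (slope Y τ) (𝓝[>] τ) (𝓝 (deriv Y τ)) :=
    ((hasDerivAt_iff_tendsto_slope.1 hd.hasDerivAt).mono_left
    (nhdsWithin_mono τ (fun q (hq : τ < q) => hq.ne')))
  refine tendsto_nhds_unique_of_eventuallyEq h1 hav ?_
  filter_upwards [Ioo_mem_nhdsGT hm.2] with q hq
  rw [slope_def_field, div_eq_inv_mul, hinc τ q hm.1.le hq.1.le hq.2.le]

/-- The last curve arriving at a given point moves with the speed prescribed by the right limits. -/
lemma UniqueCurves.ae_deriv_flow (hu : UniqueCurves a aL Λ) (ha : CadlagField Λ a aL) (hs : 0 ≤ s)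
    {t z β : ℝ} (hβ : ∀ y, filippovFlow ha s y t ≤ z ↔ y ≤ β) :
    ∀ᵐ τ, τ ∈ Ioo s t → deriv (filippovFlow ha s β) τ = a (filippovFlow ha s β τ) τ := by
  have hpos : ∀ n : ℕ, 0 < 1 / ((n : ℝ) + 1) := fun n => by positivity
  refine (filippovCurve_filippovFlow ha s β).ae_deriv_eq_of_tendsto ha
    (Z := fun n => filippovFlow ha s (β + 1 / ((n : ℝ) + 1)))
    (fun n => filippovCurve_filippovFlow ha s _) (fun n τ hτ => ?_) fun τ => ?_
  · refine hu.lt_of_lt hs (filippovCurve_filippovFlow ha s _) (filippovCurve_filippovFlow ha s _)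
      (t := t) ?_ hτ.1 hτ.2
    refine ((hβ β).2 le_rfl).trans_lt (lt_of_not_ge fun h => ?_)
    linarith [(hβ _).1 h, hpos n]
  · have h0 := (tendsto_one_div_add_atTop_nhds_zero_nat (𝕜 := ℝ)).const_add β
    rw [add_zero] at h0
    exact ((hu.continuous_flow ha hs τ).tendsto β).comp h0

end Flow

section Transport

variable {f u₀ : ℝ → ℝ} {M : ℝ} {U UL : ℝ → ℝ → ℝ} {Λ : ℝ≥0} {c s t : ℝ}

lemma traceFlux_secantSpeed (f : ℝ → ℝ) (v c : ℝ) :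
    traceFlux id f v (secantSpeed f v c) = c * secantSpeed f v c - f c := by
  have := sub_mul_secantSpeed f v c
  simp only [traceFlux, id]
  linarith

/-- The relative mass `∫ (u - c)` is transported by the flow of the field `a_c`. -/
theorem WeakField.potential_flow (h : WeakField f u₀ M U UL)
    (ha : CadlagField Λ (velocity f U c) (velocity f UL c))
    (hu : UniqueCurves (velocity f U c) (velocity f UL c) Λ) (hs : 0 ≤ s) (hst : s ≤ t)
    {z₁ z₂ β₁ β₂ : ℝ} (hz : z₁ ≤ z₂) (h₁ : filippovFlow ha s β₁ t = z₁)
    (h₁' : ∀ y, filippovFlow ha s y t ≤ z₁ ↔ y ≤ β₁) (h₂ : filippovFlow ha s β₂ t = z₂)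
    (h₂' : ∀ y, filippovFlow ha s y t ≤ z₂ ↔ y ≤ β₂) :
    potential f u₀ U z₂ t - potential f u₀ U z₁ t - c * (z₂ - z₁) =
      potential f u₀ U β₂ s - potential f u₀ U β₁ s - c * (β₂ - β₁) := by
  have hβ : β₁ ≤ β₂ := (h₂' _).1 (h₁.le.trans hz)
  -- The curves are frozen outside `[s, t]` so that the balances up to the times `s` and `t` can be
  -- subtracted.
  have hL₁ := lipschitzWith_frozen (filippovCurve_filippovFlow ha s β₁).lipschitz s t
  have hL₂ := lipschitzWith_frozen (filippovCurve_filippovFlow ha s β₂).lipschitz s t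
  set X := filippovFlow ha s β₁ with hX
  set Y := filippovFlow ha s β₂ with hY
  have hXs : X s = β₁ := filippovFlow_of_le ha le_rfl _
  have hYs : Y s = β₂ := filippovFlow_of_le ha le_rfl _
  have hle : ∀ τ, frozen s t X τ ≤ frozen s t Y τ := fun τ =>
    hu.mono hs (filippovCurve_filippovFlow ha s β₁) (filippovCurve_filippovFlow ha s β₂)
      (by rw [filippovFlow_of_le ha le_rfl, filippovFlow_of_le ha le_rfl]; exact hβ) (le_max_left _ _)
  have e1 := h.potential_strip hL₁ hL₂ hle (hs.trans hst)
  have e2 := h.potential_strip hL₁ hL₂ hle hs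
  have hi : ∀ p q, IntervalIntegrable (fun τ =>
      traceFlux id f (U (frozen s t Y τ) τ) (deriv (frozen s t Y) τ) -
        traceFlux id f (U (frozen s t X τ) τ) (deriv (frozen s t X) τ)) volume p q := fun p q =>
    (((h.locallyIntegrable_flux continuous_id h.continuous_flux hL₂).sub
      (h.locallyIntegrable_flux continuous_id h.continuous_flux hL₁)).integrableOn_isCompact
        isCompact_uIcc).intervalIntegrable
  have e3 := intervalIntegral.integral_interval_sub_left (hi 0 t) (hi 0 s)
  have e4 : ∫ τ in s..t, (traceFlux id f (U (frozen s t Y τ) τ) (deriv (frozen s t Y) τ) -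
        traceFlux id f (U (frozen s t X τ) τ) (deriv (frozen s t X) τ)) =
      ∫ τ in s..t, (c * deriv Y τ - c * deriv X τ) := by
    rw [intervalIntegral.integral_of_le hst, intervalIntegral.integral_of_le hst,
      integral_Ioc_eq_integral_Ioo, integral_Ioc_eq_integral_Ioo]
    apply setIntegral_congr_ae measurableSet_Ioo
    filter_upwards [hu.ae_deriv_flow ha hs h₁', hu.ae_deriv_flow ha hs h₂'] with τ k1 k2 hτ
    have k1 := k1 hτ
    have k2 := k2 hτ
    rw [deriv_frozen hτ, deriv_frozen hτ, frozen_eq (Ioo_subset_Icc_self hτ),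
      frozen_eq (Ioo_subset_Icc_self hτ), k1, k2]
    rw [hX, hY]
    simp only [velocity, traceFlux_secantSpeed]
    ring
  have hdi : ∀ {Z : ℝ → ℝ}, LipschitzWith Λ Z →
      IntervalIntegrable (fun τ => c * deriv Z τ) volume s t := fun hZ =>
    ((locallyIntegrable_deriv hZ).integrableOn_isCompact
      isCompact_uIcc).intervalIntegrable.const_mul c
  have hLX := (filippovCurve_filippovFlow ha s β₁).lipschitz
  have hLY := (filippovCurve_filippovFlow ha s β₂).lipschitz
  rw [intervalIntegral.integral_sub (hdi hLY) (hdi hLX), intervalIntegral.integral_const_mul,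
    intervalIntegral.integral_const_mul, LipschitzWith.integral_deriv hLX,
    LipschitzWith.integral_deriv hLY] at e4
  simp only [frozen_eq (right_mem_Icc.2 hst), frozen_eq (left_mem_Icc.2 hst)] at e1 e2
  simp only [← hX, ← hY] at e4 h₁ h₂
  rw [hXs, hYs] at e2 e4
  rw [h₁, h₂] at e1 e4
  linarith

end Transport

/-! ### Contraction of the relative mass along the flow -/

lemma lintegral_ne_top_of_abs_le {g : ℝ → ℝ} {C : ℝ} (hC : ∀ x, |g x| ≤ C) {s : Set ℝ}
    (hs : volume s ≠ ⊤) : ∫⁻ x in s, ENNReal.ofReal (g x) ≠ ⊤ := by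
  have h1 : ∫⁻ x in s, ENNReal.ofReal (g x) ≤ ENNReal.ofReal C * volume s := by
    rw [← setLIntegral_const]
    exact lintegral_mono fun x => ENNReal.ofReal_le_ofReal ((le_abs_self _).trans (hC x))
  exact ne_top_of_le_ne_top (ENNReal.mul_ne_top ENNReal.ofReal_ne_top hs) h1

lemma volume_preimage_Ioc_ne_top {T : ℝ → ℝ} {D : ℝ} (hT : ∀ y, |T y - y| ≤ D) (z₁ z₂ : ℝ) :
    volume (T ⁻¹' Ioc z₁ z₂) ≠ ⊤ := by
  have hsub : T ⁻¹' Ioc z₁ z₂ ⊆ Icc (z₁ - D) (z₂ + D) := by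
    intro y hy
    have h1 := abs_le.1 (hT y)
    exact ⟨by linarith [hy.1], by linarith [hy.2]⟩
  exact ne_top_of_le_ne_top measure_Icc_lt_top.ne (measure_mono hsub)

lemma setIntegral_eq_toReal_sub {g : ℝ → ℝ} (hg : Measurable g) {C : ℝ} (hC : ∀ x, |g x| ≤ C)
    {s : Set ℝ} (hs : volume s ≠ ⊤) :
    ∫ x in s, g x = (∫⁻ x in s, ENNReal.ofReal (g x)).toReal -
      (∫⁻ x in s, ENNReal.ofReal (-g x)).toReal := by
  apply integral_eq_lintegral_pos_part_sub_lintegral_neg_part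
  exact Measure.integrableOn_of_bounded (M := C) hs hg.aestronglyMeasurable
    (ae_of_all _ fun x => by rw [Real.norm_eq_abs]; exact hC x)

/-- If a map transports the signed density `G` to `g`, then the total variation does not increase.
Cancellation may occur when the map is not injective. -/
lemma withDensity_abs_le_map {g G T : ℝ → ℝ} (hg : Measurable g) (hG : Measurable G)
    (hT : Measurable T) {C D : ℝ} (hgC : ∀ x, |g x| ≤ C) (hGC : ∀ x, |G x| ≤ C)
    (hTD : ∀ y, |T y - y| ≤ D)
    (h : ∀ z₁ z₂, z₁ < z₂ → ∫ x in Ioc z₁ z₂, g x = ∫ x in T ⁻¹' Ioc z₁ z₂, G x) :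
    volume.withDensity (fun x => ENNReal.ofReal |g x|) ≤
      (volume.withDensity fun x => ENNReal.ofReal |G x|).map T := by
  have hneg : ∀ {k : ℝ → ℝ}, (∀ x, |k x| ≤ C) → ∀ x, |-k x| ≤ C := fun hk x => by
    rw [abs_neg]; exact hk x
  set μ := volume.withDensity (fun x => ENNReal.ofReal (g x)) +
    (volume.withDensity fun x => ENNReal.ofReal (-G x)).map T with hμ
  set ν := volume.withDensity (fun x => ENNReal.ofReal (-g x)) +
    (volume.withDensity fun x => ENNReal.ofReal (G x)).map T with hν
  have hμν : μ = ν := by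
    have hfin := fun z₁ z₂ : ℝ => (measure_Ioc_lt_top (μ := volume) (a := z₁) (b := z₂)).ne
    have hfin' := volume_preimage_Ioc_ne_top hTD
    apply Measure.ext_of_Ioc'
    · intro z₁ z₂ _
      rw [hμ, Measure.add_apply, Measure.map_apply hT measurableSet_Ioc,
        withDensity_apply _ measurableSet_Ioc, withDensity_apply _ (hT measurableSet_Ioc)]
      exact ENNReal.add_ne_top.2 ⟨lintegral_ne_top_of_abs_le hgC (hfin _ _),
        lintegral_ne_top_of_abs_le (hneg hGC) (hfin' _ _)⟩
    · intro z₁ z₂ hz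
      rw [hμ, hν, Measure.add_apply, Measure.add_apply, Measure.map_apply hT measurableSet_Ioc,
        Measure.map_apply hT measurableSet_Ioc,
        withDensity_apply _ measurableSet_Ioc, withDensity_apply _ (hT measurableSet_Ioc),
        withDensity_apply _ measurableSet_Ioc, withDensity_apply _ (hT measurableSet_Ioc)]
      have e := h z₁ z₂ hz
      rw [setIntegral_eq_toReal_sub hg hgC (hfin _ _), setIntegral_eq_toReal_sub hG hGC (hfin' _ _)]
        at e
      have n1 := lintegral_ne_top_of_abs_le hgC (hfin z₁ z₂)
      have n2 := lintegral_ne_top_of_abs_le (hneg hgC) (hfin z₁ z₂)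
      have n3 := lintegral_ne_top_of_abs_le hGC (hfin' z₁ z₂)
      have n4 := lintegral_ne_top_of_abs_le (hneg hGC) (hfin' z₁ z₂)
      rw [← ENNReal.toReal_eq_toReal_iff' (ENNReal.add_ne_top.2 ⟨n1, n4⟩)
        (ENNReal.add_ne_top.2 ⟨n2, n3⟩), ENNReal.toReal_add n1 n4, ENNReal.toReal_add n2 n3]
      linarith
  have hsplit : ∀ {k : ℝ → ℝ}, ∀ x,
      ENNReal.ofReal |k x| = ENNReal.ofReal (k x) + ENNReal.ofReal (-k x) := by
    intro k x
    rcases le_total 0 (k x) with hx | hx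
    · rw [abs_of_nonneg hx, ENNReal.ofReal_of_nonpos (neg_nonpos.2 hx), add_zero]
    · rw [abs_of_nonpos hx, ENNReal.ofReal_of_nonpos hx, zero_add]
  have habs : ∀ {k : ℝ → ℝ}, Measurable k → volume.withDensity (fun x => ENNReal.ofReal |k x|) =
      volume.withDensity (fun x => ENNReal.ofReal (k x)) +
        volume.withDensity (fun x => ENNReal.ofReal (-k x)) := by
    intro k hk
    rw [← withDensity_add_left (by fun_prop)]
    congr 1
    funext x
    exact hsplit x
  -- As `g⁺ + T_# G⁻ = g⁻ + T_# G⁺`, the density `g⁺` is dominated by `T_# G⁺` on `{g > 0}`, and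
  -- `g⁻` by `T_# G⁻` on the complement.
  have hP : MeasurableSet {x | 0 < g x} := measurableSet_lt measurable_const hg
  rw [habs hg, habs hG, Measure.map_add _ _ hT]
  have hpos : ∀ A, MeasurableSet A → volume.withDensity (fun x => ENNReal.ofReal (g x)) A ≤
      (volume.withDensity fun x => ENNReal.ofReal (G x)).map T (A ∩ {x | 0 < g x}) := by
    intro A hA
    have h1 : volume.withDensity (fun x => ENNReal.ofReal (g x)) A =
        volume.withDensity (fun x => ENNReal.ofReal (g x)) (A ∩ {x | 0 < g x}) := by
      rw [← measure_inter_add_sdiff A hP, withDensity_apply _ (hA.diff hP)]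
      rw [setLIntegral_congr_fun (g := fun _ => 0) (hA.diff hP)]
      · simp
      · intro x hx
        exact ENNReal.ofReal_of_nonpos (not_lt.1 hx.2)
    have h2 : volume.withDensity (fun x => ENNReal.ofReal (-g x)) (A ∩ {x | 0 < g x}) = 0 := by
      rw [withDensity_apply _ (hA.inter hP), setLIntegral_congr_fun (g := fun _ => 0) (hA.inter hP)]
      · simp
      · intro x hx
        exact ENNReal.ofReal_of_nonpos (neg_nonpos.2 (le_of_lt hx.2))
    have h3 : μ (A ∩ {x | 0 < g x}) = ν (A ∩ {x | 0 < g x}) := by rw [hμν]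
    rw [hμ, hν, Measure.add_apply, Measure.add_apply, h2, zero_add] at h3
    rw [h1, ← h3]
    exact le_self_add
  have hnegm : ∀ A, MeasurableSet A → volume.withDensity (fun x => ENNReal.ofReal (-g x)) A ≤
      (volume.withDensity fun x => ENNReal.ofReal (-G x)).map T (A \ {x | 0 < g x}) := by
    intro A hA
    have h1 : volume.withDensity (fun x => ENNReal.ofReal (-g x)) A =
        volume.withDensity (fun x => ENNReal.ofReal (-g x)) (A \ {x | 0 < g x}) := by
      rw [← measure_inter_add_sdiff A hP, withDensity_apply _ (hA.inter hP)]
      rw [setLIntegral_congr_fun (g := fun _ => 0) (hA.inter hP)]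
      · simp
      · intro x hx
        exact ENNReal.ofReal_of_nonpos (neg_nonpos.2 (le_of_lt hx.2))
    have h2 : volume.withDensity (fun x => ENNReal.ofReal (g x)) (A \ {x | 0 < g x}) = 0 := by
      rw [withDensity_apply _ (hA.diff hP), setLIntegral_congr_fun (g := fun _ => 0) (hA.diff hP)]
      · simp
      · intro x hx
        exact ENNReal.ofReal_of_nonpos (not_lt.1 hx.2)
    have h3 : μ (A \ {x | 0 < g x}) = ν (A \ {x | 0 < g x}) := by rw [hμν]
    rw [hμ, hν, Measure.add_apply, Measure.add_apply, h2, zero_add] at h3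
    rw [h1, h3]
    exact le_self_add
  rw [Measure.le_iff]
  intro A hA
  rw [Measure.add_apply, Measure.add_apply]
  exact add_le_add ((hpos A hA).trans (measure_mono inter_subset_left))
    ((hnegm A hA).trans (measure_mono sdiff_subset))

lemma integral_abs_mul_le_of_transport {g G T : ℝ → ℝ} (hg : Measurable g) (hG : Measurable G)
    (hT : Measurable T) {C D : ℝ} (hgC : ∀ x, |g x| ≤ C) (hGC : ∀ x, |G x| ≤ C)
    (hTD : ∀ y, |T y - y| ≤ D)
    (h : ∀ z₁ z₂, z₁ < z₂ → ∫ x in Ioc z₁ z₂, g x = ∫ x in T ⁻¹' Ioc z₁ z₂, G x)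
    {ψ : ℝ → ℝ} (hψ : Measurable ψ) (hψ0 : ∀ x, 0 ≤ ψ x)
    (hi : Integrable fun x => |G x| * ψ (T x)) :
    ∫ x, |g x| * ψ x ≤ ∫ x, |G x| * ψ (T x) := by
  rw [integral_eq_lintegral_of_nonneg_ae (ae_of_all _ fun x => mul_nonneg (abs_nonneg _) (hψ0 _))
    (hg.abs.mul hψ).aestronglyMeasurable, integral_eq_lintegral_of_nonneg_ae
    (ae_of_all _ fun x => mul_nonneg (abs_nonneg _) (hψ0 _))
    (hG.abs.mul (hψ.comp hT)).aestronglyMeasurable]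
  refine ENNReal.toReal_mono ?_ ?_
  · have := hi.lintegral_lt_top
    exact this.ne
  · have h1 := lintegral_mono' (withDensity_abs_le_map hg hG hT hgC hGC hTD h)
      (le_refl fun x => ENNReal.ofReal (ψ x))
    rw [lintegral_map (by fun_prop) hT,
      lintegral_withDensity_eq_lintegral_mul _ (by fun_prop) (by fun_prop),
      lintegral_withDensity_eq_lintegral_mul _ (by fun_prop) (by fun_prop)] at h1
    simpa only [Pi.mul_apply, ← ENNReal.ofReal_mul (abs_nonneg _)] using h1

section Mass

variable {f u₀ : ℝ → ℝ} {M : ℝ} {U UL : ℝ → ℝ → ℝ} {Λ : ℝ≥0} {c s t : ℝ}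

/-- `w` represents the solution at time `t`: its primitive is the potential. -/
structure IsSlice (f u₀ : ℝ → ℝ) (M : ℝ) (U : ℝ → ℝ → ℝ) (t : ℝ) (w : ℝ → ℝ) : Prop where
  measurable : Measurable w
  abs_le : ∀ x, |w x| ≤ M
  integral : ∀ a b, ∫ x in a..b, w x = potential f u₀ U b t - potential f u₀ U a t

lemma WeakField.ae_isSlice (h : WeakField f u₀ M U UL) :
    ∀ᵐ t, 0 < t → IsSlice f u₀ M U t fun x => U x t := by
  filter_upwards [h.ae_integral_eq_potential] with t ht ht0
  exact ⟨h.measurable_slice t, fun x => h.abs_le x t, ht ht0⟩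

lemma WeakField.isSlice_init (h : WeakField f u₀ M U UL) : IsSlice f u₀ M U 0 u₀ :=
  ⟨h.measurable_init, h.abs_init_le, h.integral_init_eq_potential⟩

lemma IsSlice.integral_sub {w : ℝ → ℝ} (hw : IsSlice f u₀ M U t w) (c : ℝ) {a b : ℝ} (hab : a ≤ b) :
    ∫ x in Ioc a b, (w x - c) = potential f u₀ U b t - potential f u₀ U a t - c * (b - a) := by
  rw [← hw.integral, ← intervalIntegral.integral_of_le hab, intervalIntegral.integral_sub
    (intervalIntegrable_of_abs_le hw.measurable hw.abs_le a b) intervalIntegrable_const,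
    intervalIntegral.integral_const, smul_eq_mul]
  ring

/-- The flow of the field `a_c` does not increase the mass of `|u - c|`. -/
theorem WeakField.integral_abs_mul_le (h : WeakField f u₀ M U UL)
    (ha : CadlagField Λ (velocity f U c) (velocity f UL c))
    (hu : UniqueCurves (velocity f U c) (velocity f UL c) Λ) (hs : 0 ≤ s) (hst : s ≤ t)
    {v w : ℝ → ℝ} (hv : IsSlice f u₀ M U s v) (hw : IsSlice f u₀ M U t w) {ψ : ℝ → ℝ}
    (hψ : Continuous ψ) (hψc : HasCompactSupport ψ) (hψ0 : ∀ x, 0 ≤ ψ x) :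
    ∫ x, |w x - c| * ψ x ≤ ∫ x, |v x - c| * ψ (filippovFlow ha s x t) := by
  have hTc := hu.continuous_flow ha hs t
  have hTD := abs_filippovFlow_sub_le ha hst
  have hbd : ∀ {w : ℝ → ℝ}, (∀ x, |w x| ≤ M) → ∀ x, |w x - c| ≤ M + |c| := fun hw x =>
    (abs_sub _ _).trans (add_le_add_left (hw x) _)
  refine integral_abs_mul_le_of_transport (hw.measurable.sub_const c) (hv.measurable.sub_const c)
    hTc.measurable (hbd hw.abs_le) (hbd hv.abs_le) hTD (fun z₁ z₂ hz => ?_) hψ.measurable hψ0 ?_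
  · obtain ⟨β₁, h₁, h₁'⟩ := hu.exists_origin ha hs hst z₁
    obtain ⟨β₂, h₂, h₂'⟩ := hu.exists_origin ha hs hst z₂
    have hβ : β₁ ≤ β₂ := (h₂' _).1 (h₁.le.trans hz.le)
    have hpre : (fun y => filippovFlow ha s y t) ⁻¹' Ioc z₁ z₂ = Ioc β₁ β₂ := by
      ext y
      simp only [mem_preimage, mem_Ioc]
      rw [h₂', ← not_le, h₁', not_le]
    rw [hpre, hw.integral_sub c hz.le, hv.integral_sub c hβ]
    exact h.potential_flow ha hu hs hst hz.le h₁ h₁' h₂ h₂'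
  · have hcs : HasCompactSupport fun x => ψ (filippovFlow ha s x t) := by
      obtain ⟨R, -, hR⟩ := hasCompactSupport_exists hψc
      apply hasCompactSupport_of_zero_off (z := 0) (R := R + Λ * (t - s))
      intro x hx
      refine (hR _ ?_).1
      rw [Real.dist_eq, sub_zero] at hx
      have h1 := hTD x
      have h2 := abs_sub_abs_le_abs_sub x (filippovFlow ha s x t)
      rw [abs_sub_comm] at h2
      linarith
    exact ((hψ.comp hTc).integrable_of_hasCompactSupport hcs).bdd_mul
      (hv.measurable.sub_const c).abs.aestronglyMeasurable
      (ae_of_all _ fun x => by rw [Real.norm_eq_abs, abs_abs]; exact hbd hv.abs_le x)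

end Mass

/-! ### The Kruzkov inequalities from the contraction property -/

/-- The time derivative of a test function. -/
noncomputable def timeDeriv (φ : ℝ → ℝ → ℝ) (x t : ℝ) : ℝ := deriv (fun τ => φ x τ) t

/-- The space derivative of a test function. -/
noncomputable def spaceDeriv (φ : ℝ → ℝ → ℝ) (x t : ℝ) : ℝ := deriv (fun y => φ y t) x

section Test

variable {φ : ℝ → ℝ → ℝ}

lemma IsTest.timeDeriv_eq (hφ : IsTest φ) (x t : ℝ) :
    timeDeriv φ x t = fderiv ℝ (Function.uncurry φ) (x, t) (0, 1) := by
  have h1 := (hφ.1.differentiable (by simp) (x, t)).hasFDerivAt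
  have h2 : HasDerivAt (fun τ : ℝ => (x, τ)) (0, 1) t :=
    (hasDerivAt_const t x).prodMk (hasDerivAt_id t)
  exact (h1.comp_hasDerivAt t h2).deriv

lemma IsTest.spaceDeriv_eq (hφ : IsTest φ) (x t : ℝ) :
    spaceDeriv φ x t = fderiv ℝ (Function.uncurry φ) (x, t) (1, 0) := by
  have h1 := (hφ.1.differentiable (by simp) (x, t)).hasFDerivAt
  have h2 : HasDerivAt (fun y : ℝ => (y, t)) (1, 0) x :=
    (hasDerivAt_id x).prodMk (hasDerivAt_const x t)
  exact (h1.comp_hasDerivAt x h2).deriv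

lemma IsTest.continuous_timeDeriv (hφ : IsTest φ) :
    Continuous (Function.uncurry (timeDeriv φ)) := by
  have : Function.uncurry (timeDeriv φ) = fun p => fderiv ℝ (Function.uncurry φ) p (0, 1) := by
    funext p; exact hφ.timeDeriv_eq p.1 p.2
  rw [this]
  exact (hφ.1.continuous_fderiv (by simp)).clm_apply continuous_const

lemma IsTest.continuous_spaceDeriv (hφ : IsTest φ) :
    Continuous (Function.uncurry (spaceDeriv φ)) := by
  have : Function.uncurry (spaceDeriv φ) = fun p => fderiv ℝ (Function.uncurry φ) p (1, 0) := by
    funext p; exact hφ.spaceDeriv_eq p.1 p.2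
  rw [this]
  exact (hφ.1.continuous_fderiv (by simp)).clm_apply continuous_const

lemma IsTest.exists_support (hφ : IsTest φ) : ∃ N : ℝ, 0 < N ∧ ∀ x t, N ≤ |x| ∨ N ≤ |t| →
    φ x t = 0 ∧ timeDeriv φ x t = 0 ∧ spaceDeriv φ x t = 0 := by
  obtain ⟨N, hN, h⟩ := hφ.2.exists_pos_le_norm
  obtain ⟨N', hN', h'⟩ := (hφ.2.fderiv (𝕜 := ℝ)).exists_pos_le_norm
  refine ⟨max N N', lt_max_of_lt_left hN, fun x t hxt => ?_⟩
  have hn : max N N' ≤ ‖(x, t)‖ := by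
    rw [Prod.norm_def, Real.norm_eq_abs, Real.norm_eq_abs]
    exact le_max_iff.2 hxt
  have h1 := h _ ((le_max_left _ _).trans hn)
  have h2 := h' _ ((le_max_right _ _).trans hn)
  rw [hφ.timeDeriv_eq, hφ.spaceDeriv_eq, h2]
  exact ⟨h1, rfl, rfl⟩

/-- First order Taylor expansion with a uniform quadratic remainder. -/
lemma IsTest.exists_bounds (hφ : IsTest φ) : ∃ C : ℝ, 0 ≤ C ∧
    (∀ x t, |φ x t| ≤ C ∧ |timeDeriv φ x t| ≤ C ∧ |spaceDeriv φ x t| ≤ C) ∧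
    (∀ x t y r, |φ y r - φ x t| ≤ C * (|y - x| + |r - t|)) ∧
    ∀ x t y r, |φ y r - φ x t - (timeDeriv φ x t * (r - t) + spaceDeriv φ x t * (y - x))| ≤
      C * (|y - x| + |r - t|) ^ 2 := by
  set F := Function.uncurry φ with hF
  have hd : Differentiable ℝ F := hφ.1.differentiable (by simp)
  have hFc := hφ.1.continuous
  have hDc : Continuous (fderiv ℝ F) := hφ.1.continuous_fderiv (by simp)
  obtain ⟨C₁, h₁⟩ := hφ.2.exists_bound_of_continuous hFc
  obtain ⟨C₂, h₂⟩ := (hφ.2.fderiv (𝕜 := ℝ)).exists_bound_of_continuous hDc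
  have hD1 : ContDiff ℝ 1 (fderiv ℝ F) := hφ.1.fderiv_right (by norm_cast)
  obtain ⟨L, hL⟩ :=
    ContDiff.lipschitzWith_of_hasCompactSupport (hφ.2.fderiv (𝕜 := ℝ)) hD1 one_ne_zero
  have hC₁ : 0 ≤ C₁ := (norm_nonneg _).trans (h₁ 0)
  have hC₂ : 0 ≤ C₂ := (norm_nonneg _).trans (h₂ 0)
  have hnorm : ∀ x t y r : ℝ, ‖((y, r) : ℝ × ℝ) - (x, t)‖ ≤ |y - x| + |r - t| := by
    intro x t y r
    rw [Prod.mk_sub_mk, Prod.norm_def, Real.norm_eq_abs, Real.norm_eq_abs]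
    exact max_le (le_add_of_nonneg_right (abs_nonneg _)) (le_add_of_nonneg_left (abs_nonneg _))
  have hap : ∀ p v : ℝ × ℝ, ‖v‖ ≤ 1 → |fderiv ℝ F p v| ≤ C₂ := by
    intro p v hv
    rw [← Real.norm_eq_abs]
    refine ((fderiv ℝ F p).le_opNorm v).trans ?_
    calc _ ≤ C₂ * 1 := mul_le_mul (h₂ p) hv (norm_nonneg _) hC₂
      _ = C₂ := mul_one _
  refine ⟨C₁ + C₂ + L, by positivity, fun x t => ⟨?_, ?_, ?_⟩, fun x t y r => ?_, fun x t y r => ?_⟩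
  · have := h₁ (x, t)
    rw [Real.norm_eq_abs] at this
    exact this.trans (by linarith [L.2])
  · rw [hφ.timeDeriv_eq]
    exact (hap _ _ (by simp [Prod.norm_def])).trans (by linarith [L.2])
  · rw [hφ.spaceDeriv_eq]
    exact (hap _ _ (by simp [Prod.norm_def])).trans (by linarith [L.2])
  · have h3 := Convex.norm_image_sub_le_of_norm_fderiv_le (𝕜 := ℝ) (f := F) (s := univ)
      (x := (x, t)) (y := (y, r))
      (fun p _ => hd p) (fun p _ => h₂ p) convex_univ (mem_univ _) (mem_univ _)
    rw [Real.norm_eq_abs] at h3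
    refine h3.trans (mul_le_mul ?_ (hnorm x t y r) (norm_nonneg _) (by positivity))
    linarith [L.2]
  · have h3 := Convex.norm_image_sub_le_of_norm_fderiv_le' (𝕜 := ℝ) (f := F)
      (s := segment ℝ ((x, t) : ℝ × ℝ) (y, r)) (x := (x, t)) (y := (y, r))
      (φ := fderiv ℝ F (x, t)) (C := L * (|y - x| + |r - t|))
      (fun p _ => hd p) (fun p hp => ?_) (convex_segment _ _) (left_mem_segment _ _ _)
      (right_mem_segment _ _ _)
    · have e : fderiv ℝ F (x, t) ((y, r) - (x, t)) =
          timeDeriv φ x t * (r - t) + spaceDeriv φ x t * (y - x) := by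
        have : ((y, r) : ℝ × ℝ) - (x, t) =
            (r - t) • ((0, 1) : ℝ × ℝ) + (y - x) • ((1, 0) : ℝ × ℝ) := by
          ext <;> simp
        rw [this, map_add, map_smul, map_smul, hφ.timeDeriv_eq, hφ.spaceDeriv_eq, smul_eq_mul,
          smul_eq_mul, mul_comm (r - t), mul_comm (y - x)]
      rw [e, Real.norm_eq_abs] at h3
      refine h3.trans ?_
      have h4 := mul_le_mul_of_nonneg_left (hnorm x t y r)
        (show 0 ≤ (L : ℝ) * (|y - x| + |r - t|) by positivity)
      refine h4.trans ?_
      have h5 : 0 ≤ (C₁ + C₂) * (|y - x| + |r - t|) ^ 2 := by positivity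
      nlinarith
    · have h4 := hL.dist_le_mul p (x, t)
      rw [dist_eq_norm, dist_eq_norm] at h4
      refine h4.trans (mul_le_mul_of_nonneg_left ?_ L.2)
      rw [segment_eq_image'] at hp
      obtain ⟨θ, hθ, rfl⟩ := hp
      rw [add_sub_cancel_left, norm_smul, Real.norm_eq_abs, abs_of_nonneg hθ.1]
      calc _ ≤ 1 * ‖((y, r) : ℝ × ℝ) - (x, t)‖ := mul_le_mul_of_nonneg_right hθ.2 (norm_nonneg _)
        _ ≤ _ := by rw [one_mul]; exact hnorm x t y r

end Test

section Average

/-- The average of `A(x, ·)` over the time interval `[s, s + η]`, written over a fixed interval so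
that it is clearly measurable in all variables. -/
noncomputable def timeAverage (A : ℝ → ℝ → ℝ) (η x s : ℝ) : ℝ :=
  ∫ σ in Ioc (0 : ℝ) 1, A x (s + η * σ)

variable {A : ℝ → ℝ → ℝ} {C : ℝ}

lemma measurable_timeAverage (hA : Measurable (Function.uncurry A)) (η : ℝ) :
    Measurable (Function.uncurry (timeAverage A η)) := by
  have h1 : Measurable fun p : (ℝ × ℝ) × ℝ => A p.1.1 (p.1.2 + η * p.2) :=
    hA.comp (f := fun p : (ℝ × ℝ) × ℝ => (p.1.1, p.1.2 + η * p.2)) (by fun_prop)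
  exact (h1.stronglyMeasurable.integral_prod_right' (ν := volume.restrict (Ioc (0 : ℝ) 1))).measurable

lemma abs_timeAverage_le (hC : ∀ x t, |A x t| ≤ C) (η x s : ℝ) : |timeAverage A η x s| ≤ C := by
  have := norm_setIntegral_le_of_norm_le_const (μ := volume) (s := Ioc (0 : ℝ) 1)
    (f := fun σ => A x (s + η * σ)) (C := C) (by simp)
    (fun σ _ => by rw [Real.norm_eq_abs]; exact hC _ _)
  rw [Real.norm_eq_abs] at this
  simpa [timeAverage] using this

lemma timeAverage_eq {η : ℝ} (hη : 0 < η) (x s : ℝ) :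
    timeAverage A η x s = η⁻¹ * ∫ τ in Ioc s (s + η), A x τ := by
  unfold timeAverage
  rw [← intervalIntegral.integral_of_le zero_le_one,
    intervalIntegral.integral_comp_add_mul (fun τ => A x τ) hη.ne' s, smul_eq_mul,
    intervalIntegral.integral_of_le (by linarith), mul_zero, mul_one, add_zero]

lemma ae_tendsto_timeAverage (hA : Measurable (Function.uncurry A)) (hC : ∀ x t, |A x t| ≤ C) :
    ∀ᵐ s, ∀ᵐ x, Tendsto (fun n : ℕ => timeAverage A (1 / ((n : ℝ) + 1)) x s) atTop (𝓝 (A x s)) := by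
  have hpos : ∀ n : ℕ, 0 < 1 / ((n : ℝ) + 1) := fun n => by positivity
  have hmeas : MeasurableSet {p : ℝ × ℝ | Tendsto
      (fun n : ℕ => timeAverage A (1 / ((n : ℝ) + 1)) p.1 p.2) atTop (𝓝 (A p.1 p.2))} :=
    measurableSet_tendsto_fun (fun n => measurable_timeAverage hA _) hA
  rw [← Measure.ae_ae_comm hmeas]
  refine ae_of_all _ fun x => ?_
  have hm : Measurable fun τ => A x τ := hA.comp measurable_prodMk_left
  filter_upwards [ae_tendsto_average_right (locallyIntegrable_of_abs_le hm (hC x))] with s hs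
  have h1 : Tendsto (fun n : ℕ => s + 1 / ((n : ℝ) + 1)) atTop (𝓝[>] s) := by
    simpa using tendsto_affine_nhdsGT s one_pos
  refine (hs.comp h1).congr fun n => ?_
  rw [timeAverage_eq (hpos n), Function.comp, add_sub_cancel_left]

/-- Dominated convergence for iterated integrals of functions supported in a bounded strip. -/
lemma tendsto_integral_integral {g : ℕ → ℝ → ℝ → ℝ} {g' : ℝ → ℝ → ℝ} {K R N : ℝ}
    (hg : ∀ n, Measurable (Function.uncurry (g n))) (hK : ∀ n x s, |g n x s| ≤ K)
    (hR : ∀ n x s, R < |x| → g n x s = 0)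
    (hlim : ∀ᵐ s, ∀ᵐ x, Tendsto (fun n => g n x s) atTop (𝓝 (g' x s))) :
    Tendsto (fun n => ∫ s in Ioc 0 N, ∫ x, g n x s) atTop (𝓝 (∫ s in Ioc 0 N, ∫ x, g' x s)) := by
  have hb : Integrable ((Icc (-R) R).indicator fun _ : ℝ => K) :=
    (integrable_indicator_iff measurableSet_Icc).2 (integrableOn_const measure_Icc_lt_top.ne)
  have hle : ∀ n x s, ‖g n x s‖ ≤ (Icc (-R) R).indicator (fun _ : ℝ => K) x := by
    intro n x s
    by_cases hx : |x| ≤ R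
    · rw [indicator_of_mem (show x ∈ Icc (-R) R from abs_le.1 hx)]
      exact hK n x s
    · rw [hR n x s (not_le.1 hx), norm_zero]
      exact indicator_nonneg (fun _ _ => (abs_nonneg _).trans (hK n x s)) x
  refine tendsto_integral_of_dominated_convergence
    (fun _ => ∫ x, (Icc (-R) R).indicator (fun _ : ℝ => K) x) (fun n => ?_) (integrable_const _)
    (fun n => ae_of_all _ fun s => norm_integral_le_of_norm_le hb (ae_of_all _ fun x => hle n x s)) ?_
  · have h1 : Measurable fun p : ℝ × ℝ => g n p.2 p.1 := (hg n).comp measurable_swap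
    exact (h1.stronglyMeasurable.integral_prod_right' (ν := volume)).aestronglyMeasurable
  · refine ae_restrict_of_ae ?_
    filter_upwards [hlim] with s hs
    exact tendsto_integral_of_dominated_convergence _
      (fun n => ((hg n).comp measurable_prodMk_right).aestronglyMeasurable) hb
      (fun n => ae_of_all _ fun x => hle n x s) hs

end Average

/-- The largest rate of change of the test function `φ` along curves with speed in `[-B, A]`. -/
noncomputable def driftBound (φ A B : ℝ → ℝ → ℝ) (x t : ℝ) : ℝ :=
  timeDeriv φ x t + max (spaceDeriv φ x t) 0 * A x t + max (-spaceDeriv φ x t) 0 * B x t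

section Drift

variable {φ A B : ℝ → ℝ → ℝ}

lemma measurable_driftBound (hφ : IsTest φ) (hA : Measurable (Function.uncurry A))
    (hB : Measurable (Function.uncurry B)) : Measurable (Function.uncurry (driftBound φ A B)) := by
  have h1 := hφ.continuous_timeDeriv.measurable
  have h2 := hφ.continuous_spaceDeriv.measurable
  exact (h1.add ((h2.max measurable_const).mul hA)).add ((h2.neg.max measurable_const).mul hB)

lemma abs_driftBound_le {C Λ : ℝ} (h1 : ∀ x t, |timeDeriv φ x t| ≤ C)
    (h2 : ∀ x t, |spaceDeriv φ x t| ≤ C) (hA : ∀ x t, |A x t| ≤ Λ) (hB : ∀ x t, |B x t| ≤ Λ)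
    (x t : ℝ) : |driftBound φ A B x t| ≤ C + C * Λ + C * Λ := by
  have hC : 0 ≤ C := (abs_nonneg _).trans (h1 x t)
  have hm : ∀ z : ℝ, |z| ≤ C → |max z 0| ≤ C := fun z hz => by
    rw [abs_of_nonneg (le_max_right _ _)]
    exact max_le ((le_abs_self _).trans hz) hC
  unfold driftBound
  refine (abs_add_le _ _).trans (add_le_add ((abs_add_le _ _).trans (add_le_add (h1 x t) ?_)) ?_)
  · rw [abs_mul]
    exact mul_le_mul (hm _ (h2 x t)) (hA x t) (abs_nonneg _) hC
  · rw [abs_mul]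
    exact mul_le_mul (hm _ (by rw [abs_neg]; exact h2 x t)) (hB x t) (abs_nonneg _) hC

lemma driftBound_eq_zero {x t : ℝ} (h1 : timeDeriv φ x t = 0) (h2 : spaceDeriv φ x t = 0) :
    driftBound φ A B x t = 0 := by
  simp [driftBound, h1, h2]

lemma tendsto_driftBound {An Bn : ℕ → ℝ → ℝ → ℝ} {x t : ℝ} {α β : ℝ}
    (hA : Tendsto (fun n => An n x t) atTop (𝓝 α)) (hB : Tendsto (fun n => Bn n x t) atTop (𝓝 β)) :
    Tendsto (fun n => driftBound φ (An n) (Bn n) x t) atTop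
      (𝓝 (driftBound φ (fun _ _ => α) (fun _ _ => β) x t)) :=
  (tendsto_const_nhds.add (tendsto_const_nhds.mul hA)).add (tendsto_const_nhds.mul hB)

lemma driftBound_neg (a : ℝ) (x t : ℝ) : driftBound φ (fun _ _ => a) (fun _ _ => -a) x t =
    timeDeriv φ x t + a * spaceDeriv φ x t := by
  unfold driftBound
  have : max (spaceDeriv φ x t) 0 - max (-spaceDeriv φ x t) 0 = spaceDeriv φ x t := by
    rcases le_total 0 (spaceDeriv φ x t) with h | h
    · rw [max_eq_left h, max_eq_right (neg_nonpos.2 h), sub_zero]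
    · rw [max_eq_right h, max_eq_left (neg_nonneg.2 h)]; ring
  linear_combination a * this

end Drift

lemma notMem_Icc_neg_of_lt_abs {R x : ℝ} (h : R < |x|) : x ∉ Icc (-R) R :=
  fun hm => not_le.2 h (abs_le.2 hm)

section Increment

variable {Λ : ℝ≥0} {a aL : ℝ → ℝ → ℝ} {X : ℝ → ℝ} {s : ℝ}

lemma FilippovCurve.increment_le_localSup (ha : CadlagField Λ a aL)
    (hX : FilippovCurve a aL Λ s X) {η δ : ℝ} (hη : 0 < η) (hδ : Λ * η < δ) :
    X (s + η) - X s ≤ η * timeAverage (localSup a δ) η (X s) s ∧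
    -(X (s + η) - X s) ≤ η * timeAverage (localSup (fun x t => -a x t) δ) η (X s) s := by
  have hδ0 : 0 < δ := (mul_nonneg Λ.2 hη.le).trans_lt hδ
  have hmem : ∀ᵐ τ, τ ∈ Ioc s (s + η) → deriv X τ ≤ localSup a δ (X s) τ ∧
      -deriv X τ ≤ localSup (fun x t => -a x t) δ (X s) τ := by
    filter_upwards [hX.deriv_mem] with τ hτ hm
    refine ha.le_localSup_of_mem ?_ (hτ hm.1)
    refine (dist_le_of_lipschitz_comp hX.lipschitz τ s).trans_lt (lt_of_le_of_lt ?_ hδ)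
    rw [abs_of_nonneg (by linarith [hm.1])]
    exact mul_le_mul_of_nonneg_left (by linarith [hm.2]) Λ.2
  have hd : IntegrableOn (deriv X) (Ioc s (s + η)) :=
    ((locallyIntegrable_deriv hX.lipschitz).integrableOn_isCompact isCompact_Icc).mono_set
      Ioc_subset_Icc_self
  have hA : ∀ {b bL : ℝ → ℝ → ℝ}, CadlagField Λ b bL →
      IntegrableOn (fun τ => localSup b δ (X s) τ) (Ioc s (s + η)) := fun hb =>
    ((hb.locallyIntegrable_localSup hδ0 (continuous_const (y := X s))).integrableOn_isCompact
      isCompact_Icc).mono_set Ioc_subset_Icc_self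
  have e : X (s + η) - X s = ∫ τ in Ioc s (s + η), deriv X τ := by
    rw [← intervalIntegral.integral_of_le (by linarith), LipschitzWith.integral_deriv hX.lipschitz]
  rw [timeAverage_eq hη, timeAverage_eq hη, mul_inv_cancel_left₀ hη.ne', mul_inv_cancel_left₀ hη.ne',
    e, ← integral_neg]
  constructor
  · exact setIntegral_mono_on_ae hd (hA ha) measurableSet_Ioc (hmem.mono fun τ h hm => (h hm).1)
  · exact setIntegral_mono_on_ae hd.neg (hA ha.neg) measurableSet_Ioc
      (hmem.mono fun τ h hm => (h hm).2)

/-- The increment of a test function along a Filippov curve, up to second order in time. -/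
lemma FilippovCurve.test_increment_le (ha : CadlagField Λ a aL) (hX : FilippovCurve a aL Λ s X)
    {φ : ℝ → ℝ → ℝ} {N C : ℝ}
    (hN : ∀ x t, N ≤ |x| ∨ N ≤ |t| → φ x t = 0 ∧ timeDeriv φ x t = 0 ∧ spaceDeriv φ x t = 0)
    (hC0 : 0 ≤ C)
    (hC : ∀ x t y r, |φ y r - φ x t - (timeDeriv φ x t * (r - t) + spaceDeriv φ x t * (y - x))| ≤
      C * (|y - x| + |r - t|) ^ 2)
    {η δ : ℝ} (hη : 0 < η) (hη1 : η ≤ 1) (hδ : Λ * η < δ) :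
    φ (X (s + η)) (s + η) - φ (X s) s ≤ η * (driftBound φ (timeAverage (localSup a δ) η)
      (timeAverage (localSup (fun x t => -a x t) δ) η) (X s) s +
      η * (Icc (-(N + Λ)) (N + Λ)).indicator (fun _ => C * (Λ + 1) ^ 2) (X s)) := by
  have hd := dist_le_of_lipschitz_comp hX.lipschitz (s + η) s
  rw [add_sub_cancel_left, abs_of_pos hη] at hd
  by_cases hx : |X s| ≤ N + Λ
  · rw [indicator_of_mem (show X s ∈ Icc (-(N + Λ)) (N + Λ) from _root_.abs_le.1 hx)]
    have h1 := (_root_.abs_le.1 (hC (X s) s (X (s + η)) (s + η))).2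
    rw [add_sub_cancel_left, abs_of_pos hη] at h1
    obtain ⟨h2, h3⟩ := hX.increment_le_localSup ha hη hδ
    have h4 : C * (|X (s + η) - X s| + η) ^ 2 ≤ C * (Λ * η + η) ^ 2 :=
      mul_le_mul_of_nonneg_left (pow_le_pow_left₀ (by positivity) (by linarith) 2) hC0
    have h5 : spaceDeriv φ (X s) s * (X (s + η) - X s) =
        max (spaceDeriv φ (X s) s) 0 * (X (s + η) - X s) +
        max (-spaceDeriv φ (X s) s) 0 * -(X (s + η) - X s) := by
      rcases le_total 0 (spaceDeriv φ (X s) s) with h | h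
      · rw [max_eq_left h, max_eq_right (neg_nonpos.2 h)]; ring
      · rw [max_eq_right h, max_eq_left (neg_nonneg.2 h)]; ring
    have h6 := mul_le_mul_of_nonneg_left h2 (le_max_right (spaceDeriv φ (X s) s) 0)
    have h7 := mul_le_mul_of_nonneg_left h3 (le_max_right (-spaceDeriv φ (X s) s) 0)
    unfold driftBound
    linarith
  · have hx' := not_le.1 hx
    have h0 := hN (X s) s (Or.inl (by linarith [Λ.2]))
    have h1 := hN (X (s + η)) (s + η) (Or.inl (by
      have h2 := abs_sub_abs_le_abs_sub (X s) (X (s + η))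
      rw [abs_sub_comm] at h2
      have : (Λ : ℝ) * η ≤ Λ := mul_le_of_le_one_right Λ.2 hη1
      linarith))
    rw [indicator_of_notMem (notMem_Icc_neg_of_lt_abs hx'), driftBound_eq_zero h0.2.1 h0.2.2,
      h0.1, h1.1]
    simp

end Increment

lemma integrable_of_bounded_of_support {g : ℝ → ℝ} (hg : Measurable g) {K R : ℝ}
    (hK : ∀ x, |g x| ≤ K) (hR : ∀ x, R < |x| → g x = 0) : Integrable g := by
  rw [← integrableOn_iff_integrable_of_support_subset (s := Icc (-R) R)]
  · exact Measure.integrableOn_of_bounded (M := K) measure_Icc_lt_top.ne hg.aestronglyMeasurable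
      (ae_of_all _ fun x => by rw [Real.norm_eq_abs]; exact hK x)
  · intro x hx
    by_contra hx'
    refine hx (hR x (lt_of_not_ge fun h => hx' (abs_le.1 h)))

section Contraction

variable {f u₀ : ℝ → ℝ} {M : ℝ} {U UL : ℝ → ℝ → ℝ} {Λ : ℝ≥0} {c : ℝ} {φ : ℝ → ℝ → ℝ}

lemma CadlagField.abs_relative_le (hU : CadlagField M U UL) (c x t : ℝ) : |U x t - c| ≤ M + |c| :=
  (abs_sub _ _).trans (add_le_add_left (hU.abs_le x t) _)

lemma IsTest.continuous_slice (hφ : IsTest φ) (t : ℝ) : Continuous fun x => φ x t :=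
  hφ.1.continuous.comp (by fun_prop : Continuous fun x : ℝ => (x, t))

/-- The mass of `|u - c|` weighted by a test function. -/
noncomputable def relativeMass (U : ℝ → ℝ → ℝ) (c : ℝ) (φ : ℝ → ℝ → ℝ) (t : ℝ) : ℝ :=
  ∫ x, |U x t - c| * φ x t

lemma CadlagField.measurable_relativeMass (hU : CadlagField M U UL) (c : ℝ) (hφ : IsTest φ) :
    Measurable (relativeMass U c φ) := by
  have h1 : Measurable fun p : ℝ × ℝ => |U p.2 p.1 - c| * φ p.2 p.1 :=
    ((hU.measurable.comp measurable_swap).sub_const c).abs.mul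
      (hφ.1.continuous.measurable.comp measurable_swap)
  exact (h1.stronglyMeasurable.integral_prod_right' (ν := volume)).measurable

/-- Along the flow of the field `a_c`, the mass of `|u - c|` weighted by a nonnegative test function
grows at most as the test function does. -/
lemma WeakField.ae_relativeMass_sub_le (h : WeakField f u₀ M U UL)
    (ha : CadlagField Λ (velocity f U c) (velocity f UL c))
    (hu : UniqueCurves (velocity f U c) (velocity f UL c) Λ) (hφ : IsTest φ)
    (hφ0 : ∀ x t, 0 ≤ t → 0 ≤ φ x t) {η N : ℝ} (hη : 0 < η)
    (hN : ∀ x t, N ≤ |x| → φ x t = 0) {D : ℝ → ℝ → ℝ}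
    (hD : Measurable (Function.uncurry D)) {K R : ℝ} (hDK : ∀ x t, |D x t| ≤ K)
    (hDR : ∀ x t, R < |x| → D x t = 0)
    (hinc : ∀ s X, FilippovCurve (velocity f U c) (velocity f UL c) Λ s X →
      φ (X (s + η)) (s + η) - φ (X s) s ≤ η * D (X s) s) :
    ∀ᵐ s, 0 < s → relativeMass U c φ (s + η) - relativeMass U c φ s ≤
      η * ∫ x, |U x s - c| * D x s := by
  have hshift : ∀ᵐ s, 0 < s + η → IsSlice f u₀ M U (s + η) fun x => U x (s + η) :=
    (measurePreserving_add_right volume η).quasiMeasurePreserving.ae h.ae_isSlice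
  obtain ⟨C, hC0, hC, -, -⟩ := hφ.exists_bounds
  have hm : 0 ≤ M + |c| := (abs_nonneg _).trans (h.abs_relative_le c 0 0)
  filter_upwards [h.ae_isSlice, hshift] with s h1 h2 hs
  have hle := h.integral_abs_mul_le ha hu hs.le (by linarith : s ≤ s + η) (h1 hs)
    (h2 (by linarith)) (ψ := fun x => φ x (s + η)) (hφ.continuous_slice _)
    (hasCompactSupport_of_zero_off (z := 0) (R := N) fun x hx =>
      hN x _ (by rw [Real.dist_eq, sub_zero] at hx; exact hx.le))
    (fun x => hφ0 x _ (by linarith))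
  have hUm : Measurable fun x => |U x s - c| := ((h.measurable_slice s).sub_const c).abs
  have hb : ∀ {g : ℝ → ℝ} {K : ℝ}, (∀ x, |g x| ≤ K) →
      ∀ x, |(|U x s - c| * g x)| ≤ (M + |c|) * K := by
    intro g K hg x
    rw [abs_mul, abs_abs]
    exact mul_le_mul (h.abs_relative_le c x s) (hg x) (abs_nonneg _) hm
  have hTc := hu.continuous_flow ha hs.le (s + η)
  have i1 : Integrable fun x => |U x s - c| * φ (filippovFlow ha s x (s + η)) (s + η) := by
    refine integrable_of_bounded_of_support (R := N + Λ * η)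
      (hUm.mul ((hφ.continuous_slice _).comp hTc).measurable) (hb fun x => (hC _ _).1) fun x hx => ?_
    rw [hN _ _, mul_zero]
    have h3 := abs_filippovFlow_sub_le ha (by linarith : s ≤ s + η) x
    have h4 := abs_sub_abs_le_abs_sub x (filippovFlow ha s x (s + η))
    rw [abs_sub_comm] at h4
    rw [add_sub_cancel_left] at h3
    linarith
  have i2 : Integrable fun x => |U x s - c| * φ x s :=
    integrable_of_bounded_of_support (R := N) (hUm.mul (hφ.continuous_slice _).measurable)
      (hb fun x => (hC _ _).1) fun x hx => by rw [hN _ _ hx.le, mul_zero]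
  have i3 : Integrable fun x => |U x s - c| * D x s :=
    integrable_of_bounded_of_support (R := R) (hUm.mul (hD.comp measurable_prodMk_right))
      (hb fun x => hDK _ _) fun x hx => by rw [hDR _ _ hx, mul_zero]
  have hmono : ∫ x, |U x s - c| * φ (filippovFlow ha s x (s + η)) (s + η) ≤
      ∫ x, (|U x s - c| * φ x s + η * (|U x s - c| * D x s)) := by
    refine integral_mono i1 (i2.add (i3.const_mul η)) fun x => ?_
    have h3 := hinc s _ (filippovCurve_filippovFlow ha s x)
    rw [filippovFlow_of_le ha le_rfl] at h3
    have h4 := mul_le_mul_of_nonneg_left h3 (abs_nonneg (U x s - c))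
    simp only
    linarith
  rw [integral_add i2 (i3.const_mul η), integral_const_mul] at hmono
  unfold relativeMass
  linarith

/-- Shortly after the initial time, the mass exceeds the initial one at most linearly in time. -/
lemma WeakField.ae_relativeMass_le_init (h : WeakField f u₀ M U UL)
    (ha : CadlagField Λ (velocity f U c) (velocity f UL c))
    (hu : UniqueCurves (velocity f U c) (velocity f UL c) Λ) (hφ : IsTest φ)
    (hφ0 : ∀ x t, 0 ≤ t → 0 ≤ φ x t) :
    ∃ K, ∀ᵐ s, s ∈ Ioc (0 : ℝ) 1 → relativeMass U c φ s ≤ (∫ x, |u₀ x - c| * φ x 0) + K * s := by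
  obtain ⟨N, hN0, hN⟩ := hφ.exists_support
  obtain ⟨C, hC0, hC, hL, -⟩ := hφ.exists_bounds
  set I : ℝ → ℝ := (Icc (-(N + Λ)) (N + Λ)).indicator fun _ => C * (Λ + 1) with hI
  have hIm : Measurable I := measurable_const.indicator measurableSet_Icc
  have hI0 : ∀ x, |I x| ≤ C * (Λ + 1) := fun x => by
    have h1 : 0 ≤ C * ((Λ : ℝ) + 1) := by positivity
    rw [abs_of_nonneg (indicator_nonneg (fun _ _ => h1) x)]
    exact indicator_le_self' (fun _ _ => h1) x
  have hUm : Measurable fun x => |u₀ x - c| := (h.measurable_init.sub_const c).abs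
  have hm : ∀ x, |u₀ x - c| ≤ M + |c| := fun x =>
    (abs_sub _ _).trans (add_le_add_left (h.abs_init_le x) _)
  have hb : ∀ {g : ℝ → ℝ} {K : ℝ}, (∀ x, |g x| ≤ K) →
      ∀ x, |(|u₀ x - c| * g x)| ≤ (M + |c|) * K := by
    intro g K hg x
    rw [abs_mul, abs_abs]
    exact mul_le_mul (hm x) (hg x) (abs_nonneg _) ((abs_nonneg _).trans (hm x))
  refine ⟨∫ x, |u₀ x - c| * I x, ?_⟩
  filter_upwards [h.ae_isSlice] with s h1 hs
  have hle := h.integral_abs_mul_le ha hu le_rfl hs.1.le h.isSlice_init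
    (h1 hs.1) (ψ := fun x => φ x s) (hφ.continuous_slice _)
    (hasCompactSupport_of_zero_off (z := 0) (R := N) fun x hx =>
      (hN x _ (Or.inl (by rw [Real.dist_eq, sub_zero] at hx; exact hx.le))).1)
    (fun x => hφ0 x _ hs.1.le)
  have hTc := hu.continuous_flow ha le_rfl s
  have hfar : ∀ x, N + Λ < |x| → φ (filippovFlow ha 0 x s) s = 0 := by
    intro x hx
    refine (hN _ _ (Or.inl ?_)).1
    have h3 := abs_filippovFlow_sub_le ha hs.1.le x
    have h4 := abs_sub_abs_le_abs_sub x (filippovFlow ha 0 x s)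
    rw [abs_sub_comm] at h4
    have h5 : (Λ : ℝ) * (s - 0) ≤ Λ := mul_le_of_le_one_right Λ.2 (by linarith [hs.2])
    linarith
  have i1 : Integrable fun x => |u₀ x - c| * φ (filippovFlow ha 0 x s) s :=
    integrable_of_bounded_of_support (R := N + Λ)
      (hUm.mul ((hφ.continuous_slice _).comp hTc).measurable) (hb fun x => (hC _ _).1) fun x hx => by
        rw [hfar x hx, mul_zero]
  have i2 : Integrable fun x => |u₀ x - c| * φ x 0 :=
    integrable_of_bounded_of_support (R := N) (hUm.mul (hφ.continuous_slice _).measurable)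
      (hb fun x => (hC _ _).1) fun x hx => by rw [(hN _ _ (Or.inl hx.le)).1, mul_zero]
  have i3 : Integrable fun x => |u₀ x - c| * I x :=
    integrable_of_bounded_of_support (R := N + Λ) (hUm.mul hIm) (hb hI0) fun x hx => by
      rw [hI, indicator_of_notMem (notMem_Icc_neg_of_lt_abs hx), mul_zero]
  have hmono : ∫ x, |u₀ x - c| * φ (filippovFlow ha 0 x s) s ≤
      ∫ x, (|u₀ x - c| * φ x 0 + (|u₀ x - c| * I x) * s) := by
    refine integral_mono i1 (i2.add (i3.mul_const s)) fun x => ?_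
    have h3 : φ (filippovFlow ha 0 x s) s ≤ φ x 0 + I x * s := by
      by_cases hx : |x| ≤ N + Λ
      · rw [hI, indicator_of_mem (show x ∈ Icc (-(N + Λ)) (N + Λ) from abs_le.1 hx)]
        have h4 := (abs_le.1 (hL x 0 (filippovFlow ha 0 x s) s)).2
        have h5 := abs_filippovFlow_sub_le ha hs.1.le x
        rw [sub_zero] at h4 h5
        rw [abs_of_pos hs.1] at h4
        have h6 := mul_le_mul_of_nonneg_left (add_le_add_left h5 s) hC0
        linarith
      · have hx := not_le.1 hx
        rw [hfar x hx, (hN x 0 (Or.inl (by linarith [Λ.2]))).1, hI,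
          indicator_of_notMem (notMem_Icc_neg_of_lt_abs hx)]
        simp
    have h4 := mul_le_mul_of_nonneg_left h3 (abs_nonneg (u₀ x - c))
    simp only
    linarith
  rw [integral_add i2 (i3.mul_const s), integral_mul_const] at hmono
  unfold relativeMass
  linarith

end Contraction

/-- For a test function supported in `|t| < N`, only the times in `(0, N]` matter. -/
lemma weakForm_eq_of_support {φ : ℝ → ℝ → ℝ} {N : ℝ}
    (hN : ∀ x t, N ≤ |t| → timeDeriv φ x t = 0 ∧ spaceDeriv φ x t = 0) {η q u₀ : ℝ → ℝ}
    {U : ℝ → ℝ → ℝ} : weakForm η q u₀ U φ = (∫ t in Ioc 0 N, ∫ x,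
      (η (U x t) * timeDeriv φ x t + q (U x t) * spaceDeriv φ x t)) + ∫ x, η (u₀ x) * φ x 0 := by
  unfold weakForm
  congr 1
  rw [integral_Ici_eq_integral_Ioi]
  refine setIntegral_eq_of_subset_of_forall_sdiff_eq_zero measurableSet_Ioi
    (fun t ht => ht.1) fun t ht => ?_
  have ht' : N ≤ |t| := by
    by_contra! hlt
    exact ht.2 ⟨ht.1, ((le_abs_self t).trans hlt.le)⟩
  have h0 := fun x => hN x t ht'
  simp only [timeDeriv, spaceDeriv] at h0
  simp [(h0 _).1, (h0 _).2]

section Kruzkov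

variable {f u₀ : ℝ → ℝ} {M : ℝ} {U UL : ℝ → ℝ → ℝ} {Λ : ℝ≥0} {c : ℝ} {φ : ℝ → ℝ → ℝ}

/-- The discrete balance of the mass of `|u - c|` over time steps of length `η`. -/
lemma WeakField.le_integral_of_increment (h : WeakField f u₀ M U UL)
    (ha : CadlagField Λ (velocity f U c) (velocity f UL c))
    (hu : UniqueCurves (velocity f U c) (velocity f UL c) Λ) (hφ : IsTest φ)
    (hφ0 : ∀ x t, 0 ≤ t → 0 ≤ φ x t) {η N : ℝ} (hη : 0 < η) (hη1 : η ≤ 1) (hN0 : 0 < N)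
    (hN : ∀ x t, N ≤ |x| ∨ N ≤ |t| → φ x t = 0) {D : ℝ → ℝ → ℝ}
    (hD : Measurable (Function.uncurry D)) {K R : ℝ} (hDK : ∀ x t, |D x t| ≤ K)
    (hDR : ∀ x t, R < |x| → D x t = 0)
    (hinc : ∀ s X, FilippovCurve (velocity f U c) (velocity f UL c) Λ s X →
      φ (X (s + η)) (s + η) - φ (X s) s ≤ η * D (X s) s) {K₀ : ℝ}
    (hK₀ : ∀ᵐ s, s ∈ Ioc (0 : ℝ) 1 →
      relativeMass U c φ s ≤ (∫ x, |u₀ x - c| * φ x 0) + K₀ * s) :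
    -((∫ x, |u₀ x - c| * φ x 0) + |K₀| * η) ≤ ∫ s in Ioc 0 N, ∫ x, |U x s - c| * D x s := by
  set E := relativeMass U c φ with hE
  have hEm : Measurable E := h.measurable_relativeMass c hφ
  obtain ⟨C, hC0, hC, -, -⟩ := hφ.exists_bounds
  have hm : 0 ≤ M + |c| := (abs_nonneg _).trans (h.abs_relative_le c 0 0)
  have hind : ∀ {g : ℝ → ℝ → ℝ} {K R : ℝ}, (∀ x t, |g x t| ≤ K) → (∀ x t, R < |x| → g x t = 0) →
      ∀ s, |∫ x, |U x s - c| * g x s| ≤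
        ∫ x, (Icc (-R) R).indicator (fun _ : ℝ => (M + |c|) * K) x := by
    intro g K R hg hR s
    rw [← Real.norm_eq_abs]
    refine norm_integral_le_of_norm_le ((integrable_indicator_iff measurableSet_Icc).2
      (integrableOn_const measure_Icc_lt_top.ne)) (ae_of_all _ fun x => ?_)
    by_cases hx : |x| ≤ R
    · rw [indicator_of_mem (show x ∈ Icc (-R) R from _root_.abs_le.1 hx), Real.norm_eq_abs, abs_mul,
        abs_abs]
      exact mul_le_mul (h.abs_relative_le c x s) (hg x s) (abs_nonneg _) hm
    · rw [hR x s (not_le.1 hx), mul_zero, norm_zero]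
      exact indicator_nonneg (fun _ _ => mul_nonneg hm ((abs_nonneg _).trans (hg x s))) x
  have hEi : ∀ a b, IntervalIntegrable E volume a b := fun a b =>
    intervalIntegrable_of_abs_le hEm
      (hind (fun x t => (hC x t).1) fun x t hx => hN x t (Or.inl (le_of_lt hx))) a b
  have hGi : IntegrableOn (fun s => ∫ x, |U x s - c| * D x s) (Ioc 0 N) := by
    have h1 : Measurable fun p : ℝ × ℝ => |U p.2 p.1 - c| * D p.2 p.1 :=
      ((h.measurable.comp measurable_swap).sub_const c).abs.mul (hD.comp measurable_swap)
    exact Measure.integrableOn_of_bounded measure_Ioc_lt_top.ne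
      (h1.stronglyMeasurable.integral_prod_right' (ν := volume)).aestronglyMeasurable
      (ae_of_all _ (hind hDK hDR))
  have hstep := h.ae_relativeMass_sub_le ha hu hφ hφ0 hη (fun x t hx => hN x t (Or.inl hx)) hD hDK
    hDR hinc
  have hsi : IntervalIntegrable (fun s => E (s + η)) volume 0 N := by
    simpa using (hEi (0 + η) (N + η)).comp_add_right η
  have h1 : ∫ s in Ioc 0 N, (E (s + η) - E s) ≤ ∫ s in Ioc 0 N, η * ∫ x, |U x s - c| * D x s := by
    refine setIntegral_mono_on_ae ?_ (hGi.const_mul η) measurableSet_Ioc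
      (hstep.mono fun s hs hm => hs hm.1)
    exact ((hsi.sub (hEi 0 N)).1 : _)
  rw [integral_const_mul, ← intervalIntegral.integral_of_le hN0.le,
    intervalIntegral.integral_sub hsi (hEi 0 N),
    intervalIntegral.integral_comp_add_right (fun s => E s) η, zero_add] at h1
  have h2 : ∫ s in N..(N + η), E s = 0 := by
    apply intervalIntegral.integral_zero_ae
    refine ae_of_all _ fun s hs => ?_
    rw [uIoc_of_le (by linarith)] at hs
    have h3 : ∀ x, φ x s = 0 := fun x =>
      hN x s (Or.inr (hs.1.le.trans (le_abs_self s)))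
    simp [hE, relativeMass, h3]
  have h3 := intervalIntegral.integral_add_adjacent_intervals (hEi 0 N) (hEi N (N + η))
  have h4 := intervalIntegral.integral_add_adjacent_intervals (hEi 0 η) (hEi η (N + η))
  have h5 : ∫ s in (0 : ℝ)..η, E s ≤ ∫ _ in (0 : ℝ)..η, ((∫ x, |u₀ x - c| * φ x 0) + |K₀| * η) := by
    rw [intervalIntegral.integral_of_le hη.le, intervalIntegral.integral_of_le hη.le]
    refine setIntegral_mono_on_ae (hEi 0 η).1 (integrableOn_const measure_Ioc_lt_top.ne)
      measurableSet_Ioc ?_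
    filter_upwards [hK₀] with s hs hm
    refine (hs ⟨hm.1, hm.2.trans hη1⟩).trans (add_le_add_right ?_ _)
    exact (mul_le_mul_of_nonneg_right (le_abs_self K₀) hm.1.le).trans
      (mul_le_mul_of_nonneg_left hm.2 (abs_nonneg _))
  rw [intervalIntegral.integral_const, sub_zero, smul_eq_mul] at h5
  have h6 : η * -((∫ x, |u₀ x - c| * φ x 0) + |K₀| * η) ≤
      η * ∫ s in Ioc 0 N, ∫ x, |U x s - c| * D x s := by linarith
  exact le_of_mul_le_mul_left h6 hη

/-- If the Filippov curves of the field `a_c` are unique, the entropy inequality holds for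
`|u - c|`. -/
theorem WeakField.kruzkov_of_unique (h : WeakField f u₀ M U UL)
    (ha : CadlagField Λ (velocity f U c) (velocity f UL c))
    (hu : UniqueCurves (velocity f U c) (velocity f UL c) Λ) (hφ : IsTest φ)
    (hφ0 : ∀ x t, 0 ≤ t → 0 ≤ φ x t) :
    0 ≤ weakForm (kruzkov c) (kruzkovFlux f c) u₀ U φ := by
  obtain ⟨N, hN0, hN⟩ := hφ.exists_support
  obtain ⟨C, hC0, hC, -, hT⟩ := hφ.exists_bounds
  obtain ⟨K₀, hK₀⟩ := h.ae_relativeMass_le_init ha hu hφ hφ0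
  have hm : 0 ≤ M + |c| := (abs_nonneg _).trans (h.abs_relative_le c 0 0)
  set E₀ := ∫ x, |u₀ x - c| * φ x 0 with hE₀
  set a := velocity f U c with ha'
  have hpos : ∀ n : ℕ, 0 < 1 / ((n : ℝ) + 1) := fun n => by positivity
  have hle1 : ∀ n : ℕ, 1 / ((n : ℝ) + 1) ≤ 1 := fun n => by
    rw [div_le_one (by positivity)]; linarith [n.cast_nonneg (α := ℝ)]
  have hlim0 := tendsto_one_div_add_atTop_nhds_zero_nat (𝕜 := ℝ)
  set K₁ : ℝ := C * (Λ + 1) ^ 2 with hK₁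
  have hK₁0 : 0 ≤ K₁ := by positivity
  set I : ℝ → ℝ := (Icc (-(N + Λ)) (N + Λ)).indicator fun _ => K₁ with hI
  have hIm : Measurable I := measurable_const.indicator measurableSet_Icc
  have hI0 : ∀ x, |I x| ≤ K₁ := fun x => by
    rw [abs_of_nonneg (indicator_nonneg (fun _ _ => hK₁0) x)]
    exact indicator_le_self' (fun _ _ => hK₁0) x
  have hIfar : ∀ x, N + Λ < |x| → I x = 0 := fun x hx =>
    indicator_of_notMem (notMem_Icc_neg_of_lt_abs hx) _
  have hdfar : ∀ (A B : ℝ → ℝ → ℝ) x t, N + Λ < |x| → driftBound φ A B x t = 0 := fun A B x t hx =>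
    have := hN x t (Or.inl (by linarith [Λ.2]))
    driftBound_eq_zero this.2.1 this.2.2
  have hUm : Measurable (Function.uncurry fun x t => |U x t - c|) := (h.measurable.sub_const c).abs
  have hmul : ∀ {g K x t}, |g| ≤ K → |(|U x t - c| * g)| ≤ (M + |c|) * K := by
    intro g K x t hg
    rw [abs_mul, abs_abs]
    exact mul_le_mul (h.abs_relative_le c x t) hg (abs_nonneg _) hm
  -- The limit of vanishing time steps, for a fixed radius of the local suprema.
  have hδ : ∀ m : ℕ, -E₀ ≤ ∫ s in Ioc 0 N, ∫ x, |U x s - c| *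
      driftBound φ (localSup a (1 / ((m : ℝ) + 1)))
        (localSup (fun x t => -a x t) (1 / ((m : ℝ) + 1))) x s := by
    intro m
    set δ := 1 / ((m : ℝ) + 1) with hδ
    have hδ0 : 0 < δ := hpos m
    have hAm := ha.measurable_localSup δ
    have hBm := ha.neg.measurable_localSup δ
    have hAC := fun x t => ha.abs_localSup_le hδ0 x t
    have hBC := fun x t => ha.neg.abs_localSup_le hδ0 x t
    set A := localSup a δ
    set B := localSup (fun x t => -a x t) δ
    set D : ℕ → ℝ → ℝ → ℝ := fun n x s => driftBound φ (timeAverage A (1 / ((n : ℝ) + 1)))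
      (timeAverage B (1 / ((n : ℝ) + 1))) x s + 1 / ((n : ℝ) + 1) * I x with hD
    have hDm : ∀ n, Measurable (Function.uncurry (D n)) := fun n =>
      (measurable_driftBound hφ (measurable_timeAverage hAm _) (measurable_timeAverage hBm _)).add
        ((hIm.comp measurable_fst).const_mul _)
    have hDK : ∀ n x t, |D n x t| ≤ C + C * Λ + C * Λ + K₁ := by
      intro n x t
      refine (abs_add_le _ _).trans (add_le_add (abs_driftBound_le (fun x t => (hC x t).2.1)
        (fun x t => (hC x t).2.2) (abs_timeAverage_le hAC _) (abs_timeAverage_le hBC _) x t) ?_)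
      rw [abs_mul, abs_of_pos (hpos n)]
      calc _ ≤ 1 * K₁ := mul_le_mul (hle1 n) (hI0 x) (abs_nonneg _) zero_le_one
        _ = K₁ := one_mul _
    have hDR : ∀ n x t, N + Λ < |x| → D n x t = 0 := by
      intro n x t hx
      simp only [hD, hdfar _ _ x t hx, hIfar x hx, mul_zero, add_zero]
    have hlim : Tendsto (fun n => ∫ s in Ioc 0 N, ∫ x, |U x s - c| * D n x s) atTop
        (𝓝 (∫ s in Ioc 0 N, ∫ x, |U x s - c| * driftBound φ A B x s)) := by
      refine tendsto_integral_integral (R := N + Λ) (fun n => hUm.mul (hDm n))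
        (fun n x t => hmul (hDK n x t)) (fun n x t hx => by rw [hDR n x t hx, mul_zero]) ?_
      filter_upwards [ae_tendsto_timeAverage hAm hAC, ae_tendsto_timeAverage hBm hBC] with s h1 h2
      filter_upwards [h1, h2] with x h1 h2
      have h3 := tendsto_driftBound (φ := φ) h1 h2
      have h4 := hlim0.mul_const (I x)
      have h5 := (h3.add h4).const_mul |U x s - c|
      rw [zero_mul, add_zero] at h5
      exact h5
    have hlim' : Tendsto (fun n : ℕ => -(E₀ + |K₀| * (1 / ((n : ℝ) + 1)))) atTop (𝓝 (-E₀)) := by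
      simpa using ((hlim0.const_mul |K₀|).const_add E₀).neg
    have hsmall : ∀ᶠ n : ℕ in atTop, Λ * (1 / ((n : ℝ) + 1)) < δ := by
      have := hlim0.const_mul (Λ : ℝ)
      rw [mul_zero] at this
      exact this.eventually (gt_mem_nhds hδ0)
    refine le_of_tendsto_of_tendsto hlim' hlim ?_
    filter_upwards [hsmall] with n hn
    exact h.le_integral_of_increment ha hu hφ hφ0 (hpos n) (hle1 n) hN0
      (fun x t hx => (hN x t hx).1)
      (hDm n) (hDK n) (hDR n)
      (fun s X hX => hX.test_increment_le ha hN hC0 hT (hpos n) (hle1 n) hn) hK₀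
  -- The limit of vanishing radius.
  have hlim : Tendsto (fun m : ℕ => ∫ s in Ioc 0 N, ∫ x, |U x s - c| *
      driftBound φ (localSup a (1 / ((m : ℝ) + 1)))
        (localSup (fun x t => -a x t) (1 / ((m : ℝ) + 1))) x s) atTop
      (𝓝 (∫ s in Ioc 0 N, ∫ x, (kruzkov c (U x s) * timeDeriv φ x s +
        kruzkovFlux f c (U x s) * spaceDeriv φ x s))) := by
    refine tendsto_integral_integral (K := (M + |c|) * (C + C * Λ + C * Λ)) (R := N + Λ)
      (fun m => hUm.mul
        (measurable_driftBound hφ (ha.measurable_localSup _) (ha.neg.measurable_localSup _)))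
      (fun m x t => hmul (abs_driftBound_le (fun x t => (hC x t).2.1) (fun x t => (hC x t).2.2)
        (ha.abs_localSup_le (hpos m)) (ha.neg.abs_localSup_le (hpos m)) x t))
      (fun m x t hx => by rw [hdfar _ _ x t hx, mul_zero]) (ae_of_all _ fun s => ?_)
    filter_upwards [ha.ae_left_eq s] with x hx
    have h1 := ha.tendsto_localSup x s
    have h2 := ha.neg.tendsto_localSup x s
    rw [hx, max_self] at h1 h2
    have h3 := (tendsto_driftBound (φ := φ) h1 h2).const_mul |U x s - c|
    rw [driftBound_neg] at h3
    have e : kruzkov c (U x s) * timeDeriv φ x s + kruzkovFlux f c (U x s) * spaceDeriv φ x s =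
        |U x s - c| * (timeDeriv φ x s + a x s * spaceDeriv φ x s) := by
      simp only [kruzkov, kruzkovFlux, ha', velocity]; ring
    rw [e]
    exact h3
  have hfinal := ge_of_tendsto' hlim hδ
  rw [weakForm_eq_of_support fun x t ht => (hN x t (Or.inr ht)).2]
  change 0 ≤ _ + E₀
  linarith

end Kruzkov

/-! ### From the Kruzkov entropies to all convex entropies -/

/-- The sign of `w - k`, with the value `-1` at `w = k`, which is irrelevant as only primitives of
`jump k` are used. -/
noncomputable def jump (k w : ℝ) : ℝ := if k < w then 1 else -1

lemma measurable_jump (k : ℝ) : Measurable (jump k) :=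
  Measurable.ite measurableSet_Ioi measurable_const measurable_const

lemma abs_jump_le (k w : ℝ) : |jump k w| ≤ 1 := by
  unfold jump; split_ifs <;> simp

lemma intervalIntegrable_mul_of_abs_le {g F : ℝ → ℝ} (hg : Measurable g) {C : ℝ}
    (hC : ∀ v, |g v| ≤ C) (hF : Continuous F) (a b : ℝ) :
    IntervalIntegrable (fun w => g w * F w) volume a b :=
  (intervalIntegrable_of_abs_le hg hC a b).mul_continuousOn hF.continuousOn

lemma integral_jump_mul_deriv {f : ℝ → ℝ} (hf : ContDiff ℝ 1 f) (k v : ℝ) :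
    ∫ w in k..v, jump k w * deriv f w = |v - k| * secantSpeed f v k := by
  have hF : ∫ w in k..v, deriv f w = f v - f k :=
    intervalIntegral.integral_deriv_eq_sub (fun x _ => hf.differentiable (by simp) x)
      ((hf.continuous_deriv (by simp)).intervalIntegrable _ _)
  have hs := sub_mul_secantSpeed f v k
  rcases le_total k v with h | h
  · have e : ∫ w in k..v, jump k w * deriv f w = ∫ w in k..v, deriv f w := by
      apply intervalIntegral.integral_congr_ae
      refine ae_of_all _ fun w hw => ?_
      rw [uIoc_of_le h] at hw
      rw [jump, if_pos hw.1, one_mul]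
    rw [e, hF, abs_of_nonneg (sub_nonneg.2 h), hs]
  · have e : ∫ w in k..v, jump k w * deriv f w = ∫ w in k..v, -deriv f w := by
      apply intervalIntegral.integral_congr_ae
      refine ae_of_all _ fun w hw => ?_
      rw [uIoc_of_ge h] at hw
      rw [jump, if_neg (not_lt.2 hw.2), neg_one_mul]
    rw [e, intervalIntegral.integral_neg, hF, abs_of_nonpos (sub_nonpos.2 h), ← hs]
    ring

lemma kruzkovFlux_eq_integral {f : ℝ → ℝ} (hf : ContDiff ℝ 1 f) (k v : ℝ) :
    kruzkovFlux f k v = ∫ w in k..v, jump k w * deriv f w :=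
  (integral_jump_mul_deriv hf k v).symm

/-- The Kruzkov flux is locally absolutely continuous because it is a primitive of `jump k * f'`. -/
lemma isEntropyPair_kruzkov {f : ℝ → ℝ} (hf : ContDiff ℝ 1 f) (k : ℝ) :
    IsEntropyPair f (kruzkov k) (kruzkovFlux f k) := by
  refine ⟨?_, fun a b => ?_, ?_⟩
  · have h2 : ConvexOn ℝ univ fun v : ℝ => ‖v - k‖ := by
      have := (convexOn_univ_norm (E := ℝ)).translate_left (-k)
      simpa [Function.comp_def, sub_eq_add_neg] using this
    exact h2
  · have hi := fun a b => intervalIntegrable_mul_of_abs_le (measurable_jump k) (abs_jump_le k)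
      (hf.continuous_deriv (by simp)) a b
    have h1 := (hi (min k (min a b)) (max k (max a b))).absolutelyContinuousOnInterval_intervalIntegral
      (c := k) ?_
    · have h2 := h1.mono (c := a) (d := b) ?_
      · have e : kruzkovFlux f k = fun v => ∫ w in k..v, jump k w * deriv f w :=
          funext (kruzkovFlux_eq_integral hf k)
        rwa [e]
      · rw [uIcc_of_le (show min k (min a b) ≤ max k (max a b) from
          (min_le_left _ _).trans (le_max_left _ _))]
        exact Icc_subset_Icc (min_le_right _ _) (le_max_right _ _)
    · rw [uIcc_of_le ((min_le_left _ _).trans (le_max_left _ _))]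
      exact ⟨min_le_left _ _, le_max_left _ _⟩
  · have hne : ∀ᵐ v : ℝ, v ≠ k := by rw [ae_iff]; simp
    filter_upwards [hne] with v hv
    have hd := (hf.differentiable (by simp) v).hasDerivAt
    rcases lt_or_gt_of_ne hv with h | h
    · have e1 : kruzkov k =ᶠ[𝓝 v] fun w => k - w := by
        filter_upwards [Iio_mem_nhds h] with w hw
        rw [kruzkov, abs_of_neg (sub_neg.2 hw), neg_sub]
      have e2 : kruzkovFlux f k =ᶠ[𝓝 v] fun w => f k - f w := by
        filter_upwards [Iio_mem_nhds h] with w hw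
        rw [kruzkovFlux, abs_of_neg (sub_neg.2 hw), neg_mul, sub_mul_secantSpeed, neg_sub]
      have h1 : deriv (kruzkov k) v = -1 := by
        rw [e1.deriv_eq]; exact ((hasDerivAt_id v).const_sub k).deriv
      rw [h1]
      exact ((hd.const_sub (f k)).congr_deriv (by ring)).congr_of_eventuallyEq e2
    · have e1 : kruzkov k =ᶠ[𝓝 v] fun w => w - k := by
        filter_upwards [Ioi_mem_nhds h] with w hw
        rw [kruzkov, abs_of_pos (sub_pos.2 hw)]
      have e2 : kruzkovFlux f k =ᶠ[𝓝 v] fun w => f w - f k := by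
        filter_upwards [Ioi_mem_nhds h] with w hw
        rw [kruzkovFlux, abs_of_pos (sub_pos.2 hw), sub_mul_secantSpeed]
      have h1 : deriv (kruzkov k) v = 1 := by
        rw [e1.deriv_eq]; exact ((hasDerivAt_id v).sub_const k).deriv
      rw [h1]
      exact ((hd.sub_const (f k)).congr_deriv (by ring)).congr_of_eventuallyEq e2

section WeakForm

variable {f u₀ : ℝ → ℝ} {M : ℝ} {U UL : ℝ → ℝ → ℝ} {φ : ℝ → ℝ → ℝ}

lemma weakForm_const_mul (r : ℝ) (η q u₀ : ℝ → ℝ) (U φ : ℝ → ℝ → ℝ) :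
    weakForm (fun v => r * η v) (fun v => r * q v) u₀ U φ = r * weakForm η q u₀ U φ := by
  unfold weakForm
  rw [mul_add, ← integral_const_mul, ← integral_const_mul]
  congr 1
  · congr 1
    funext t
    rw [← integral_const_mul]
    congr 1
    funext x
    ring
  · congr 1
    funext x
    ring

/-- Only the values of the entropy pair on the range of the solution matter. -/
lemma WeakField.weakForm_congr_range (h : WeakField f u₀ M U UL) {η η' q q' : ℝ → ℝ}
    (h1 : ∀ v, |v| ≤ M → η v = η' v) (h2 : ∀ v, |v| ≤ M → q v = q' v) :
    weakForm η q u₀ U φ = weakForm η' q' u₀ U φ := by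
  unfold weakForm
  simp only [h1 _ (h.abs_le _ _), h2 _ (h.abs_le _ _), h1 _ (h.abs_init_le _)]

lemma WeakField.integrable_weak (h : WeakField f u₀ M U UL) {η q : ℝ → ℝ} (hη : Continuous η)
    (hq : Continuous q) (hφ : IsTest φ) :
    (∀ t, Integrable fun x => η (U x t) * timeDeriv φ x t + q (U x t) * spaceDeriv φ x t) ∧
    (Integrable fun t => ∫ x, (η (U x t) * timeDeriv φ x t + q (U x t) * spaceDeriv φ x t)) ∧
    Integrable fun x => η (u₀ x) * φ x 0 := by
  obtain ⟨N, hN0, hN⟩ := hφ.exists_support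
  obtain ⟨C, hC0, hC, -, -⟩ := hφ.exists_bounds
  obtain ⟨C₁, hC₁0, hC₁⟩ := exists_abs_le_of_continuous hη M
  obtain ⟨C₂, hC₂0, hC₂⟩ := exists_abs_le_of_continuous hq M
  have hm : Measurable (Function.uncurry fun x t =>
      η (U x t) * timeDeriv φ x t + q (U x t) * spaceDeriv φ x t) :=
    ((hη.measurable.comp h.measurable).mul hφ.continuous_timeDeriv.measurable).add
      ((hq.measurable.comp h.measurable).mul hφ.continuous_spaceDeriv.measurable)
  have hb : ∀ x t, |η (U x t) * timeDeriv φ x t + q (U x t) * spaceDeriv φ x t| ≤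
      C₁ * C + C₂ * C := by
    intro x t
    refine (abs_add_le _ _).trans (add_le_add ?_ ?_) <;> rw [abs_mul]
    · exact mul_le_mul (hC₁ _ (h.abs_le x t)) (hC x t).2.1 (abs_nonneg _) hC₁0
    · exact mul_le_mul (hC₂ _ (h.abs_le x t)) (hC x t).2.2 (abs_nonneg _) hC₂0
  have hz : ∀ x t, N ≤ |x| ∨ N ≤ |t| →
      η (U x t) * timeDeriv φ x t + q (U x t) * spaceDeriv φ x t = 0 := fun x t hx => by
    rw [(hN x t hx).2.1, (hN x t hx).2.2, mul_zero, mul_zero, add_zero]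
  have hI : Integrable ((Icc (-N) N).indicator fun _ : ℝ => C₁ * C + C₂ * C) :=
    (integrable_indicator_iff measurableSet_Icc).2 (integrableOn_const measure_Icc_lt_top.ne)
  refine ⟨fun t => integrable_of_bounded_of_support (hm.comp measurable_prodMk_right)
    (fun x => hb x t) (fun x hx => hz x t (Or.inl (le_of_lt hx))),
    integrable_of_bounded_of_support (R := N)
      (K := ∫ x, (Icc (-N) N).indicator (fun _ : ℝ => C₁ * C + C₂ * C) x) ?_ (fun t => ?_)
      fun t ht => ?_,
    integrable_of_bounded_of_support (K := C₁ * C)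
      ((hη.measurable.comp h.measurable_init).mul (hφ.continuous_slice 0).measurable) (fun x => ?_)
      fun x hx => by rw [(hN x 0 (Or.inl (le_of_lt hx))).1, mul_zero]⟩
  · have h1 := hm.comp measurable_swap
    exact (h1.stronglyMeasurable.integral_prod_right' (ν := volume)).measurable
  · rw [← Real.norm_eq_abs]
    refine norm_integral_le_of_norm_le hI (ae_of_all _ fun x => ?_)
    by_cases hx : |x| ≤ N
    · rw [indicator_of_mem (show x ∈ Icc (-N) N from _root_.abs_le.1 hx), Real.norm_eq_abs]
      exact hb x t
    · rw [hz x t (Or.inl (not_le.1 hx).le), norm_zero]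
      exact indicator_nonneg (fun _ _ => by positivity) x
  · simp only [hz _ t (Or.inr ht.le), integral_zero]
  · rw [abs_mul]
    exact mul_le_mul (hC₁ _ (h.abs_init_le x)) (hC x 0).1 (abs_nonneg _) hC₁0

lemma WeakField.weakForm_add (h : WeakField f u₀ M U UL) {η₁ η₂ q₁ q₂ : ℝ → ℝ}
    (hη₁ : Continuous η₁) (hη₂ : Continuous η₂) (hq₁ : Continuous q₁) (hq₂ : Continuous q₂)
    (hφ : IsTest φ) : weakForm (fun v => η₁ v + η₂ v) (fun v => q₁ v + q₂ v) u₀ U φ =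
      weakForm η₁ q₁ u₀ U φ + weakForm η₂ q₂ u₀ U φ := by
  obtain ⟨a1, a2, a3⟩ := h.integrable_weak hη₁ hq₁ hφ
  obtain ⟨b1, b2, b3⟩ := h.integrable_weak hη₂ hq₂ hφ
  have e1 : ∀ t, ∫ x, ((η₁ (U x t) + η₂ (U x t)) * timeDeriv φ x t +
      (q₁ (U x t) + q₂ (U x t)) * spaceDeriv φ x t) =
      (∫ x, (η₁ (U x t) * timeDeriv φ x t + q₁ (U x t) * spaceDeriv φ x t)) +
      ∫ x, (η₂ (U x t) * timeDeriv φ x t + q₂ (U x t) * spaceDeriv φ x t) := by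
    intro t
    rw [← integral_add (a1 t) (b1 t)]
    congr 1
    funext x
    ring
  have e2 : ∫ x, (η₁ (u₀ x) + η₂ (u₀ x)) * φ x 0 =
      (∫ x, η₁ (u₀ x) * φ x 0) + ∫ x, η₂ (u₀ x) * φ x 0 := by
    rw [← integral_add a3 b3]
    congr 1
    funext x
    ring
  change (∫ t in Ici (0 : ℝ), ∫ x, ((η₁ (U x t) + η₂ (U x t)) * timeDeriv φ x t +
      (q₁ (U x t) + q₂ (U x t)) * spaceDeriv φ x t)) + ∫ x, (η₁ (u₀ x) + η₂ (u₀ x)) * φ x 0 =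
      ((∫ t in Ici (0 : ℝ), ∫ x, (η₁ (U x t) * timeDeriv φ x t + q₁ (U x t) * spaceDeriv φ x t)) +
        ∫ x, η₁ (u₀ x) * φ x 0) +
      ((∫ t in Ici (0 : ℝ), ∫ x, (η₂ (U x t) * timeDeriv φ x t + q₂ (U x t) * spaceDeriv φ x t)) +
        ∫ x, η₂ (u₀ x) * φ x 0)
  simp only [e1]
  rw [e2, integral_add a2.integrableOn b2.integrableOn]
  ring

lemma IsTest.hasCompactSupport_time (hφ : IsTest φ) (x : ℝ) : HasCompactSupport fun t => φ x t := by
  obtain ⟨N, -, hN⟩ := hφ.exists_support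
  exact hasCompactSupport_of_zero_off (z := 0) (R := N) fun t ht =>
    (hN x t (Or.inr (by rw [Real.dist_eq, sub_zero] at ht; exact ht.le))).1

/-- Constants solve the conservation law. -/
lemma weakForm_const (a b : ℝ) (hφ : IsTest φ) :
    weakForm (fun _ => a) (fun _ => b) u₀ U φ = 0 := by
  obtain ⟨N, hN0, hN⟩ := hφ.exists_support
  have hdx : ∀ x t, HasDerivAt (fun y => φ y t) (spaceDeriv φ x t) x := fun x t =>
    (((hφ.1.differentiable (by simp)).comp (by fun_prop :
      Differentiable ℝ fun y : ℝ => (y, t))) x).hasDerivAt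
  have hdt : ∀ x t, HasDerivAt (fun τ => φ x τ) (timeDeriv φ x t) t := fun x t =>
    (((hφ.1.differentiable (by simp)).comp (by fun_prop :
      Differentiable ℝ fun τ : ℝ => (x, τ))) t).hasDerivAt
  have ct : Continuous (Function.uncurry (timeDeriv φ)) := hφ.continuous_timeDeriv
  have cx : Continuous (Function.uncurry (spaceDeriv φ)) := hφ.continuous_spaceDeriv
  have hcs : HasCompactSupport (Function.uncurry (timeDeriv φ)) := by
    apply hasCompactSupport_of_zero_off (z := (0, 0)) (R := N)
    rintro ⟨x, t⟩ hxt
    rw [Prod.dist_eq, Real.dist_eq, Real.dist_eq, sub_zero, sub_zero, lt_max_iff] at hxt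
    exact (hN x t (hxt.imp le_of_lt le_of_lt)).2.1
  have i1 : ∀ t, Integrable fun x => timeDeriv φ x t := fun t =>
    (ct.comp (by fun_prop : Continuous fun x : ℝ => (x, t))).integrable_of_hasCompactSupport
      (hasCompactSupport_of_zero_off (z := 0) (R := N) fun x hx =>
        (hN x t (Or.inl (by rw [Real.dist_eq, sub_zero] at hx; exact hx.le))).2.1)
  have i2 : ∀ t, Integrable fun x => spaceDeriv φ x t := fun t =>
    (cx.comp (by fun_prop : Continuous fun x : ℝ => (x, t))).integrable_of_hasCompactSupport
      (hasCompactSupport_of_zero_off (z := 0) (R := N) fun x hx =>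
        (hN x t (Or.inl (by rw [Real.dist_eq, sub_zero] at hx; exact hx.le))).2.2)
  have z1 : ∀ t, ∫ x, spaceDeriv φ x t = 0 := fun t =>
    integral_eq_zero_of_hasDerivAt_of_integrable (fun x => hdx x t) (i2 t)
      ((hφ.continuous_slice t).integrable_of_hasCompactSupport
        (hasCompactSupport_of_zero_off (z := 0) (R := N) fun x hx =>
          (hN x t (Or.inl (by rw [Real.dist_eq, sub_zero] at hx; exact hx.le))).1))
  have z2 : ∀ x, ∫ t in Ici (0 : ℝ), timeDeriv φ x t = -φ x 0 := by
    intro x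
    rw [integral_Ici_eq_integral_Ioi]
    have h1 := (hφ.hasCompactSupport_time x).integral_Ioi_deriv_eq
      (hφ.1.comp (by fun_prop : ContDiff ℝ ∞ fun t : ℝ => (x, t)) |>.of_le (by simp)) 0
    exact h1
  have hsw : ∫ t in Ici (0 : ℝ), ∫ x, timeDeriv φ x t =
      ∫ x, ∫ t in Ici (0 : ℝ), timeDeriv φ x t := by
    have hi : Integrable (Function.uncurry (timeDeriv φ))
        (volume.prod (volume.restrict (Ici 0))) := by
      have := ct.integrable_of_hasCompactSupport (μ := volume.prod volume) hcs
      refine this.mono_measure ?_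
      exact Measure.prod_mono le_rfl Measure.restrict_le_self
    exact (integral_integral_swap hi).symm
  unfold weakForm
  change (∫ t in Ici (0 : ℝ), ∫ x, (a * timeDeriv φ x t + b * spaceDeriv φ x t)) +
    ∫ x, a * φ x 0 = 0
  have e : ∀ t, ∫ x, (a * timeDeriv φ x t + b * spaceDeriv φ x t) = a * ∫ x, timeDeriv φ x t := by
    intro t
    rw [integral_add ((i1 t).const_mul a) ((i2 t).const_mul b), integral_const_mul,
      integral_const_mul, z1, mul_zero, add_zero]
  simp only [e]
  rw [integral_const_mul, hsw]
  simp only [z2]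
  rw [integral_neg, integral_const_mul]
  ring

end WeakForm

/-- The primitive of `g` vanishing at `0`. -/
noncomputable def primitive (g : ℝ → ℝ) (v : ℝ) : ℝ := ∫ w in (0 : ℝ)..v, g w

section Admissible

variable {f u₀ : ℝ → ℝ} {M : ℝ} {U UL : ℝ → ℝ → ℝ} {φ : ℝ → ℝ → ℝ} {g g' : ℝ → ℝ}

/-- `g` is a bounded measurable function such that the entropy inequality holds for the entropy with
derivative `g`. -/
structure Admissible (f u₀ : ℝ → ℝ) (U : ℝ → ℝ → ℝ) (g : ℝ → ℝ) : Prop where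
  measurable : Measurable g
  exists_bound : ∃ C, ∀ v, |g v| ≤ C
  nonneg : ∀ φ, IsTest φ → (∀ x t, 0 ≤ t → 0 ≤ φ x t) →
    0 ≤ weakForm (primitive g) (primitive fun v => g v * deriv f v) u₀ U φ

lemma continuous_primitive (hg : ∀ a b, IntervalIntegrable g volume a b) :
    Continuous (primitive g) :=
  intervalIntegral.continuous_primitive hg 0

lemma primitive_congr (h : ∀ᵐ w, |w| ≤ M → g w = g' w) {v : ℝ} (hv : |v| ≤ M) :
    primitive g v = primitive g' v := by
  apply intervalIntegral.integral_congr_ae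
  filter_upwards [h] with w hw hm
  refine hw (abs_le.2 ?_)
  have h1 := abs_le.1 hv
  have hM : 0 ≤ M := (abs_nonneg v).trans hv
  rcases le_total 0 v with h0 | h0
  · rw [uIoc_of_le h0] at hm
    exact ⟨by linarith [hm.1], hm.2.trans h1.2⟩
  · rw [uIoc_of_ge h0] at hm
    exact ⟨h1.1.trans hm.1.le, hm.2.trans hM⟩

lemma continuous_entropy_pair (hf : ContDiff ℝ 1 f) (hg : Measurable g) {C : ℝ}
    (hC : ∀ v, |g v| ≤ C) :
    Continuous (primitive g) ∧ Continuous (primitive fun v => g v * deriv f v) :=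
  ⟨continuous_primitive fun a b => intervalIntegrable_of_abs_le hg hC a b,
    continuous_primitive fun a b => intervalIntegrable_mul_of_abs_le hg hC
      (hf.continuous_deriv (by simp)) a b⟩

lemma Admissible.add (h : WeakField f u₀ M U UL) (hf : ContDiff ℝ 1 f)
    (h1 : Admissible f u₀ U g) (h2 : Admissible f u₀ U g') : Admissible f u₀ U (g + g') := by
  obtain ⟨C, hC⟩ := h1.exists_bound
  obtain ⟨C', hC'⟩ := h2.exists_bound
  refine ⟨h1.measurable.add h2.measurable,
    ⟨C + C', fun v => (abs_add_le _ _).trans (add_le_add (hC v) (hC' v))⟩, fun φ hφ hφ0 => ?_⟩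
  have c1 := continuous_entropy_pair hf h1.measurable hC
  have c2 := continuous_entropy_pair hf h2.measurable hC'
  have hf' : Continuous (deriv f) := hf.continuous_deriv (by simp)
  have e1 : primitive (g + g') = fun v => primitive g v + primitive g' v := by
    funext v
    exact intervalIntegral.integral_add (intervalIntegrable_of_abs_le h1.measurable hC _ _)
      (intervalIntegrable_of_abs_le h2.measurable hC' _ _)
  have e2 : (primitive fun v => (g + g') v * deriv f v) =
      fun v => primitive (fun v => g v * deriv f v) v +
        primitive (fun v => g' v * deriv f v) v := by
    funext v
    simp only [primitive, Pi.add_apply, add_mul]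
    exact intervalIntegral.integral_add
      (intervalIntegrable_mul_of_abs_le h1.measurable hC hf' _ _)
      (intervalIntegrable_mul_of_abs_le h2.measurable hC' hf' _ _)
  rw [e1, e2, h.weakForm_add c1.1 c2.1 c1.2 c2.2 hφ]
  exact add_nonneg (h1.nonneg φ hφ hφ0) (h2.nonneg φ hφ hφ0)

lemma Admissible.const_mul (h1 : Admissible f u₀ U g) {r : ℝ} (hr : 0 ≤ r) :
    Admissible f u₀ U fun v => r * g v := by
  obtain ⟨C, hC⟩ := h1.exists_bound
  refine ⟨h1.measurable.const_mul r, ⟨r * C, fun v => ?_⟩, fun φ hφ hφ0 => ?_⟩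
  · rw [abs_mul, abs_of_nonneg hr]
    exact mul_le_mul_of_nonneg_left (hC v) hr
  · have e1 : (primitive fun v => r * g v) = fun v => r * primitive g v :=
      funext fun v => intervalIntegral.integral_const_mul _ _
    have e2 : (primitive fun v => r * g v * deriv f v) =
        fun v => r * primitive (fun v => g v * deriv f v) v := by
      funext v
      simp only [primitive, mul_assoc]
      exact intervalIntegral.integral_const_mul _ _
    rw [e1, e2, weakForm_const_mul]
    exact mul_nonneg hr (h1.nonneg φ hφ hφ0)

lemma Admissible.congr (h : WeakField f u₀ M U UL) (h1 : Admissible f u₀ U g) (hg' : Measurable g')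
    (hb : ∃ C, ∀ v, |g' v| ≤ C) (he : ∀ᵐ v, |v| ≤ M → g v = g' v) : Admissible f u₀ U g' := by
  refine ⟨hg', hb, fun φ hφ hφ0 => ?_⟩
  have := h1.nonneg φ hφ hφ0
  rwa [h.weakForm_congr_range (fun v hv => primitive_congr he hv)
    (fun v hv => primitive_congr (he.mono fun w hw hm => by rw [hw hm]) hv)] at this

lemma weakForm_add_const (h : WeakField f u₀ M U UL) {η q : ℝ → ℝ} (hη : Continuous η)
    (hq : Continuous q) (a b : ℝ) (hφ : IsTest φ) :
    weakForm (fun v => η v + a) (fun v => q v + b) u₀ U φ = weakForm η q u₀ U φ := by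
  rw [h.weakForm_add hη continuous_const hq continuous_const hφ, weakForm_const a b hφ, add_zero]

lemma admissible_const (h : WeakField f u₀ M U UL) (hf : ContDiff ℝ 1 f) (r : ℝ) :
    Admissible f u₀ U fun _ => r := by
  refine ⟨measurable_const, ⟨|r|, fun _ => le_rfl⟩, fun φ hφ _ => ?_⟩
  have e1 : (primitive fun _ => r) = fun v => r * v + 0 := by
    funext v
    simp [primitive, mul_comm]
  have e2 : (primitive fun v => r * deriv f v) = fun v => r * f v + -(r * f 0) := by
    funext v
    have : ∫ w in (0 : ℝ)..v, deriv f w = f v - f 0 :=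
      intervalIntegral.integral_deriv_eq_sub (fun x _ => hf.differentiable (by simp) x)
        ((hf.continuous_deriv (by simp)).intervalIntegrable _ _)
    rw [primitive, intervalIntegral.integral_const_mul, this]
    ring
  rw [e1, e2, weakForm_add_const h (η := fun v => r * v) (q := fun v => r * f v) (by fun_prop)
    (continuous_const.mul hf.continuous) _ _ hφ,
    weakForm_const_mul r (fun v => v) f]
  exact (mul_eq_zero_of_right r (h.weak φ hφ)).ge

lemma admissible_jump (h : WeakField f u₀ M U UL) (hf : ContDiff ℝ 1 f)
    (hK : KruzkovInequalities f u₀ U) (k : ℝ) : Admissible f u₀ U (jump k) := by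
  refine ⟨measurable_jump k, ⟨1, abs_jump_le k⟩, fun φ hφ hφ0 => ?_⟩
  have hf' : Continuous (deriv f) := hf.continuous_deriv (by simp)
  have hsplit : ∀ {F : ℝ → ℝ}, Continuous F → ∀ v,
      (primitive fun w => jump k w * F w) v =
        (∫ w in k..v, jump k w * F w) + -∫ w in k..0, jump k w * F w := by
    intro F hF v
    have hi := intervalIntegrable_mul_of_abs_le (measurable_jump k) (abs_jump_le k) hF
    rw [← sub_eq_add_neg, intervalIntegral.integral_interval_sub_left (hi k v) (hi k 0)]
    rfl
  have e1 : primitive (jump k) = fun v => kruzkov k v + -kruzkov k 0 := by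
    funext v
    have h1 := hsplit (F := fun _ => 1) continuous_const v
    have h2 := fun v => integral_jump_mul_deriv contDiff_id k v
    have h3 : ∀ v k : ℝ, secantSpeed id v k = 1 := fun v k => by
      unfold secantSpeed
      split_ifs with hvk
      · exact deriv_id k
      · exact div_self (sub_ne_zero.2 hvk)
    simp only [deriv_id, h3, mul_one] at h1 h2
    rw [h1, h2, h2]
    rfl
  have e2 : (primitive fun v => jump k v * deriv f v) =
      fun v => kruzkovFlux f k v + -kruzkovFlux f k 0 := by
    funext v
    rw [hsplit hf', kruzkovFlux_eq_integral hf, kruzkovFlux_eq_integral hf]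
  rw [e1, e2, weakForm_add_const h (continuous_kruzkov k) (continuous_kruzkovFlux hf k) _ _ hφ]
  exact hK k φ hφ hφ0

open Classical in
lemma admissible_upperSet (h : WeakField f u₀ M U UL) (hf : ContDiff ℝ 1 f)
    (hK : KruzkovInequalities f u₀ U) {S : Set ℝ} (hS : IsUpperSet S) (hSm : MeasurableSet S) :
    Admissible f u₀ U fun v => if v ∈ S then 1 else -1 := by
  by_cases hne : S.Nonempty
  · by_cases hb : BddBelow S
    · refine (admissible_jump h hf hK (sInf S)).congr h
        (Measurable.ite hSm measurable_const measurable_const)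
        ⟨1, fun v => by split_ifs <;> simp⟩ ?_
      have hn : ∀ᵐ v : ℝ, v ≠ sInf S := by rw [ae_iff]; simp
      filter_upwards [hn] with v hv _
      rcases lt_or_gt_of_ne hv with hlt | hlt
      · rw [jump, if_neg (not_lt.2 hlt.le), if_neg fun hm => not_le.2 hlt (csInf_le hb hm)]
      · obtain ⟨w, hw, hwv⟩ := exists_lt_of_csInf_lt hne hlt
        rw [jump, if_pos hlt, if_pos (hS hwv.le hw)]
    · have hall : ∀ v, v ∈ S := by
        intro v
        rw [not_bddBelow_iff] at hb
        obtain ⟨w, hw, hwv⟩ := hb v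
        exact hS hwv.le hw
      simpa only [hall, if_true] using admissible_const h hf 1
  · rw [not_nonempty_iff_eq_empty] at hne
    simpa only [hne, mem_empty_iff_false, if_false] using admissible_const h hf (-1)

/-- The integer part as a sum of signs over its levels. -/
lemma floor_eq_sum {y : ℝ} {L : ℕ} (hy : |y| ≤ L) :
    (⌊y⌋ : ℝ) = 2⁻¹ * ∑ j ∈ Finset.Ioc (-(L : ℤ)) L, if (j : ℝ) ≤ y then 1 else -1 := by
  have h1 : -(L : ℤ) ≤ ⌊y⌋ := Int.le_floor.2 (by push_cast; exact (abs_le.1 hy).1)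
  have h2 : ⌊y⌋ ≤ (L : ℤ) := by
    have : (⌊y⌋ : ℝ) ≤ (L : ℤ) := (Int.floor_le y).trans (by push_cast; exact (abs_le.1 hy).2)
    exact_mod_cast this
  have e : ∀ j : ℤ, (j : ℝ) ≤ y ↔ j ≤ ⌊y⌋ := fun j => Int.le_floor.symm
  simp only [e]
  rw [Finset.sum_ite, Finset.sum_const, Finset.sum_const]
  have f1 : (Finset.Ioc (-(L : ℤ)) L).filter (fun j => j ≤ ⌊y⌋) = Finset.Ioc (-(L : ℤ)) ⌊y⌋ := by
    ext j; simp only [Finset.mem_filter, Finset.mem_Ioc]; omega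
  have f2 : (Finset.Ioc (-(L : ℤ)) L).filter (fun j => ¬ j ≤ ⌊y⌋) = Finset.Ioc ⌊y⌋ (L : ℤ) := by
    ext j; simp only [Finset.mem_filter, Finset.mem_Ioc]; omega
  have c1 : (((Finset.Ioc (-(L : ℤ)) ⌊y⌋).card : ℤ) : ℝ) = ⌊y⌋ + L := by
    rw [Int.card_Ioc_of_le _ _ h1]; push_cast; ring
  have c2 : (((Finset.Ioc ⌊y⌋ (L : ℤ)).card : ℤ) : ℝ) = L - ⌊y⌋ := by
    rw [Int.card_Ioc_of_le _ _ h2]; push_cast; ring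
  rw [f1, f2, nsmul_eq_mul, nsmul_eq_mul]
  rw [Int.cast_natCast] at c1 c2
  rw [c1, c2]
  ring

lemma admissible_floor (h : WeakField f u₀ M U UL) (hf : ContDiff ℝ 1 f)
    (hK : KruzkovInequalities f u₀ U) (hg : Monotone g) {C : ℝ} (hC : ∀ v, |g v| ≤ C) (n : ℕ) :
    Admissible f u₀ U fun v => ((n : ℝ) + 1)⁻¹ * ⌊((n : ℝ) + 1) * g v⌋ := by
  classical
  obtain ⟨L, hL⟩ := exists_nat_ge (((n : ℝ) + 1) * C)
  have hn : (0 : ℝ) < (n : ℝ) + 1 := by positivity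
  have e : (fun v => ((n : ℝ) + 1)⁻¹ * ⌊((n : ℝ) + 1) * g v⌋) =
      fun v => (((n : ℝ) + 1)⁻¹ * 2⁻¹) * (∑ j ∈ Finset.Ioc (-(L : ℤ)) L, fun v =>
        if v ∈ {v | (j : ℝ) ≤ ((n : ℝ) + 1) * g v} then (1 : ℝ) else -1) v := by
    funext v
    rw [floor_eq_sum (L := L), mul_assoc, Finset.sum_apply]
    · simp only [mem_ofPred_eq]
    · rw [abs_mul, abs_of_pos hn]
      exact (mul_le_mul_of_nonneg_left (hC v) hn.le).trans hL
  rw [e]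
  refine Admissible.const_mul ?_ (by positivity)
  refine Finset.sum_induction _ (Admissible f u₀ U) (fun _ _ h1 h2 => h1.add h hf h2)
    (admissible_const h hf 0) fun j _ => ?_
  refine admissible_upperSet h hf hK (fun v w hvw hv => ?_)
    (measurableSet_le measurable_const (hg.measurable.const_mul _))
  have hv : (j : ℝ) ≤ ((n : ℝ) + 1) * g v := hv
  exact hv.trans (mul_le_mul_of_nonneg_left (hg hvw) hn.le)

lemma tendsto_weakForm (h : WeakField f u₀ M U UL) (hφ : IsTest φ) {ηn qn : ℕ → ℝ → ℝ}
    {η q : ℝ → ℝ} (hηn : ∀ n, Continuous (ηn n)) (hqn : ∀ n, Continuous (qn n)) {C : ℝ}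
    (hη : ∀ n v, |v| ≤ M → |ηn n v| ≤ C) (hq : ∀ n v, |v| ≤ M → |qn n v| ≤ C)
    (hηlim : ∀ v, |v| ≤ M → Tendsto (fun n => ηn n v) atTop (𝓝 (η v)))
    (hqlim : ∀ v, |v| ≤ M → Tendsto (fun n => qn n v) atTop (𝓝 (q v))) :
    Tendsto (fun n => weakForm (ηn n) (qn n) u₀ U φ) atTop (𝓝 (weakForm η q u₀ U φ)) := by
  obtain ⟨N, hN0, hN⟩ := hφ.exists_support
  obtain ⟨K, hK0, hK, -, -⟩ := hφ.exists_bounds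
  have hC0 : 0 ≤ C := (abs_nonneg _).trans (hη 0 _ (h.abs_le 0 0))
  simp only [weakForm_eq_of_support fun x t ht => (hN x t (Or.inr ht)).2]
  refine Tendsto.add ?_ ?_
  · refine tendsto_integral_integral (K := C * K + C * K) (R := N) (fun n => ?_) (fun n x t => ?_)
      (fun n x t hx => ?_) (ae_of_all _ fun t => ae_of_all _ fun x => ?_)
    · exact (((hηn n).measurable.comp h.measurable).mul hφ.continuous_timeDeriv.measurable).add
        (((hqn n).measurable.comp h.measurable).mul hφ.continuous_spaceDeriv.measurable)
    · refine (abs_add_le _ _).trans (add_le_add ?_ ?_) <;> rw [abs_mul]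
      · exact mul_le_mul (hη n _ (h.abs_le x t)) (hK x t).2.1 (abs_nonneg _) hC0
      · exact mul_le_mul (hq n _ (h.abs_le x t)) (hK x t).2.2 (abs_nonneg _) hC0
    · rw [(hN x t (Or.inl hx.le)).2.1, (hN x t (Or.inl hx.le)).2.2, mul_zero, mul_zero, add_zero]
    · exact ((hηlim _ (h.abs_le x t)).mul_const _).add ((hqlim _ (h.abs_le x t)).mul_const _)
  · have hi : Integrable ((Icc (-N) N).indicator fun _ : ℝ => C * K) :=
      (integrable_indicator_iff measurableSet_Icc).2 (integrableOn_const measure_Icc_lt_top.ne)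
    refine tendsto_integral_of_dominated_convergence _ (fun n =>
      (((hηn n).measurable.comp h.measurable_init).mul
        (hφ.continuous_slice 0).measurable).aestronglyMeasurable) hi
      (fun n => ae_of_all _ fun x => ?_) (ae_of_all _ fun x =>
        (hηlim _ (h.abs_init_le x)).mul_const _)
    by_cases hx : |x| ≤ N
    · rw [indicator_of_mem (show x ∈ Icc (-N) N from _root_.abs_le.1 hx), Real.norm_eq_abs, abs_mul]
      exact mul_le_mul (hη n _ (h.abs_init_le x)) (hK x 0).1 (abs_nonneg _) hC0
    · rw [(hN x 0 (Or.inl (not_le.1 hx).le)).1, mul_zero, norm_zero]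
      exact indicator_nonneg (fun _ _ => by positivity) x

lemma abs_primitive_le {g : ℝ → ℝ} {C : ℝ} (hC : ∀ w, |w| ≤ M → |g w| ≤ C) {v : ℝ} (hv : |v| ≤ M) :
    |primitive g v| ≤ C * M := by
  have h1 := abs_le.1 hv
  have hM : 0 ≤ M := (abs_nonneg v).trans hv
  have hC0 : 0 ≤ C := (abs_nonneg _).trans (hC v hv)
  have := intervalIntegral.norm_integral_le_of_norm_le_const (a := 0) (b := v) (f := g) (C := C)
    fun w hw => by
      rw [Real.norm_eq_abs]
      refine hC w (abs_le.2 ?_)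
      rcases le_total 0 v with h0 | h0
      · rw [uIoc_of_le h0] at hw
        exact ⟨by linarith [hw.1], hw.2.trans h1.2⟩
      · rw [uIoc_of_ge h0] at hw
        exact ⟨h1.1.trans hw.1.le, hw.2.trans hM⟩
  rw [Real.norm_eq_abs, sub_zero] at this
  exact this.trans (mul_le_mul_of_nonneg_left hv hC0)

lemma tendsto_primitive {gn : ℕ → ℝ → ℝ} {C : ℝ} (hm : ∀ n, Measurable (gn n))
    (hC : ∀ n v, |gn n v| ≤ C) (hlim : ∀ v, Tendsto (fun n => gn n v) atTop (𝓝 (g v)))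
    {F : ℝ → ℝ} (hF : Continuous F) (v : ℝ) :
    Tendsto (fun n => primitive (fun w => gn n w * F w) v) atTop
      (𝓝 (primitive (fun w => g w * F w) v)) := by
  refine intervalIntegral.tendsto_integral_filter_of_dominated_convergence (fun w => C * |F w|)
    (Eventually.of_forall fun n => ((hm n).mul hF.measurable).aestronglyMeasurable)
    (Eventually.of_forall fun n => ae_of_all _ fun w _ => ?_)
    ((continuous_const.mul hF.abs).intervalIntegrable _ _)
    (ae_of_all _ fun w _ => (hlim w).mul_const _)
  rw [Real.norm_eq_abs, abs_mul]
  exact mul_le_mul_of_nonneg_right (hC n w) (abs_nonneg _)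

/-- Every bounded monotone function is a limit of nonnegative combinations of sign functions, hence
admissible. -/
lemma admissible_of_monotone (h : WeakField f u₀ M U UL) (hf : ContDiff ℝ 1 f)
    (hK : KruzkovInequalities f u₀ U) (hg : Monotone g) {C : ℝ} (hC : ∀ v, |g v| ≤ C) :
    Admissible f u₀ U g := by
  refine ⟨hg.measurable, ⟨C, hC⟩, fun φ hφ hφ0 => ?_⟩
  have hadm := admissible_floor h hf hK hg hC
  set gn : ℕ → ℝ → ℝ := fun n v => ((n : ℝ) + 1)⁻¹ * ⌊((n : ℝ) + 1) * g v⌋ with hgn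
  have hclose : ∀ n v, |gn n v - g v| ≤ 1 / ((n : ℝ) + 1) := by
    intro n v
    have hn : (0 : ℝ) < (n : ℝ) + 1 := by positivity
    have h1 := Int.floor_le (((n : ℝ) + 1) * g v)
    have h2 := Int.lt_floor_add_one (((n : ℝ) + 1) * g v)
    have e : gn n v - g v = ((n : ℝ) + 1)⁻¹ * (⌊((n : ℝ) + 1) * g v⌋ - ((n : ℝ) + 1) * g v) := by
      rw [hgn, mul_sub, inv_mul_cancel_left₀ hn.ne']
    rw [e, abs_mul, abs_of_pos (inv_pos.2 hn), one_div]
    refine mul_le_of_le_one_right (inv_pos.2 hn).le (abs_le.2 ⟨by linarith, by linarith⟩)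
  have hlim : ∀ v, Tendsto (fun n => gn n v) atTop (𝓝 (g v)) := fun v => by
    rw [tendsto_iff_norm_sub_tendsto_zero]
    exact squeeze_zero (fun _ => norm_nonneg _) (fun n => hclose n v)
      tendsto_one_div_add_atTop_nhds_zero_nat
  have hbd : ∀ n v, |gn n v| ≤ C + 1 := by
    intro n v
    have h1 := abs_sub_abs_le_abs_sub (gn n v) (g v)
    have h2 : 1 / ((n : ℝ) + 1) ≤ 1 := by
      rw [div_le_one (by positivity)]; linarith [n.cast_nonneg (α := ℝ)]
    linarith [hclose n v, hC v]
  have hf' : Continuous (deriv f) := hf.continuous_deriv (by simp)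
  obtain ⟨D, hD0, hD⟩ := exists_abs_le_of_continuous hf' M
  have hC0 : 0 ≤ C := (abs_nonneg _).trans (hC 0)
  have hM0 : 0 ≤ M := (abs_nonneg _).trans (h.abs_le 0 0)
  have hcont := fun n => continuous_entropy_pair hf (hadm n).measurable (hbd n)
  refine ge_of_tendsto' (tendsto_weakForm h hφ (ηn := fun n => primitive (gn n))
    (qn := fun n => primitive fun v => gn n v * deriv f v) (C := (C + 1) * M + (C + 1) * D * M)
    (fun n => (hcont n).1) (fun n => (hcont n).2) (fun n v hv => ?_) (fun n v hv => ?_)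
    (fun v _ => ?_) fun v _ => ?_) fun n => (hadm n).nonneg φ hφ hφ0
  · refine (abs_primitive_le (fun w _ => hbd n w) hv).trans (le_add_of_nonneg_right (by positivity))
  · refine (abs_primitive_le (C := (C + 1) * D) (fun w hw => ?_) hv).trans
      (le_add_of_nonneg_left (by positivity))
    rw [abs_mul]
    exact mul_le_mul (hbd n w) (hD w hw) (abs_nonneg _) (by positivity)
  · simpa only [mul_one] using
      tendsto_primitive (fun n => (hadm n).measurable) hbd hlim (F := fun _ => 1) continuous_const v
  · exact tendsto_primitive (fun n => (hadm n).measurable) hbd hlim hf' v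

/-- The Kruzkov inequalities imply the entropy inequality for every convex entropy. -/
theorem WeakField.entropy_of_kruzkov (h : WeakField f u₀ M U UL) (hf : ContDiff ℝ 1 f)
    (hK : KruzkovInequalities f u₀ U) {η q : ℝ → ℝ} (hp : IsEntropyPair f η q) (hφ : IsTest φ)
    (hφ0 : ∀ x t, 0 ≤ t → 0 ≤ φ x t) : 0 ≤ weakForm η q u₀ U φ := by
  obtain ⟨hconv, hac, hq⟩ := hp
  have hηac : ∀ a b, AbsolutelyContinuousOnInterval η a b := fun a b => by
    obtain ⟨K, hK⟩ := (hconv.locallyLipschitz.locallyLipschitzOn (s := uIcc a b)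
      ).exists_lipschitzOnWith_of_compact isCompact_uIcc
    exact hK.absolutelyContinuousOnInterval
  -- The right derivative of the entropy, frozen outside `[-M, M]`.
  -- At kinks of `η` the value of `deriv η` is meaningless, while the right derivative is monotone.
  set r : ℝ → ℝ := fun v => derivWithin η (Ioi v) v with hr
  have hrm : Monotone r := by
    have := hconv.monotoneOn_rightDeriv
    rwa [interior_univ, monotoneOn_univ] at this
  have hM0 : 0 ≤ M := (abs_nonneg _).trans (h.abs_le 0 0)
  set g : ℝ → ℝ := fun v => r (max (-M) (min M v)) with hg
  have hgm : Monotone g := fun v w hvw =>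
    hrm (max_le_max le_rfl (min_le_min le_rfl hvw))
  have hgC : ∀ v, |g v| ≤ max |r (-M)| |r M| := fun v =>
    abs_le_max_abs_abs (hrm (le_max_left _ _)) (hrm (max_le (by linarith) (min_le_left _ _)))
  have hadm := admissible_of_monotone h hf hK hgm hgC
  have hge : ∀ᵐ v, |v| ≤ M → g v = deriv η v := by
    have hd := (hηac (-M) M).ae_differentiableAt
    filter_upwards [hd] with v hv hm
    have hmem : v ∈ Icc (-M) M := abs_le.1 hm
    have hd := hv (by rwa [uIcc_of_le (by linarith)])
    rw [hg]
    simp only [min_eq_right hmem.2, max_eq_right hmem.1]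
    exact (hd.hasDerivAt.hasDerivWithinAt.derivWithin (uniqueDiffWithinAt_Ioi v))
  have e1 : ∀ v, |v| ≤ M → η v = primitive g v + η 0 := by
    intro v hv
    rw [primitive_congr hge hv, primitive, (hηac 0 v).integral_deriv_eq_sub, sub_add_cancel]
  have e2 : ∀ v, |v| ≤ M → q v = primitive (fun v => g v * deriv f v) v + q 0 := by
    intro v hv
    have he : ∀ᵐ w, |w| ≤ M → g w * deriv f w = deriv q w := by
      filter_upwards [hge, hq] with w h1 h2 hw
      rw [h1 hw, h2.deriv]
    rw [primitive_congr he hv, primitive, (hac 0 v).integral_deriv_eq_sub, sub_add_cancel]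
  have hcont := continuous_entropy_pair hf hadm.measurable hgC
  rw [h.weakForm_congr_range e1 e2, weakForm_add_const h hcont.1 hcont.2 _ _ hφ]
  exact hadm.nonneg φ hφ hφ0

end Admissible

/-! ### The equivalence -/

lemma CadlagField.mono {M M' : ℝ} {U UL : ℝ → ℝ → ℝ} (hU : CadlagField M U UL) (h : M ≤ M') :
    CadlagField M' U UL :=
  { hU with
    abs_le := fun x t => (hU.abs_le x t).trans h
    abs_left_le := fun x t => (hU.abs_left_le x t).trans h }

lemma weakForm_congr_init {u₀ v₀ : ℝ → ℝ} (h : u₀ =ᵐ[volume] v₀) (η q : ℝ → ℝ) (u φ : ℝ → ℝ → ℝ) :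
    weakForm η q u₀ u φ = weakForm η q v₀ u φ := by
  unfold weakForm
  congr 1
  apply integral_congr_ae
  filter_upwards [h] with x hx
  rw [hx]

lemma exists_measurable_representative {u₀ : ℝ → ℝ} (h : MemLp u₀ ⊤ volume) :
    ∃ M v₀, Measurable v₀ ∧ (∀ x, |v₀ x| ≤ M) ∧ u₀ =ᵐ[volume] v₀ := by
  obtain ⟨M, hM⟩ : ∃ M : ℝ, ∀ᵐ x, |u₀ x| ≤ M := by
    refine ⟨(eLpNormEssSup u₀ volume).toReal, ?_⟩
    have h2 := h.2
    rw [eLpNorm_exponent_top] at h2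
    filter_upwards [ae_le_eLpNormEssSup (f := u₀) (μ := volume)] with x hx
    have := ENNReal.toReal_mono h2.ne hx
    simpa using this
  set w := h.1.mk u₀
  refine ⟨|M|, fun x => max (-|M|) (min |M| (w x)),
    measurable_const.max (measurable_const.min h.1.stronglyMeasurable_mk.measurable),
    fun x => abs_le.2 ⟨le_max_left _ _, max_le (by linarith [abs_nonneg M]) (min_le_left _ _)⟩, ?_⟩
  filter_upwards [hM, h.1.ae_eq_mk] with x h1 h2
  have h3 := abs_le.1 (h1.trans (le_abs_self M))
  have h2 : u₀ x = w x := h2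
  change u₀ x = max (-|M|) (min |M| (w x))
  rw [← h2, min_eq_right h3.2, max_eq_right h3.1]

/-- A bounded weak solution of locally bounded variation has a representative with one-sided
limits. -/
lemma exists_weakField {f u₀ : ℝ → ℝ} (hf : Continuous f) (hu₀ : MemLp u₀ ⊤ volume) {u : ℝ → ℝ → ℝ}
    (hu : IsBounded u) (hw : IsWeakSolution f u₀ u)
    (hbv : ∀ᵐ t : ℝ, 0 ≤ t → IsBVLoc fun x => u x t) :
    ∃ M v₀ U UL, WeakField f v₀ M U UL ∧ u₀ =ᵐ[volume] v₀ ∧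
      ∀ᵐ t : ℝ, 0 ≤ t → (fun x => u x t) =ᵐ[volume] fun x => U x t := by
  obtain ⟨M₁, v₀, hm, hb, he⟩ := exists_measurable_representative hu₀
  obtain ⟨M₂, U, UL, -, hU, hUu⟩ := exists_cadlagField hu hbv
  refine ⟨max M₁ M₂, v₀, U, UL, ⟨hU.mono (le_max_right _ _), hf, hm,
    fun x => (hb x).trans (le_max_left _ _), fun φ hφ => ?_⟩, he, hUu⟩
  rw [← weakForm_congr_init he, ← weakForm_congr hUu]
  exact hw φ hφ

/-- For a solution with one-sided limits, the Kruzkov inequalities are equivalent to uniqueness of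
the Filippov curves of all fields `a_c`. -/
theorem WeakField.kruzkovInequalities_iff {f u₀ : ℝ → ℝ} {M : ℝ} {U UL : ℝ → ℝ → ℝ}
    (h : WeakField f u₀ M U UL) (hf : ContDiff ℝ 1 f) {b : ℝ → ℝ → ℝ → ℝ}
    (hb : ∀ c, ∀ᵐ t : ℝ, 0 ≤ t → (fun x => b c x t) =ᵐ[volume] fun x => velocity f U c x t) :
    KruzkovInequalities f u₀ U ↔ ∀ c x s, 0 ≤ s → FilippovWellPosed (b c) x s := by
  constructor
  · intro hK c x s hs
    obtain ⟨Λ, ha⟩ := h.exists_velocity hf c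
    rw [ha.filippovWellPosed_iff hs (hb c)]
    intro X Y hX hY hXs hYs t ht
    exact hX.eq_of_kruzkov h hf hK hs hY (hXs.trans hYs.symm) ht
  · intro hwp c φ hφ hφ0
    obtain ⟨Λ, ha⟩ := h.exists_velocity hf c
    refine h.kruzkov_of_unique ha (fun s X Y hs hX hY hXY => ?_) hφ hφ0
    exact (ha.filippovWellPosed_iff hs (hb c) (X s)).1 (hwp c (X s) s hs) X Y hX hY rfl hXY.symm

end ConsLaw


theorem theorem1p1 (f : ℝ → ℝ) (hf : ContDiff ℝ 1 f)
    (u₀ : ℝ → ℝ) (hu₀_bv : ConsLaw.IsBVLoc u₀) (hu₀_bdd : MemLp u₀ ∞ volume)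
    (u : ℝ → ℝ → ℝ) (hu_bdd : ConsLaw.IsBounded u)
    (hu_weak : ConsLaw.IsWeakSolution f u₀ u)
    (hu_bv : ∀ᵐ t : ℝ, 0 ≤ t → ConsLaw.IsBVLoc (fun x => u x t)) :
    ConsLaw.IsEntropySolution f u₀ u ↔
      ∀ (c x s : ℝ), 0 ≤ s → ConsLaw.FilippovWellPosed (ConsLaw.velocity f u c) x s := by
  obtain ⟨M, v₀, U, UL, h, he, hU⟩ :=
    ConsLaw.exists_weakField hf.continuous hu₀_bdd hu_bdd hu_weak hu_bv
  have hform : ∀ η q φ, ConsLaw.weakForm η q u₀ u φ = ConsLaw.weakForm η q v₀ U φ := fun η q φ => by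
    rw [ConsLaw.weakForm_congr_init he, ConsLaw.weakForm_congr hU]
  rw [← h.kruzkovInequalities_iff hf (b := ConsLaw.velocity f u) fun c => by
    filter_upwards [hU] with t ht ht0
    filter_upwards [ht ht0] with x hx
    have hx : u x t = U x t := hx
    simp only [ConsLaw.velocity, hx]]
  constructor
  · rintro ⟨-, hent⟩ k φ hφ hφ0
    rw [← hform]
    exact hent _ _ (ConsLaw.isEntropyPair_kruzkov hf k) φ hφ hφ0
  · refine fun hK => ⟨hu_weak, fun η q hp φ hφ hφ0 => ?_⟩
    rw [hform]
    exact h.entropy_of_kruzkov hf hK hp hφ hφ0
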